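/- Let $G\rightrightarrows M$ be a Hausdorff Lie groupoid with source $s$ and range $r$ over a closed (compact, without boundary) manifold $M$, which is identified with the submanifold of units of $G$. Let $A=\ker(Ts)|_M$ be its Lie algebroid, with anchor $\rho=Tr|_A\colon A\to TM$ and bracket of sections induced from the Lie bracket of right-invariant vector fields on $G$. A bisection of $G$ is an embedded submanifold of $G$ on which $r$ and $s$ both restrict to diffeomorphisms onto $M$. Bisections form a group $\mathrm{Bis}(G)$ under the multiplication of arrows, and for a bisection $\gamma$ and $m\in M$ we write $\gamma m\in G$ for the unique arrow in $\gamma$ with source $m$. Let $K$ be a compact Lie group acting on $G$ by bisections, i.e. let $K\to\mathrm{Bis}(G)$ be a group homomorphism such that $K\times M\to G$, $(\gamma,m)\mapsto\gamma m$, is smooth. For $\gamma\in K$ let $M^\gamma=\{m\in M\mid \gamma m=m\}$, with inclusion $j\colon M^\gamma\hookrightarrow M$. Then, for every $\gamma\in K$: (1) $M^\gamma$ is an embedded submanifold of $M$ (its components may have different dimensions), and $\rho\colon A\to TM$ is transverse to $TM^\gamma$, i.e. $\rho(A_m)+T_mM^\gamma=T_mM$ for all $m\in M^\gamma$. (2)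 Consequently the pullback Lie algebroid $j^!A\to M^\gamma$ exists: the fibre product $j^!A=A\times_{TM}TM^\gamma$, with smooth sections the pairs $(a,v)$ of a smooth map $a\colon M^\gamma\to A$ over $j$ and a smooth vector field $v$ on $M^\gamma$ with $\rho(a)=v$, is a smooth vector bundle over $M^\gamma$, and carries a unique Lie algebroid structure whose anchor is the projection to $TM^\gamma$ and for which the projection $j^!A\to A$ is compatible with brackets, i.e. if $X,Y\in\Gamma(A)$ restrict on $M^\gamma$ to the $A$-components of the sections $\sigma,\tau$ of $j^!A$, then the $A$-component of $[\sigma,\tau]$ is $[X,Y]|_{M^\gamma}$. -/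

import Mathlib

open scoped Manifold ContDiff Topology

noncomputable section

section Submanifolds

variable {E : Type*} [NormedAddCommGroup E] [NormedSpace ℝ E]
  {M : Type*} [TopologicalSpace M] [ChartedSpace E M]

/-- `S ⊆ M` is an embedded submanifold of the (boundaryless, smooth) manifold `M`: around each of
its points there is a smooth chart of `M` in which `S` is cut out by a linear subspace. The
dimension of the subspace may depend on the point, that is, the connected components of `S` may
have different dimensions. -/
def IsEmbeddedSubmanifold (E : Type*) [NormedAddCommGroup E] [NormedSpace ℝ E]
    {M : Type*} [TopologicalSpace M] [ChartedSpace E M] (S : Set M) : Prop :=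
  ∀ x ∈ S, ∃ φ ∈ IsManifold.maximalAtlas 𝓘(ℝ, E) ∞ M, x ∈ φ.source ∧
    ∃ V : Submodule ℝ E, ∀ y ∈ φ.source, y ∈ S ↔ φ y ∈ V

/-- The set of velocities at `x` of smooth curves contained in `S` and passing through `x` at
time `0`. -/
def velocitySet (E : Type*) [NormedAddCommGroup E] [NormedSpace ℝ E]
    {M : Type*} [TopologicalSpace M] [ChartedSpace E M] (S : Set M) (x : M) :
    Set (TangentSpace 𝓘(ℝ, E) x) :=
  {v | ∃ c : ℝ → M, c 0 = x ∧
    (∃ ε > 0, ContMDiffOn 𝓘(ℝ, ℝ) 𝓘(ℝ, E) ∞ c (Set.Ioo (-ε) ε) ∧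
      ∀ t ∈ Set.Ioo (-ε) ε, c t ∈ S) ∧
    (mfderiv 𝓘(ℝ, ℝ) 𝓘(ℝ, E) c 0 (1 : ℝ) : E) = v}

/-- The tangent space `T_x S ⊆ T_x M`, spanned by the velocities of curves in `S`. (When `S` is an
embedded submanifold, the velocities already form a linear subspace.) -/
def tangentSub (E : Type*) [NormedAddCommGroup E] [NormedSpace ℝ E]
    {M : Type*} [TopologicalSpace M] [ChartedSpace E M] (S : Set M) (x : M) :
    Submodule ℝ (TangentSpace 𝓘(ℝ, E) x) :=
  Submodule.span ℝ (velocitySet E S x)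

/-- A map `f` defined on a subset `S` of `M` is smooth near `x ∈ S`: it is locally the restriction
of a smooth map defined on an open neighbourhood of `x` in `M`. -/
def SmoothNear {S : Set M} {E' : Type*} [NormedAddCommGroup E'] [NormedSpace ℝ E']
    {H' : Type*} [TopologicalSpace H'] (J : ModelWithCorners ℝ E' H')
    {N : Type*} [TopologicalSpace N] [ChartedSpace H' N] (f : S → N) (x : S) : Prop :=
  ∃ U : Set M, IsOpen U ∧ (x : M) ∈ U ∧
    ∃ F : M → N, ContMDiffOn 𝓘(ℝ, E) J ∞ F U ∧ ∀ y : S, (y : M) ∈ U → F y = f y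

/-- A smooth map on a subset `S` of `M`. For an embedded submanifold `S` these are the maps that
are smooth for its manifold structure. -/
def SmoothOnSub {S : Set M} {E' : Type*} [NormedAddCommGroup E'] [NormedSpace ℝ E']
    {H' : Type*} [TopologicalSpace H'] (J : ModelWithCorners ℝ E' H')
    {N : Type*} [TopologicalSpace N] [ChartedSpace H' N] (f : S → N) : Prop :=
  ∀ x : S, SmoothNear (E := E) J f x

variable [IsManifold 𝓘(ℝ, E) ∞ M]

/-- A Lie algebroid over an embedded submanifold `Q` of `M`, with fibres `V q`. The smooth vector
bundle with these fibres is presented by its space `sections` of global smooth sections, which is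
a `C^∞(Q)`-module, is local, and has a local frame around each point. -/
structure LieAlgebroid (E : Type*) [NormedAddCommGroup E] [NormedSpace ℝ E]
    {M : Type*} [TopologicalSpace M] [ChartedSpace E M] [IsManifold 𝓘(ℝ, E) ∞ M]
    (Q : Set M) (V : Q → Type*) [∀ q, AddCommGroup (V q)] [∀ q, Module ℝ (V q)] where
  /-- the smooth sections of the vector bundle -/
  sections : Submodule ℝ (∀ q : Q, V q)
  smul_mem : ∀ (f : Q → ℝ), SmoothOnSub (E := E) 𝓘(ℝ, ℝ) f →
    ∀ X ∈ sections, (fun q => f q • X q) ∈ sections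
  mem_of_local : ∀ X : (∀ q : Q, V q),
    (∀ q₀ : Q, ∃ U : Set M, IsOpen U ∧ (q₀ : M) ∈ U ∧
      ∃ Y ∈ sections, ∀ q : Q, (q : M) ∈ U → X q = Y q) → X ∈ sections
  exists_frame : ∀ q₀ : Q, ∃ U : Set M, IsOpen U ∧ (q₀ : M) ∈ U ∧
    ∃ (k : ℕ) (e : Fin k → ∀ q : Q, V q), (∀ i, e i ∈ sections) ∧
      (∀ q : Q, (q : M) ∈ U → LinearIndependent ℝ (fun i => e i q) ∧
        Submodule.span ℝ (Set.range fun i => e i q) = ⊤) ∧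
      ∀ X ∈ sections, ∃ c : Fin k → Q → ℝ, ∀ q : Q, (q : M) ∈ U →
        X q = ∑ i, c i q • e i q ∧ ∀ i, SmoothNear (E := E) 𝓘(ℝ, ℝ) (c i) q
  /-- the anchor, a vector bundle map to `TQ` -/
  anchor : ∀ q : Q, V q →ₗ[ℝ] TangentSpace 𝓘(ℝ, E) (q : M)
  anchor_mem : ∀ (q : Q) (v : V q), anchor q v ∈ tangentSub E Q (q : M)
  anchor_smooth : ∀ X ∈ sections, SmoothOnSub (E := E) 𝓘(ℝ, E).tangent
    (fun q : Q => (⟨(q : M), anchor q (X q)⟩ : TangentBundle 𝓘(ℝ, E) M))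
  /-- the Lie bracket of sections -/
  bracket : sections →ₗ[ℝ] sections →ₗ[ℝ] sections
  bracket_self : ∀ X, bracket X X = 0
  jacobi : ∀ X Y Z, bracket X (bracket Y Z) = bracket (bracket X Y) Z + bracket Y (bracket X Z)
  /-- `[X, f Y] = f [X, Y] + (ρ(X) f) Y`. The derivative of `f ∈ C^∞(Q)` at `q` in the direction
  of a vector tangent to `Q` is computed with any local extension `F` of `f` to `M`. -/
  leibniz : ∀ (X Y : sections) (f : Q → ℝ) (hf : SmoothOnSub (E := E) 𝓘(ℝ, ℝ) f)
    (q : Q) (F : M → ℝ), ContMDiffAt 𝓘(ℝ, E) 𝓘(ℝ, ℝ) ∞ F (q : M) →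
    (∀ᶠ m in 𝓝 (q : M), ∀ hm : m ∈ Q, F m = f ⟨m, hm⟩) →
    (bracket X ⟨fun p => f p • Y.1 p, smul_mem f hf Y.1 Y.2⟩).1 q =
      f q • (bracket X Y).1 q +
        (show ℝ from mfderiv 𝓘(ℝ, E) 𝓘(ℝ, ℝ) F (q : M) (anchor q (X.1 q))) • Y.1 q

end Submanifolds

/-- A Lie groupoid `(r, s) : G ⇉ M`. The product `mul g h` is meaningful only for composable pairs,
`s g = r h`; its values elsewhere are irrelevant. As `s` is a submersion, the composable pairs form
an embedded submanifold of `G × G`, on which the product is required to be smooth. -/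
structure LieGroupoid (EM EG : Type*) [NormedAddCommGroup EM] [NormedSpace ℝ EM]
    [NormedAddCommGroup EG] [NormedSpace ℝ EG]
    (M G : Type*) [TopologicalSpace M] [ChartedSpace EM M] [TopologicalSpace G]
    [ChartedSpace EG G] where
  /-- source -/
  s : G → M
  /-- range -/
  r : G → M
  /-- units -/
  u : M → G
  /-- inversion of arrows -/
  inv : G → G
  /-- composition of arrows -/
  mul : G → G → G
  s_unit : ∀ m, s (u m) = m
  r_unit : ∀ m, r (u m) = m
  s_mul : ∀ g h, s g = r h → s (mul g h) = s h
  r_mul : ∀ g h, s g = r h → r (mul g h) = r g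
  mul_assoc : ∀ g h k, s g = r h → s h = r k → mul (mul g h) k = mul g (mul h k)
  unit_mul : ∀ g, mul (u (r g)) g = g
  mul_unit : ∀ g, mul g (u (s g)) = g
  s_inv : ∀ g, s (inv g) = r g
  r_inv : ∀ g, r (inv g) = s g
  mul_inv : ∀ g, mul g (inv g) = u (r g)
  inv_mul : ∀ g, mul (inv g) g = u (s g)
  s_submersion : Manifold.IsSubmersion 𝓘(ℝ, EG) 𝓘(ℝ, EM) ∞ s
  r_submersion : Manifold.IsSubmersion 𝓘(ℝ, EG) 𝓘(ℝ, EM) ∞ r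
  u_smooth : ContMDiff 𝓘(ℝ, EM) 𝓘(ℝ, EG) ∞ u
  inv_smooth : ContMDiff 𝓘(ℝ, EG) 𝓘(ℝ, EG) ∞ inv
  mul_smooth : ContMDiffOn (𝓘(ℝ, EG).prod 𝓘(ℝ, EG)) 𝓘(ℝ, EG) ∞
    (fun p : G × G => mul p.1 p.2) {p | s p.1 = r p.2}

namespace LieGroupoid

variable {EM EG : Type*} [NormedAddCommGroup EM] [NormedSpace ℝ EM]
  [NormedAddCommGroup EG] [NormedSpace ℝ EG]
  {M G : Type*} [TopologicalSpace M] [ChartedSpace EM M] [TopologicalSpace G] [ChartedSpace EG G]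
  (𝒢 : LieGroupoid EM EG M G)

/-- The fibre `A_m = ker (T_m s)` of the Lie algebroid of `𝒢`, where `m` is regarded as a unit. -/
def algFiber (m : M) : Submodule ℝ (TangentSpace 𝓘(ℝ, EG) (𝒢.u m)) :=
  LinearMap.ker (mfderiv 𝓘(ℝ, EG) 𝓘(ℝ, EM) 𝒢.s (𝒢.u m)).toLinearMap

/-- The derivative `T r : T_m G → T_m M` at the unit `m` (recall that `r (u m) = m`). -/
def rangeDeriv (m : M) : TangentSpace 𝓘(ℝ, EG) (𝒢.u m) →ₗ[ℝ] TangentSpace 𝓘(ℝ, EM) m :=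
  show EG →ₗ[ℝ] EM from (mfderiv 𝓘(ℝ, EG) 𝓘(ℝ, EM) 𝒢.r (𝒢.u m)).toLinearMap

/-- The anchor `ρ = T r|_A : A_m → T_m M`. -/
def anchor (m : M) : 𝒢.algFiber m →ₗ[ℝ] TangentSpace 𝓘(ℝ, EM) m :=
  𝒢.rangeDeriv m ∘ₗ (𝒢.algFiber m).subtype

/-- The right-invariant vector field `X^R(g) = T R_g (X (r g))` of a section `X` of `A`, where
`R_g : h ↦ h g` is defined on the submanifold `s⁻¹(r g)` of `G`, whose tangent space at the unit
`r g` is `A_{r g}`. (A derivative within a submanifold is determined on vectors tangent to it.) -/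
def rightInvariant (X : ∀ m : M, TangentSpace 𝓘(ℝ, EG) (𝒢.u m)) (g : G) :
    TangentSpace 𝓘(ℝ, EG) g :=
  show EG from mfderivWithin 𝓘(ℝ, EG) 𝓘(ℝ, EG) (fun h => 𝒢.mul h g) {h | 𝒢.s h = 𝒢.r g}
    (𝒢.u (𝒢.r g)) (X (𝒢.r g))

/-- The Lie bracket of sections of `A`, `[X, Y] = [X^R, Y^R]|_M`. -/
def algBracket (X Y : ∀ m : M, TangentSpace 𝓘(ℝ, EG) (𝒢.u m)) (m : M) :
    TangentSpace 𝓘(ℝ, EG) (𝒢.u m) :=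
  VectorField.mlieBracket 𝓘(ℝ, EG) (𝒢.rightInvariant X) (𝒢.rightInvariant Y) (𝒢.u m)

/-- `X` is a smooth section of the Lie algebroid `A → M`. -/
def IsAlgSection [IsManifold 𝓘(ℝ, EG) ∞ G] (X : ∀ m : M, TangentSpace 𝓘(ℝ, EG) (𝒢.u m)) : Prop :=
  (∀ m, X m ∈ 𝒢.algFiber m) ∧
    ContMDiff 𝓘(ℝ, EM) 𝓘(ℝ, EG).tangent ∞
      (fun m : M => (⟨𝒢.u m, X m⟩ : TangentBundle 𝓘(ℝ, EG) G))

/-- The anchor `ρ : A → TM` is transverse to `TQ`. -/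
def AnchorTransverse (Q : Set M) : Prop :=
  ∀ m ∈ Q, LinearMap.range (𝒢.anchor m) ⊔ tangentSub EM Q m = ⊤

/-- The fibre at `q` of `j^!A = A ×_{TM} TQ`: pairs `(a, v) ∈ A_q × T_q Q` with `ρ a = v`. -/
def pullbackFiber (Q : Set M) (q : Q) :
    Submodule ℝ (TangentSpace 𝓘(ℝ, EG) (𝒢.u (q : M)) × TangentSpace 𝓘(ℝ, EM) (q : M)) :=
  (𝒢.algFiber (q : M)).prod (tangentSub EM Q (q : M)) ⊓
    LinearMap.eqLocus (𝒢.rangeDeriv (q : M) ∘ₗ LinearMap.fst ℝ _ _) (LinearMap.snd ℝ _ _)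

/-- `L` is the pullback Lie algebroid `j^!A` along the inclusion `j : Q → M`: the vector bundle is
`A ×_{TM} TQ`, with the smooth structure induced from `A × TM`, the anchor is the projection to
`TQ`, and the projection `j^!A → A` is compatible with the brackets. -/
structure IsPullback [IsManifold 𝓘(ℝ, EM) ∞ M] [IsManifold 𝓘(ℝ, EG) ∞ G] (Q : Set M)
    (L : LieAlgebroid EM Q (fun q => 𝒢.pullbackFiber Q q)) : Prop where
  mem_sections : ∀ σ : (∀ q : Q, 𝒢.pullbackFiber Q q), σ ∈ L.sections ↔
    SmoothOnSub (E := EM) 𝓘(ℝ, EG).tangent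
      (fun q : Q => (⟨𝒢.u (q : M), (σ q).1.1⟩ : TangentBundle 𝓘(ℝ, EG) G)) ∧
    SmoothOnSub (E := EM) 𝓘(ℝ, EM).tangent
      (fun q : Q => (⟨(q : M), (σ q).1.2⟩ : TangentBundle 𝓘(ℝ, EM) M))
  anchor_eq : ∀ (q : Q) (x : 𝒢.pullbackFiber Q q), L.anchor q x = x.1.2
  bracket_eq : ∀ (σ τ : L.sections) (X Y : ∀ m : M, TangentSpace 𝓘(ℝ, EG) (𝒢.u m)),
    𝒢.IsAlgSection X → 𝒢.IsAlgSection Y →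
    (∀ q : Q, (σ.1 q).1.1 = X (q : M)) → (∀ q : Q, (τ.1 q).1.1 = Y (q : M)) →
    ∀ q : Q, ((L.bracket σ τ).1 q).1.1 = 𝒢.algBracket X Y (q : M)

/-- A bisection of `𝒢`: an embedded submanifold of `G` on which both `s` and `r` restrict to
diffeomorphisms onto `M`; `sInv` and `rInv` are the inverse diffeomorphisms. -/
structure Bisection where
  /-- the underlying submanifold of `G` -/
  carrier : Set G
  embedded : IsEmbeddedSubmanifold EG carrier
  /-- inverse of `s` restricted to the bisection -/
  sInv : M → G
  sInv_mem : ∀ m, sInv m ∈ carrier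
  s_sInv : ∀ m, 𝒢.s (sInv m) = m
  sInv_s : ∀ g ∈ carrier, sInv (𝒢.s g) = g
  sInv_smooth : ContMDiff 𝓘(ℝ, EM) 𝓘(ℝ, EG) ∞ sInv
  /-- inverse of `r` restricted to the bisection -/
  rInv : M → G
  rInv_mem : ∀ m, rInv m ∈ carrier
  r_rInv : ∀ m, 𝒢.r (rInv m) = m
  rInv_r : ∀ g ∈ carrier, rInv (𝒢.r g) = g
  rInv_smooth : ContMDiff 𝓘(ℝ, EM) 𝓘(ℝ, EG) ∞ rInv

/-- The product of two sets of arrows, `S T = {g h | g ∈ S, h ∈ T composable}`. -/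
def mulSet (S T : Set G) : Set G :=
  {x | ∃ g ∈ S, ∃ h ∈ T, 𝒢.s g = 𝒢.r h ∧ x = 𝒢.mul g h}

variable {𝒢} in
/-- Left multiplication `γ g` of an arrow `g` by a bisection `γ`: the composition of `g` with the
unique arrow in `γ` whose source is `r g`. -/
def Bisection.leftMul (γ : 𝒢.Bisection) (g : G) : G := 𝒢.mul (γ.sInv (𝒢.r g)) g

variable {𝒢} in
/-- The fixed set `M^γ = {m ∈ M | γ m = m}`, where `M` is regarded as the set of units in `G`. -/
def Bisection.fixedSet (γ : 𝒢.Bisection) : Set M := {m | γ.leftMul (𝒢.u m) = 𝒢.u m}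

/-- An action of the Lie group `K` on `𝒢` by bisections: a homomorphism from `K` to the group of
bisections (with the product induced by the product of arrows, so that the neutral element is the
set of units), such that `(k, m) ↦ k m` is a smooth map `K × M → G`. -/
structure BisectionAction (EK : Type*) [NormedAddCommGroup EK] [NormedSpace ℝ EK]
    (K : Type*) [TopologicalSpace K] [ChartedSpace EK K] [Group K] where
  /-- the bisection by which a group element acts -/
  bis : K → 𝒢.Bisection
  bis_one : (bis 1).carrier = Set.range 𝒢.u
  bis_mul : ∀ k l, (bis (k * l)).carrier = 𝒢.mulSet (bis k).carrier (bis l).carrier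
  smooth : ContMDiff (𝓘(ℝ, EK).prod 𝓘(ℝ, EM)) 𝓘(ℝ, EG) ∞
    (fun p : K × M => (bis p.1).leftMul (𝒢.u p.2))

end LieGroupoid

end

/-! Let `γ` act on all of `G` by left multiplication. This preserves `s`, and it fixes every arrow
whose range lies in `M^γ`. At a unit `x` over `M^γ` let `L` be the derivative of the action. Its
powers are derivatives at `x` of elements of the stabilizer of `x`, a compact set, so they are
bounded (`exists_bound_and_eventually_act_eq`). Hence the tangent space is the direct sum of `P =
ker (L - 1)` and `R = im (L - 1)` (`isCompl_ker_range_sub_one`). Neither an invariant metric nor a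
linearization of the action is needed.

Project the displacement of a unit, measured in a chart at `x`, to `R` along `P`. If the projection
vanishes, the displacement `w` is fixed by `L`; by an estimate uniform over the stabilizer the
`n`-th iterate moves the point by `n w` up to an error `n ‖w‖ / 2`, while the orbit stays bounded,
so `w = 0` (`eventually_apply_eq_self`). Thus `M^γ` is locally the zero set of an `R`-valued map.
Since `L` is the identity on `ker Tr`, the operator `L - 1` takes all its values on vectors tangent
to the units, so this map is a submersion and `M^γ` is embedded. To see transversality, split `Tu v
= p + (L - 1) w` with `p ∈ P`: the second term lies in `A` because the action preserves `s`, and `Tr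
p` is tangent to `M^γ` (`exists_chart_fixedSet`).

The second half holds for every closed embedded `Q` transverse to the anchor. The fibres of `j^!A`
are kernels of a smooth family of linear maps, surjective at a given point of `Q` by transversality
and therefore nearby, so local frames exist (`exists_local_frame`). The bracket is computed from
global extensions of sections (`exists_isAlgSection_extension`). It is independent of them because
two extensions give right-invariant fields which agree on `r⁻¹(Q)`, to which the other field is
tangent at units over `Q` (`sectionBracket_of_eq_smul`, `sectionBracket_congr`). It is tangent to
`Q` again because `X^R` is `r`-related to `ρ(X)`. The Jacobi and Leibniz identities come from vector
fields on `G`, and uniqueness from the existence of extensions. -/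

noncomputable section

set_option linter.unusedSectionVars false

/-! ### Derivatives, vector fields along maps, and Lie brackets read in charts. -/

section TangentCalculus

open Bundle Filter VectorField

variable (E E' E'' : Type*) [NormedAddCommGroup E] [NormedSpace ℝ E]
  [NormedAddCommGroup E'] [NormedSpace ℝ E'] [NormedAddCommGroup E''] [NormedSpace ℝ E'']
  {M N O : Type*} [TopologicalSpace M] [ChartedSpace E M] [TopologicalSpace N] [ChartedSpace E' N]
  [TopologicalSpace O] [ChartedSpace E'' O]

/-- The derivative of a map between boundaryless manifolds, as a continuous linear map between the
model spaces. -/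
def tderiv (f : M → N) (x : M) : E →L[ℝ] E' := mfderiv 𝓘(ℝ, E) 𝓘(ℝ, E') f x

variable {E E' E''}

theorem tderiv_comp {g : N → O} {f : M → N} {x : M}
    (hg : MDifferentiableAt 𝓘(ℝ, E') 𝓘(ℝ, E'') g (f x))
    (hf : MDifferentiableAt 𝓘(ℝ, E) 𝓘(ℝ, E') f x) :
    tderiv E E'' (fun y => g (f y)) x = (tderiv E' E'' g (f x)).comp (tderiv E E' f x) :=
  mfderiv_comp x hg hf

theorem tderiv_comp_apply {g : N → O} {f : M → N} {x : M}
    (hg : MDifferentiableAt 𝓘(ℝ, E') 𝓘(ℝ, E'') g (f x))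
    (hf : MDifferentiableAt 𝓘(ℝ, E) 𝓘(ℝ, E') f x) (v : E) :
    tderiv E E'' (fun y => g (f y)) x v = tderiv E' E'' g (f x) (tderiv E E' f x v) := by
  rw [tderiv_comp hg hf]; rfl

theorem tderiv_congr {f g : M → N} {x : M} (h : f =ᶠ[𝓝 x] g) :
    tderiv E E' f x = tderiv E E' g x :=
  h.mfderiv_eq

theorem tderiv_id (x : M) : tderiv E E (fun y : M => y) x = ContinuousLinearMap.id ℝ E :=
  mfderiv_id

theorem tderiv_const (x : M) (c : N) : tderiv E E' (fun _ : M => c) x = 0 :=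
  mfderiv_const

theorem tderiv_eq_fderiv (f : E → E') (x : E) : tderiv E E' f x = fderiv ℝ f x :=
  mfderiv_eq_fderiv

theorem HasMFDerivAt.tderiv_eq {f : M → N} {x : M} {f' : E →L[ℝ] E'}
    (h : HasMFDerivAt 𝓘(ℝ, E) 𝓘(ℝ, E') f x f') : tderiv E E' f x = f' := h.mfderiv

theorem HasFDerivAt.tderiv_eq {f : E → E'} {x : E} {f' : E →L[ℝ] E'}
    (h : HasFDerivAt f f' x) : tderiv E E' f x = f' := by
  rw [tderiv_eq_fderiv, h.fderiv]

theorem ContMDiffAt.mdiff {EP HP P : Type*} [NormedAddCommGroup EP]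
    [NormedSpace ℝ EP] [TopologicalSpace HP] {J : ModelWithCorners ℝ EP HP} [TopologicalSpace P]
    [ChartedSpace HP P] {EQ HQ Q : Type*} [NormedAddCommGroup EQ]
    [NormedSpace ℝ EQ] [TopologicalSpace HQ] {J' : ModelWithCorners ℝ EQ HQ} [TopologicalSpace Q]
    [ChartedSpace HQ Q] {f : P → Q} {x : P} (h : ContMDiffAt J J' ∞ f x) :
    MDifferentiableAt J J' f x := h.mdifferentiableAt (by simp)

theorem ContMDiffAt.eventually_mdiff [IsManifold 𝓘(ℝ, E) ∞ M] [IsManifold 𝓘(ℝ, E') ∞ N]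
    {f : M → N} {x : M} (h : ContMDiffAt 𝓘(ℝ, E) 𝓘(ℝ, E') ∞ f x) :
    ∀ᶠ y in 𝓝 x, MDifferentiableAt 𝓘(ℝ, E) 𝓘(ℝ, E') f y := by
  have : IsManifold 𝓘(ℝ, E) 1 M := .of_le (n := ∞) (by simp)
  have : IsManifold 𝓘(ℝ, E') 1 N := .of_le (n := ∞) (by simp)
  have h1 : ContMDiffAt 𝓘(ℝ, E) 𝓘(ℝ, E') 1 f x := h.of_le (by simp)
  filter_upwards [(contMDiffAt_iff_contMDiffAt_nhds (by simp)).1 h1] with y hy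
  exact hy.mdifferentiableAt (by simp)

section Chart

variable [IsManifold 𝓘(ℝ, E) ∞ M] {φ : OpenPartialHomeomorph M E}

theorem mdifferentiableAt_chart (hφ : φ ∈ IsManifold.maximalAtlas 𝓘(ℝ, E) ∞ M) {x : M}
    (hx : x ∈ φ.source) : MDifferentiableAt 𝓘(ℝ, E) 𝓘(ℝ, E) φ x :=
  (contMDiffAt_of_mem_maximalAtlas hφ hx).mdiff

theorem mdifferentiableAt_chart_symm (hφ : φ ∈ IsManifold.maximalAtlas 𝓘(ℝ, E) ∞ M) {y : E}
    (hy : y ∈ φ.target) : MDifferentiableAt 𝓘(ℝ, E) 𝓘(ℝ, E) φ.symm y :=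
  (contMDiffAt_symm_of_mem_maximalAtlas hφ hy).mdiff

theorem tderiv_symm_tderiv (hφ : φ ∈ IsManifold.maximalAtlas 𝓘(ℝ, E) ∞ M) {x : M}
    (hx : x ∈ φ.source) (v : E) :
    tderiv E E φ.symm (φ x) (tderiv E E φ x v) = v := by
  rw [← tderiv_comp_apply (mdifferentiableAt_chart_symm hφ (φ.map_source hx))
    (mdifferentiableAt_chart hφ hx),
    tderiv_congr (g := fun y => y), tderiv_id]
  · rfl
  · filter_upwards [φ.open_source.mem_nhds hx] with y hy using φ.left_inv hy

theorem tderiv_tderiv_symm (hφ : φ ∈ IsManifold.maximalAtlas 𝓘(ℝ, E) ∞ M) {x : M}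
    (hx : x ∈ φ.source) (v : E) :
    tderiv E E φ x (tderiv E E φ.symm (φ x) v) = v := by
  have h1 := mdifferentiableAt_chart hφ hx
  have h2 := φ.left_inv hx
  have h3 : MDifferentiableAt 𝓘(ℝ, E) 𝓘(ℝ, E) φ (φ.symm (φ x)) := by rwa [h2]
  have := tderiv_comp_apply h3 (mdifferentiableAt_chart_symm hφ (φ.map_source hx)) v
  rw [h2] at this
  rw [← this, tderiv_congr (g := fun y => y), tderiv_id]
  · rfl
  · filter_upwards [φ.open_target.mem_nhds (φ.map_source hx)] with y hy using φ.right_inv hy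

end Chart

section Field

variable {EP HP P : Type*} [NormedAddCommGroup EP]
  [NormedSpace ℝ EP] [TopologicalSpace HP] {J : ModelWithCorners ℝ EP HP} [TopologicalSpace P]
  [ChartedSpace HP P]

/-- The vector field `v` along the map `b : P → M` is smooth at `p`. -/
def SmoothAlongAt (E : Type*) [NormedAddCommGroup E] [NormedSpace ℝ E] {M : Type*}
    [TopologicalSpace M] [ChartedSpace E M] [IsManifold 𝓘(ℝ, E) ∞ M]
    {EP HP P : Type*} [NormedAddCommGroup EP] [NormedSpace ℝ EP] [TopologicalSpace HP]
    (J : ModelWithCorners ℝ EP HP)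
    [TopologicalSpace P] [ChartedSpace HP P] (b : P → M) (v : P → E) (p : P) : Prop :=
  ContMDiffAt J 𝓘(ℝ, E).tangent ∞ (fun p => (⟨b p, v p⟩ : TangentBundle 𝓘(ℝ, E) M)) p

variable [IsManifold 𝓘(ℝ, E) ∞ M] [IsManifold 𝓘(ℝ, E') ∞ N]

theorem SmoothAlongAt.congr {b b' : P → M} {v v' : P → E} {p : P} (h : SmoothAlongAt E J b v p)
    (hb : b' =ᶠ[𝓝 p] b) (hv : v' =ᶠ[𝓝 p] v) : SmoothAlongAt E J b' v' p := by
  unfold SmoothAlongAt at h ⊢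
  refine h.congr_of_eventuallyEq ?_
  filter_upwards [hb, hv] with q h1 h2
  rw [h1, h2]

theorem SmoothAlongAt.comp {EQ HQ Q : Type*} [NormedAddCommGroup EQ]
    [NormedSpace ℝ EQ] [TopologicalSpace HQ] {J' : ModelWithCorners ℝ EQ HQ} [TopologicalSpace Q]
    [ChartedSpace HQ Q] {b : P → M} {v : P → E} {f : Q → P} {q : Q}
    (h : SmoothAlongAt E J b v (f q)) (hf : ContMDiffAt J' J ∞ f q) :
    SmoothAlongAt E J' (fun q => b (f q)) (fun q => v (f q)) q :=
  ContMDiffAt.comp q (g := fun p => (⟨b p, v p⟩ : TangentBundle 𝓘(ℝ, E) M)) h hf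

theorem SmoothAlongAt.base {b : P → M} {v : P → E} {p : P} (h : SmoothAlongAt E J b v p) :
    ContMDiffAt J 𝓘(ℝ, E) ∞ b p := by
  unfold SmoothAlongAt at h
  exact (contMDiffAt_totalSpace.1 h).1

theorem SmoothAlongAt.pushforward {b : P → M} {v : P → E} {p : P} (h : SmoothAlongAt E J b v p)
    {f : M → N} (hf : ContMDiffAt 𝓘(ℝ, E) 𝓘(ℝ, E') ∞ f (b p)) :
    SmoothAlongAt E' J (fun q => f (b q)) (fun q => tderiv E E' f (b q) (v q)) p := by
  have : IsManifold 𝓘(ℝ, E) 1 M := .of_le (n := ∞) (by simp)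
  have : IsManifold 𝓘(ℝ, E') 1 N := .of_le (n := ∞) (by simp)
  have h0 := h.base
  unfold SmoothAlongAt at h ⊢
  have A := hf.mfderiv_const (m := ∞) (by simp)
  exact ContMDiffAt.clm_apply_of_inCoordinates (𝕜 := ℝ) (b₁ := b) (b₂ := fun q => f (b q))
    (ϕ := fun q => mfderiv 𝓘(ℝ, E) 𝓘(ℝ, E') f (b q)) (v := v)
    (ContMDiffAt.comp p A h0) h (hf.comp p h0)

theorem smoothAlongAt_model_iff {b : P → E} {v : P → E} {p : P} :
    SmoothAlongAt E J b v p ↔ ContMDiffAt J 𝓘(ℝ, E) ∞ b p ∧ ContMDiffAt J 𝓘(ℝ, E) ∞ v p := by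
  unfold SmoothAlongAt
  rw [contMDiffAt_totalSpace]
  refine and_congr_right fun _ => ?_
  simp only [trivializationAt_model_space_apply]

/-- Any chart of the maximal atlas may serve to test smoothness, not only the preferred ones. This
makes charts adapted to a submersion or a submanifold available. -/
theorem smoothAlongAt_iff_of_chart {φ : OpenPartialHomeomorph M E}
    (hφ : φ ∈ IsManifold.maximalAtlas 𝓘(ℝ, E) ∞ M) {b : P → M} {v : P → E} {p : P}
    (hp : b p ∈ φ.source) :
    SmoothAlongAt E J b v p ↔ ContMDiffAt J 𝓘(ℝ, E) ∞ b p ∧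
      ContMDiffAt J 𝓘(ℝ, E) ∞ (fun q => tderiv E E φ (b q) (v q)) p := by
  constructor
  · intro h
    exact ⟨h.base, (smoothAlongAt_model_iff.1
      (h.pushforward (contMDiffAt_of_mem_maximalAtlas hφ hp))).2⟩
  · rintro ⟨h1, h2⟩
    have h3 : SmoothAlongAt E J (fun q => φ (b q)) (fun q => tderiv E E φ (b q) (v q)) p :=
      smoothAlongAt_model_iff.2 ⟨(contMDiffAt_of_mem_maximalAtlas hφ hp).comp p h1, h2⟩
    have h4 := h3.pushforward (contMDiffAt_symm_of_mem_maximalAtlas hφ (φ.map_source hp))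
    have h5 : ∀ᶠ q in 𝓝 p, b q ∈ φ.source :=
      h1.continuousAt.eventually (φ.open_source.mem_nhds hp)
    refine h4.congr ?_ ?_
    · filter_upwards [h5] with q hq using (φ.left_inv hq).symm
    · filter_upwards [h5] with q hq using (tderiv_symm_tderiv hφ hq _).symm

theorem SmoothAlongAt.add {b : P → M} {v w : P → E} {p : P} (hv : SmoothAlongAt E J b v p)
    (hw : SmoothAlongAt E J b w p) : SmoothAlongAt E J b (fun q => v q + w q) p := by
  have hs := mem_chart_source E (b p)
  have hc := IsManifold.chart_mem_maximalAtlas (I := 𝓘(ℝ, E)) (n := ∞) (b p)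
  rw [smoothAlongAt_iff_of_chart hc hs] at *
  simp only [map_add]
  exact ⟨hv.1, hv.2.add hw.2⟩

theorem SmoothAlongAt.sub {b : P → M} {v w : P → E} {p : P} (hv : SmoothAlongAt E J b v p)
    (hw : SmoothAlongAt E J b w p) : SmoothAlongAt E J b (fun q => v q - w q) p := by
  have hs := mem_chart_source E (b p)
  have hc := IsManifold.chart_mem_maximalAtlas (I := 𝓘(ℝ, E)) (n := ∞) (b p)
  rw [smoothAlongAt_iff_of_chart hc hs] at *
  simp only [map_sub]
  exact ⟨hv.1, hv.2.sub hw.2⟩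

theorem SmoothAlongAt.smul {b : P → M} {v : P → E} {f : P → ℝ} {p : P}
    (hf : ContMDiffAt J 𝓘(ℝ, ℝ) ∞ f p)
    (hv : SmoothAlongAt E J b v p) : SmoothAlongAt E J b (fun q => f q • v q) p := by
  have hs := mem_chart_source E (b p)
  have hc := IsManifold.chart_mem_maximalAtlas (I := 𝓘(ℝ, E)) (n := ∞) (b p)
  rw [smoothAlongAt_iff_of_chart hc hs] at *
  simp only [map_smul]
  exact ⟨hv.1, hf.smul hv.2⟩

theorem smoothAlongAt_zero {b : P → M} {p : P} (hb : ContMDiffAt J 𝓘(ℝ, E) ∞ b p) :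
    SmoothAlongAt E J b (fun _ => (0 : E)) p := by
  have hs := mem_chart_source E (b p)
  have hc := IsManifold.chart_mem_maximalAtlas (I := 𝓘(ℝ, E)) (n := ∞) (b p)
  rw [smoothAlongAt_iff_of_chart hc hs]
  simp only [map_zero]
  exact ⟨hb, contMDiffAt_const⟩

end Field

section Bracket

variable [FiniteDimensional ℝ E] [FiniteDimensional ℝ E'] [IsManifold 𝓘(ℝ, E) ∞ M]
  [IsManifold 𝓘(ℝ, E') ∞ N]

/-- A vector field read in the preferred chart at `x`. -/
def chartField (V : M → E) (x : M) (y : E) : E :=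
  tderiv E E (chartAt E x) ((chartAt E x).symm y) (V ((chartAt E x).symm y))

theorem tderiv_chartAt_self (x : M) : tderiv E E (chartAt E x) x = ContinuousLinearMap.id ℝ E := by
  have : IsManifold 𝓘(ℝ, E) 1 M := .of_le (n := ∞) (by simp)
  exact mfderiv_extChartAt_self (I := 𝓘(ℝ, E)) (x := x)

theorem tderiv_chartAt_symm_self (x : M) :
    tderiv E E (chartAt E x).symm (chartAt E x x) = ContinuousLinearMap.id ℝ E := by
  ext v
  have := tderiv_symm_tderiv (IsManifold.chart_mem_maximalAtlas (I := 𝓘(ℝ, E)) (n := ∞) x)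
    (mem_chart_source E x) v
  rwa [tderiv_chartAt_self] at this

/-- The Lie bracket of vector fields, as a function to the model space. -/
def fieldBracket (V W : M → E) (x : M) : E := mlieBracket 𝓘(ℝ, E) V W x

/-- The manifold bracket is defined by inverting the derivative of the inverse chart. On the chart
domain this inverse is the derivative of the chart, which is easier to compose. -/
theorem mpullbackWithin_extChartAt_symm_eventuallyEq (V : ∀ x : M, TangentSpace 𝓘(ℝ, E) x)
    (x : M) :
    (fun y => (mpullbackWithin 𝓘(ℝ, E) 𝓘(ℝ, E) (extChartAt 𝓘(ℝ, E) x).symm V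
      (Set.range 𝓘(ℝ, E)) y : E)) =ᶠ[𝓝 (chartAt E x x)] chartField (E := E) V x := by
  have hc := IsManifold.chart_mem_maximalAtlas (I := 𝓘(ℝ, E)) (n := ∞) x
  filter_upwards [(chartAt E x).open_target.mem_nhds (mem_chart_target E x)] with y hy
  have h1 := fun v => tderiv_symm_tderiv hc ((chartAt E x).map_target hy) v
  have h2 := fun v => tderiv_tderiv_symm hc ((chartAt E x).map_target hy) v
  rw [(chartAt E x).right_inv hy] at h1 h2
  have h3 : mfderivWithin 𝓘(ℝ, E) 𝓘(ℝ, E) (extChartAt 𝓘(ℝ, E) x).symm (Set.range 𝓘(ℝ, E)) y =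
      tderiv E E (chartAt E x).symm y := by
    rw [modelWithCornersSelf_coe, Set.range_id, mfderivWithin_univ]
    rfl
  have h4 : ContinuousLinearMap.inverse (tderiv E E (chartAt E x).symm y) =
      tderiv E E (chartAt E x) ((chartAt E x).symm y) :=
    ContinuousLinearMap.inverse_eq (ContinuousLinearMap.ext h1) (ContinuousLinearMap.ext h2)
  refine Eq.trans ?_ (congrArg (fun T : E →L[ℝ] E => T (V ((chartAt E x).symm y))) h4)
  exact congrArg (fun T : E →L[ℝ] E => T.inverse (V ((chartAt E x).symm y))) h3

theorem mlieBracket_eq_lieBracket_mpullbackWithin (V W : ∀ x : M, TangentSpace 𝓘(ℝ, E) x)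
    (x : M) : (mlieBracket 𝓘(ℝ, E) V W x : E) =
      lieBracket ℝ (fun y => mpullbackWithin 𝓘(ℝ, E) 𝓘(ℝ, E) (extChartAt 𝓘(ℝ, E) x).symm V
        (Set.range 𝓘(ℝ, E)) y) (fun y => mpullbackWithin 𝓘(ℝ, E) 𝓘(ℝ, E)
        (extChartAt 𝓘(ℝ, E) x).symm W (Set.range 𝓘(ℝ, E)) y) (chartAt E x x) := by
  have : IsManifold 𝓘(ℝ, E) 1 M := .of_le (n := ∞) (by simp)
  rw [← mlieBracketWithin_univ, mlieBracketWithin_apply]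
  refine (congrArg (fun T : E →L[ℝ] E => T.inverse _) mfderiv_extChartAt_self).trans ?_
  refine (congrArg (fun T : E →L[ℝ] E => T _) ContinuousLinearMap.inverse_id).trans ?_
  simp only [Set.preimage_univ, Set.univ_inter, modelWithCornersSelf_coe, Set.range_id]
  exact congrFun (lieBracketWithin_univ (𝕜 := ℝ)) _

theorem fieldBracket_eq (V W : M → E) (x : M) :
    fieldBracket V W x =
      lieBracket ℝ (chartField V x) (chartField W x) (chartAt E x x) :=
  (mlieBracket_eq_lieBracket_mpullbackWithin (E := E) V W x).trans
    ((mpullbackWithin_extChartAt_symm_eventuallyEq V x).lieBracket_vectorField_eq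
      (mpullbackWithin_extChartAt_symm_eventuallyEq W x))

theorem SmoothAlongAt.contDiffAt_chartField {V : M → E} {x : M}
    (h : SmoothAlongAt E 𝓘(ℝ, E) (fun y : M => y) V x) :
    ContDiffAt ℝ ∞ (chartField V x) (chartAt E x x) := by
  have hc := IsManifold.chart_mem_maximalAtlas (I := 𝓘(ℝ, E)) (n := ∞) x
  have h1 := ((smoothAlongAt_iff_of_chart hc (mem_chart_source E x)).1 h).2
  refine ContMDiffAt.contDiffAt ?_
  exact ContMDiffAt.comp_of_eq (g := fun q => tderiv E E (chartAt E x) q (V q)) h1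
    (contMDiffAt_symm_of_mem_maximalAtlas hc (mem_chart_target E x))
    ((chartAt E x).left_inv (mem_chart_source E x))

/-- By symmetry of the second derivative of `F`, the image of the bracket is a difference of
derivatives of `DF w` and `DF v`; relatedness turns these into derivatives of `w' ∘ F` and `v' ∘ F`.
-/
theorem fderiv_lieBracket_of_related {F : E → E'} {v w : E → E} {v' w' : E' → E'} {z : E}
    (hF : ContDiffAt ℝ ∞ F z) (hv : DifferentiableAt ℝ v z) (hw : DifferentiableAt ℝ w z)
    (hv' : DifferentiableAt ℝ v' (F z)) (hw' : DifferentiableAt ℝ w' (F z))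
    (h1 : ∀ᶠ y in 𝓝 z, fderiv ℝ F y (v y) = v' (F y))
    (h2 : ∀ᶠ y in 𝓝 z, fderiv ℝ F y (w y) = w' (F y)) :
    fderiv ℝ F z (lieBracket ℝ v w z) = lieBracket ℝ v' w' (F z) := by
  have hd : DifferentiableAt ℝ F z := hF.differentiableAt (by simp)
  rw [fderiv_apply_lieBracket (hF.of_le (m := 2) ENat.LEInfty.out) (by simp) hw hv]
  rw [Filter.EventuallyEq.fderiv_eq h1, Filter.EventuallyEq.fderiv_eq h2,
    fderiv_fun_comp z hw' hd, fderiv_fun_comp z hv' hd]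
  simp [lieBracket, h1.self_of_nhds, h2.self_of_nhds]

/-- The Lie bracket is natural with respect to related vector fields. -/
theorem tderiv_fieldBracket_of_related {f : M → N} {V W : M → E} {V' W' : N → E'} {x : M}
    (hf : ContMDiffAt 𝓘(ℝ, E) 𝓘(ℝ, E') ∞ f x)
    (hV : SmoothAlongAt E 𝓘(ℝ, E) (fun y : M => y) V x)
    (hW : SmoothAlongAt E 𝓘(ℝ, E) (fun y : M => y) W x)
    (hV' : SmoothAlongAt E' 𝓘(ℝ, E') (fun y : N => y) V' (f x))
    (hW' : SmoothAlongAt E' 𝓘(ℝ, E') (fun y : N => y) W' (f x))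
    (h1 : ∀ᶠ y in 𝓝 x, tderiv E E' f y (V y) = V' (f y))
    (h2 : ∀ᶠ y in 𝓝 x, tderiv E E' f y (W y) = W' (f y)) :
    tderiv E E' f x (fieldBracket V W x) = fieldBracket V' W' (f x) := by
  rw [fieldBracket_eq, fieldBracket_eq]
  set φ := chartAt E x with hφ
  set ψ := chartAt E' (f x) with hψ
  have hφ' : φ ∈ IsManifold.maximalAtlas 𝓘(ℝ, E) ∞ M := IsManifold.chart_mem_maximalAtlas x
  have hψ' : ψ ∈ IsManifold.maximalAtlas 𝓘(ℝ, E') ∞ N := IsManifold.chart_mem_maximalAtlas (f x)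
  have hxs : x ∈ φ.source := mem_chart_source E x
  have hfs : f x ∈ ψ.source := mem_chart_source E' (f x)
  have hzt : φ x ∈ φ.target := mem_chart_target E x
  have hsx : φ.symm (φ x) = x := φ.left_inv hxs
  let F : E → E' := fun y => ψ (f (φ.symm y))
  have hFz : F (φ x) = ψ (f x) := by simp only [F, hsx]
  have hs := contMDiffAt_symm_of_mem_maximalAtlas hφ' hzt
  have hfs' : ContMDiffAt 𝓘(ℝ, E) 𝓘(ℝ, E') ∞ (fun y => f (φ.symm y)) (φ x) :=
    ContMDiffAt.comp_of_eq (g := f) hf hs hsx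
  have hF : ContMDiffAt 𝓘(ℝ, E) 𝓘(ℝ, E') ∞ F (φ x) :=
    ContMDiffAt.comp_of_eq (g := ψ) (contMDiffAt_of_mem_maximalAtlas hψ' hfs) hfs'
      (by rw [hsx])
  have htend : Tendsto φ.symm (𝓝 (φ x)) (𝓝 x) := by
    have := hs.continuousAt
    rwa [ContinuousAt, hsx] at this
  -- Relatedness survives reading everything in the charts at `x` and `f x`, which reduces the claim
  -- to the model spaces.
  have rel : ∀ {V : M → E} {V' : N → E'}, (∀ᶠ y in 𝓝 x, tderiv E E' f y (V y) = V' (f y)) →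
      ∀ᶠ y in 𝓝 (φ x), fderiv ℝ F y (chartField V x y) = chartField V' (f x) (F y) := by
    intro V V' h
    filter_upwards [φ.open_target.mem_nhds hzt, htend.eventually h,
      htend.eventually hf.eventually_mdiff,
      (htend.eventually (hf.continuousAt.eventually (ψ.open_source.mem_nhds hfs)))]
      with y hy e1 e2 e3
    have ht := mdifferentiableAt_chart_symm hφ' hy
    rw [← tderiv_eq_fderiv, tderiv_comp_apply (g := ψ) (f := fun y => f (φ.symm y))
      (mdifferentiableAt_chart hψ' e3) (e2.comp y ht), tderiv_comp_apply e2 ht, chartField,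
      ← hφ, chartField, ← hψ, ψ.left_inv e3, ← e1]
    have := tderiv_symm_tderiv hφ' (φ.map_target hy) (V (φ.symm y))
    rw [φ.right_inv hy] at this
    rw [this]
  have key := fderiv_lieBracket_of_related hF.contDiffAt
    (hV.contDiffAt_chartField.differentiableAt (by simp))
    (hW.contDiffAt_chartField.differentiableAt (by simp))
    (hFz ▸ hV'.contDiffAt_chartField.differentiableAt (by simp))
    (hFz ▸ hW'.contDiffAt_chartField.differentiableAt (by simp))
    (rel h1) (rel h2)
  rw [← tderiv_eq_fderiv, tderiv_comp_apply (g := ψ) (f := fun y => f (φ.symm y))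
      (by rw [hsx]; exact mdifferentiableAt_chart hψ' hfs) hfs'.mdiff,
      tderiv_comp_apply (g := f) (by rw [hsx]; exact hf.mdiff) hs.mdiff, hsx, hφ, hψ,
      tderiv_chartAt_self, tderiv_chartAt_symm_self, hFz] at key
  exact key

/-- If `W` vanishes along enough curves through `x`, then `[V, W]` vanishes at `x`. -/
theorem fieldBracket_eq_zero_of_vanishing {V W : M → E} {x : M}
    (hW : SmoothAlongAt E 𝓘(ℝ, E) (fun y : M => y) W x) (hWx : W x = 0)
    (h : V x ∈ Submodule.span ℝ {v : E | ∃ c : ℝ → M, c 0 = x ∧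
      MDifferentiableAt 𝓘(ℝ, ℝ) 𝓘(ℝ, E) c 0 ∧ (∀ᶠ t in 𝓝 0, W (c t) = 0) ∧
      tderiv ℝ E c 0 1 = v}) :
    fieldBracket V W x = 0 := by
  rw [fieldBracket_eq, lieBracket]
  set φ := chartAt E x with hφ
  have hφ' : φ ∈ IsManifold.maximalAtlas 𝓘(ℝ, E) ∞ M := IsManifold.chart_mem_maximalAtlas x
  have hxs : x ∈ φ.source := mem_chart_source E x
  have h1 : ∀ V : M → E, chartField V x (φ x) = V x := by
    intro V
    rw [chartField, ← hφ, φ.left_inv hxs, hφ, tderiv_chartAt_self]; rfl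
  -- As `W x = 0`, only the derivative of `W` in the direction `V x` is left. It is linear in the
  -- direction, so it suffices to differentiate along the given curves.
  rw [h1, h1, hWx, map_zero, sub_zero]
  have hd := hW.contDiffAt_chartField.differentiableAt (by simp)
  have : V x ∈ LinearMap.ker (fderiv ℝ (chartField W x) (φ x)).toLinearMap := by
    refine Submodule.span_le.2 ?_ h
    rintro v ⟨c, hc0, hc, hWc, rfl⟩
    change fderiv ℝ (chartField W x) (φ x) (tderiv ℝ E c 0 1) = 0
    have hφc : MDifferentiableAt 𝓘(ℝ, E) 𝓘(ℝ, E) φ (c 0) := by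
      rw [hc0]; exact mdifferentiableAt_chart hφ' hxs
    have e1 : tderiv ℝ E (fun t => φ (c t)) 0 1 = tderiv ℝ E c 0 1 := by
      rw [tderiv_comp_apply hφc hc, hc0, hφ, tderiv_chartAt_self]; rfl
    have hg : MDifferentiableAt 𝓘(ℝ, E) 𝓘(ℝ, E) (chartField W x) (φ (c 0)) := by
      rw [hc0]; exact hd.mdifferentiableAt
    have e2 := tderiv_comp_apply (f := fun t => φ (c t)) hg (hφc.comp (0 : ℝ) hc) (1 : ℝ)
    rw [e1, hc0, tderiv_eq_fderiv (chartField W x)] at e2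
    rw [← e2, tderiv_congr (g := fun _ => (0 : E)), tderiv_const]
    · rfl
    have hcs : ∀ᶠ t in 𝓝 (0 : ℝ), c t ∈ φ.source :=
      hc.continuousAt.eventually (φ.open_source.mem_nhds (by rwa [hc0]))
    filter_upwards [hcs, hWc] with t ht e
    rw [chartField, ← hφ, φ.left_inv ht, e, map_zero]
  exact this

end Bracket

end TangentCalculus

/-! ### Sections and fibre curves of submersions. -/

section Submersion

open Filter

variable {E E' : Type*} [NormedAddCommGroup E] [NormedSpace ℝ E]
  [NormedAddCommGroup E'] [NormedSpace ℝ E']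
  {M N : Type*} [TopologicalSpace M] [ChartedSpace E M] [TopologicalSpace N] [ChartedSpace E' N]

/-- The submersion normal form is a product projection. Only its linearity and a linear right
inverse matter later, so the complement is forgotten. -/
theorem Manifold.IsSubmersionAt.exists_linear_charts {f : M → N} {x : M}
    (h : Manifold.IsSubmersionAt 𝓘(ℝ, E) 𝓘(ℝ, E') ∞ f x) :
    ∃ φ ∈ IsManifold.maximalAtlas 𝓘(ℝ, E) ∞ M, ∃ κ ∈ IsManifold.maximalAtlas 𝓘(ℝ, E') ∞ N,
      x ∈ φ.source ∧ (∀ y ∈ φ.source, f y ∈ κ.source) ∧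
      ∃ (A : E →L[ℝ] E') (S : E' →L[ℝ] E), (∀ v, A (S v) = v) ∧
        ∀ y ∈ φ.source, κ (f y) = A (φ y) := by
  refine ⟨h.domChart, h.domChart_mem_maximalAtlas, h.codChart, h.codChart_mem_maximalAtlas,
    h.mem_domChart_source, h.source_subset_preimage_source,
    (ContinuousLinearMap.fst ℝ E' h.complement).comp (h.equiv : E →L[ℝ] E' × h.complement),
    (h.equiv.symm : E' × h.complement →L[ℝ] E).comp (ContinuousLinearMap.inl ℝ E' h.complement),
    fun v => by simp, fun y hy => ?_⟩
  have := h.writtenInCharts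
    (by simp [hy] : h.domChart y ∈ (h.domChart.extend 𝓘(ℝ, E)).target)
  simpa [h.domChart.left_inv hy] using this

variable [IsManifold 𝓘(ℝ, E) ∞ M] [IsManifold 𝓘(ℝ, E') ∞ N]

/-- A submersion has a smooth local section through each point. -/
theorem Manifold.IsSubmersionAt.exists_section {f : M → N} {x : M}
    (h : Manifold.IsSubmersionAt 𝓘(ℝ, E) 𝓘(ℝ, E') ∞ f x) :
    ∃ β : N → M, ContMDiffAt 𝓘(ℝ, E') 𝓘(ℝ, E) ∞ β (f x) ∧ β (f x) = x ∧
      ∀ᶠ n in 𝓝 (f x), f (β n) = n := by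
  obtain ⟨φ, hφ, κ, hκ, hx, hs, A, S, hAS, hA⟩ := h.exists_linear_charts
  have hfx := hs x hx
  -- The affine section of `A` through `φ x`: applying `A` gives `κ n`.
  let g : N → E := fun n => φ x + S (κ n - κ (f x))
  have hg : ContMDiffAt 𝓘(ℝ, E') 𝓘(ℝ, E) ∞ g (f x) := by
    have h1 : ContDiff ℝ ∞ fun z : E' => φ x + S (z - κ (f x)) := by fun_prop
    exact h1.contMDiff.contMDiffAt.comp (f x) (contMDiffAt_of_mem_maximalAtlas hκ hfx)
  have hg0 : g (f x) = φ x := by simp [g]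
  have ht : φ x ∈ φ.target := φ.map_source hx
  have hgt : ∀ᶠ n in 𝓝 (f x), g n ∈ φ.target :=
    hg.continuousAt.eventually (by rw [hg0]; exact φ.open_target.mem_nhds ht)
  refine ⟨fun n => φ.symm (g n),
    ContMDiffAt.comp_of_eq (contMDiffAt_symm_of_mem_maximalAtlas hφ ht) hg hg0, ?_, ?_⟩
  · simp only [hg0, φ.left_inv hx]
  · filter_upwards [hgt, κ.open_source.mem_nhds hfx] with n h1 h2
    have h3 := φ.map_target h1
    refine κ.injOn (hs _ h3) h2 ?_
    rw [hA _ h3, φ.right_inv h1, map_add, hAS, ← hA x hx]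
    abel

/-- Smooth families of curves in the fibres of a submersion, with prescribed velocities in the
kernel of its derivative. -/
theorem Manifold.IsSubmersionAt.exists_curves {f : M → N} {EP HP P : Type*} [NormedAddCommGroup EP]
    [NormedSpace ℝ EP] [TopologicalSpace HP] {J : ModelWithCorners ℝ EP HP} [TopologicalSpace P]
    [ChartedSpace HP P] {b : P → M} {v : P → E} {p₀ : P}
    (h : Manifold.IsSubmersionAt 𝓘(ℝ, E) 𝓘(ℝ, E') ∞ f (b p₀))
    (hv : SmoothAlongAt E J b v p₀) (hfv : ∀ᶠ p in 𝓝 p₀, tderiv E E' f (b p) (v p) = 0) :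
    ∃ c : P × ℝ → M, ContMDiffAt (J.prod 𝓘(ℝ, ℝ)) 𝓘(ℝ, E) ∞ c (p₀, 0) ∧
      (∀ᶠ p in 𝓝 p₀, c (p, 0) = b p ∧ MDifferentiableAt 𝓘(ℝ, ℝ) 𝓘(ℝ, E) (fun t => c (p, t)) 0 ∧
        tderiv ℝ E (fun t => c (p, t)) 0 1 = v p) ∧
      ∀ᶠ q in 𝓝 (p₀, (0 : ℝ)), f (c q) = f (b q.1) := by
  obtain ⟨φ, hφ, κ, hκ, hx, hs, A, S, hAS, hA⟩ := h.exists_linear_charts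
  have hb := hv.base
  have hv' := ((smoothAlongAt_iff_of_chart hφ hx).1 hv).2
  have hsrc : ∀ᶠ p in 𝓝 p₀, b p ∈ φ.source :=
    hb.continuousAt.eventually (φ.open_source.mem_nhds hx)
  have ht : φ (b p₀) ∈ φ.target := φ.map_source hx
  have hfd : ∀ y ∈ φ.source, MDifferentiableAt 𝓘(ℝ, E) 𝓘(ℝ, E') f y := by
    intro y hy
    have h1 : ContMDiffAt 𝓘(ℝ, E) 𝓘(ℝ, E') ∞ (fun z => κ.symm (A (φ z))) y :=
      ContMDiffAt.comp_of_eq (contMDiffAt_symm_of_mem_maximalAtlas hκ (κ.map_source (hs y hy)))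
        (A.contDiff.contMDiff.contMDiffAt.comp y (contMDiffAt_of_mem_maximalAtlas hφ hy))
        (hA y hy).symm
    refine (h1.congr_of_eventuallyEq ?_).mdiff
    filter_upwards [φ.open_source.mem_nhds hy] with z hz
    rw [← hA z hz, κ.left_inv (hs z hz)]
  have hker : ∀ᶠ p in 𝓝 p₀, A (tderiv E E φ (b p) (v p)) = 0 := by
    filter_upwards [hsrc, hfv] with p h1 h2
    have e1 : tderiv E E' (fun z => κ (f z)) (b p) = tderiv E E' (fun z => A (φ z)) (b p) := by
      refine tderiv_congr ?_
      filter_upwards [φ.open_source.mem_nhds h1] with z hz using hA z hz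
    rw [tderiv_comp (mdifferentiableAt_chart hκ (hs _ h1)) (hfd _ h1),
      tderiv_comp A.differentiableAt.mdifferentiableAt (mdifferentiableAt_chart hφ h1),
      tderiv_eq_fderiv A, A.fderiv] at e1
    have := congrArg (fun T : E →L[ℝ] E' => T (v p)) e1
    simpa [h2] using this.symm
  -- In the linearizing chart the curves are straight lines. By `hker` their directions lie in `ker
  -- A`, so they stay in the fibres of `f`.
  let g : P × ℝ → E := fun q => φ (b q.1) + q.2 • tderiv E E φ (b q.1) (v q.1)
  have hg : ContMDiffAt (J.prod 𝓘(ℝ, ℝ)) 𝓘(ℝ, E) ∞ g (p₀, 0) := by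
    have h1 : ContMDiffAt (J.prod 𝓘(ℝ, ℝ)) J ∞ (Prod.fst : P × ℝ → P) (p₀, 0) := contMDiffAt_fst
    have h2 : ContMDiffAt (J.prod 𝓘(ℝ, ℝ)) 𝓘(ℝ, ℝ) ∞ (Prod.snd : P × ℝ → ℝ) (p₀, 0) :=
      contMDiffAt_snd
    have h3 : ContMDiffAt J 𝓘(ℝ, E) ∞ (fun p => φ (b p)) p₀ :=
      (contMDiffAt_of_mem_maximalAtlas hφ hx).comp p₀ hb
    exact (ContMDiffAt.comp (p₀, (0 : ℝ)) (g := fun p => φ (b p)) h3 h1).add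
      (h2.smul (ContMDiffAt.comp (p₀, (0 : ℝ)) (g := fun p => tderiv E E φ (b p) (v p)) hv' h1))
  have hg0 : ∀ p, g (p, 0) = φ (b p) := by simp [g]
  have hgt : ∀ᶠ q in 𝓝 (p₀, (0 : ℝ)), g q ∈ φ.target :=
    hg.continuousAt.eventually (by rw [hg0]; exact φ.open_target.mem_nhds ht)
  refine ⟨fun q => φ.symm (g q), ContMDiffAt.comp_of_eq
    (contMDiffAt_symm_of_mem_maximalAtlas hφ ht) hg (hg0 p₀), ?_, ?_⟩
  · filter_upwards [hsrc] with p h1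
    have h2 : HasFDerivAt (fun t : ℝ => g (p, t))
        (ContinuousLinearMap.toSpanSingleton ℝ (tderiv E E φ (b p) (v p))) 0 := by
      have := ((hasFDerivAt_id (𝕜 := ℝ) (0 : ℝ)).smul_const
        (tderiv E E φ (b p) (v p))).const_add (φ (b p))
      convert! this using 1
    have h3 : MDifferentiableAt 𝓘(ℝ, E) 𝓘(ℝ, E) φ.symm (g (p, 0)) := by
      rw [hg0]; exact mdifferentiableAt_chart_symm hφ (φ.map_source h1)
    have h4 := h2.differentiableAt.mdifferentiableAt
    refine ⟨by simp only [hg0, φ.left_inv h1], h3.comp (0 : ℝ) h4, ?_⟩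
    rw [tderiv_comp_apply (f := fun t => g (p, t)) h3 h4, h2.tderiv_eq, hg0]
    simp [tderiv_symm_tderiv hφ h1]
  · have h1 : ∀ᶠ q in 𝓝 (p₀, (0 : ℝ)), b q.1 ∈ φ.source :=
      (continuous_fst.tendsto (p₀, (0 : ℝ))).eventually hsrc
    have h2 := (continuous_fst.tendsto (p₀, (0 : ℝ))).eventually hker
    filter_upwards [hgt, h1, h2] with q e1 e2 e3
    have h3 := φ.map_target e1
    refine κ.injOn (hs _ h3) (hs _ e2) ?_
    rw [hA _ h3, φ.right_inv e1, hA _ e2]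
    simp [g, e3]

/-- Every vector in the kernel of the derivative of a submersion is the velocity of a curve in its
fibre. -/
theorem Manifold.IsSubmersionAt.exists_curve {f : M → N} {x : M}
    (h : Manifold.IsSubmersionAt 𝓘(ℝ, E) 𝓘(ℝ, E') ∞ f x) {v : E}
    (hv : tderiv E E' f x v = 0) :
    ∃ c : ℝ → M, c 0 = x ∧ MDifferentiableAt 𝓘(ℝ, ℝ) 𝓘(ℝ, E) c 0 ∧ tderiv ℝ E c 0 1 = v ∧
      ∀ᶠ t in 𝓝 0, f (c t) = f x := by
  have hs := mem_chart_source E x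
  have hc := IsManifold.chart_mem_maximalAtlas (I := 𝓘(ℝ, E)) (n := ∞) x
  obtain ⟨c, -, h1, h2⟩ := Manifold.IsSubmersionAt.exists_curves (J := 𝓘(ℝ, ℝ)) (p₀ := (0 : ℝ))
    (b := fun _ => x) (v := fun _ => v) h
    ((smoothAlongAt_iff_of_chart hc hs).2 ⟨contMDiffAt_const, contMDiffAt_const⟩)
    (Eventually.of_forall fun _ => hv)
  obtain ⟨h3, h4, h5⟩ := h1.self_of_nhds
  refine ⟨fun t => c (0, t), h3, h4, h5, ?_⟩
  exact ((Continuous.prodMk_right (0 : ℝ)).tendsto (0 : ℝ)).eventually h2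

end Submersion

/-! ### Velocities of smooth families of curves. -/

section PartialDerivative

variable {E : Type*} [NormedAddCommGroup E] [NormedSpace ℝ E]
  {M : Type*} [TopologicalSpace M] [ChartedSpace E M] [IsManifold 𝓘(ℝ, E) ∞ M]
  {EP HP P : Type*} [NormedAddCommGroup EP]
  [NormedSpace ℝ EP] [TopologicalSpace HP] {J : ModelWithCorners ℝ EP HP} [TopologicalSpace P]
  [ChartedSpace HP P] [IsManifold J ∞ P]

/-- Serves to prove right-invariant fields smooth: such a field is the velocity at time `0` of a
family `c(g, t) g`. -/
theorem smoothAlongAt_partialDeriv {μ : P × ℝ → M} {p₀ : P}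
    (h : ContMDiffAt (J.prod 𝓘(ℝ, ℝ)) 𝓘(ℝ, E) ∞ μ (p₀, 0)) :
    SmoothAlongAt E J (fun p => μ (p, 0)) (fun p => tderiv ℝ E (fun t => μ (p, t)) 0 1) p₀ := by
  have : IsManifold 𝓘(ℝ, E) 1 M := .of_le (n := ∞) (by simp)
  have A := ContMDiffAt.mfderiv (I := 𝓘(ℝ, ℝ)) (I' := 𝓘(ℝ, E)) (J := J) (m := ∞) (n := ∞)
    (x₀ := p₀) (fun p t => μ (p, t)) (fun _ => (0 : ℝ)) h contMDiffAt_const (by simp)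
  have hv : SmoothAlongAt ℝ J (fun _ : P => (0 : ℝ)) (fun _ => (1 : ℝ)) p₀ :=
    smoothAlongAt_model_iff.2 ⟨contMDiffAt_const, contMDiffAt_const⟩
  have hb : ContMDiffAt J 𝓘(ℝ, E) ∞ (fun p => μ (p, 0)) p₀ :=
    ContMDiffAt.comp p₀ h (contMDiffAt_id.prodMk contMDiffAt_const)
  unfold SmoothAlongAt at hv ⊢
  exact ContMDiffAt.clm_apply_of_inCoordinates (𝕜 := ℝ) (b₁ := fun _ : P => (0 : ℝ))
    (b₂ := fun p => μ (p, 0)) (ϕ := fun p => mfderiv 𝓘(ℝ, ℝ) 𝓘(ℝ, E) (fun t => μ (p, t)) 0)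
    (v := fun _ => (1 : ℝ)) A hv hb

end PartialDerivative

/-! ### Right-invariant vector fields and their brackets. -/

namespace LieGroupoid

open Filter

variable {EM EG : Type*} [NormedAddCommGroup EM] [NormedSpace ℝ EM]
  [NormedAddCommGroup EG] [NormedSpace ℝ EG]
  {M G : Type*} [TopologicalSpace M] [ChartedSpace EM M] [TopologicalSpace G] [ChartedSpace EG G]
  (𝒢 : LieGroupoid EM EG M G)

theorem s_smooth : ContMDiff 𝓘(ℝ, EG) 𝓘(ℝ, EM) ∞ 𝒢.s := 𝒢.s_submersion.contMDiff

theorem r_smooth : ContMDiff 𝓘(ℝ, EG) 𝓘(ℝ, EM) ∞ 𝒢.r := 𝒢.r_submersion.contMDiff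

theorem s_mdiff (g : G) : MDifferentiableAt 𝓘(ℝ, EG) 𝓘(ℝ, EM) 𝒢.s g := (𝒢.s_smooth g).mdiff

theorem r_mdiff (g : G) : MDifferentiableAt 𝓘(ℝ, EG) 𝓘(ℝ, EM) 𝒢.r g := (𝒢.r_smooth g).mdiff

theorem u_mdiff (m : M) : MDifferentiableAt 𝓘(ℝ, EM) 𝓘(ℝ, EG) 𝒢.u m := (𝒢.u_smooth m).mdiff

theorem mul_unit' {m : M} {g : G} (h : 𝒢.s g = m) : 𝒢.mul g (𝒢.u m) = g := by
  rw [← h, 𝒢.mul_unit]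

theorem tderiv_s_u (m : M) (v : EM) :
    tderiv EG EM 𝒢.s (𝒢.u m) (tderiv EM EG 𝒢.u m v) = v := by
  rw [← tderiv_comp_apply (𝒢.s_mdiff _) (𝒢.u_mdiff m)]
  simp only [𝒢.s_unit, tderiv_id]
  rfl

theorem tderiv_r_u (m : M) (v : EM) :
    tderiv EG EM 𝒢.r (𝒢.u m) (tderiv EM EG 𝒢.u m v) = v := by
  rw [← tderiv_comp_apply (𝒢.r_mdiff _) (𝒢.u_mdiff m)]
  simp only [𝒢.r_unit, tderiv_id]
  rfl

/-- The product is smooth only within the set of composable pairs; composability on a whole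
neighbourhood of the parameter turns this into smoothness at a point. -/
theorem contMDiffAt_mul_of_composable {EP HP P : Type*} [NormedAddCommGroup EP]
    [NormedSpace ℝ EP] [TopologicalSpace HP] {J : ModelWithCorners ℝ EP HP} [TopologicalSpace P]
    [ChartedSpace HP P] {a b : P → G} {p : P} (ha : ContMDiffAt J 𝓘(ℝ, EG) ∞ a p)
    (hb : ContMDiffAt J 𝓘(ℝ, EG) ∞ b p) (h : ∀ᶠ q in 𝓝 p, 𝒢.s (a q) = 𝒢.r (b q)) :
    ContMDiffAt J 𝓘(ℝ, EG) ∞ (fun q => 𝒢.mul (a q) (b q)) p := by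
  have h1 := 𝒢.mul_smooth (a p, b p) h.self_of_nhds
  have h2 := ContMDiffWithinAt.comp p h1
    (f := fun q => (a q, b q)) (s := {q | 𝒢.s (a q) = 𝒢.r (b q)})
    (ha.prodMk hb).contMDiffWithinAt (fun q hq => hq)
  exact h2.contMDiffAt h

/-- The right-invariant vector field of a section of the Lie algebroid, as a function to the model
space. -/
def invField (X : M → EG) (g : G) : EG := 𝒢.rightInvariant X g

/-- A curve in the source fibre only sees the restriction of `R_g` to that fibre, so the derivative
within the fibre becomes an ordinary velocity. All later computations with `invField` pass through
such curves. -/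
theorem invField_eq_of_curve {X : M → EG} {g : G} {c : ℝ → G} (h0 : c 0 = 𝒢.u (𝒢.r g))
    (hc : MDifferentiableAt 𝓘(ℝ, ℝ) 𝓘(ℝ, EG) c 0) (hs : ∀ᶠ t in 𝓝 0, 𝒢.s (c t) = 𝒢.r g)
    (hv : tderiv ℝ EG c 0 1 = X (𝒢.r g)) :
    MDifferentiableAt 𝓘(ℝ, ℝ) 𝓘(ℝ, EG) (fun t => 𝒢.mul (c t) g) 0 ∧
      𝒢.invField X g = tderiv ℝ EG (fun t => 𝒢.mul (c t) g) 0 1 := by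
  have h1 : ContMDiffWithinAt 𝓘(ℝ, EG) 𝓘(ℝ, EG) ∞ (fun h => 𝒢.mul h g) {h | 𝒢.s h = 𝒢.r g}
      (𝒢.u (𝒢.r g)) :=
    ContMDiffWithinAt.comp (𝒢.u (𝒢.r g)) (f := fun h => (h, g))
      (𝒢.mul_smooth (𝒢.u (𝒢.r g), g) (𝒢.s_unit _))
      (contMDiffWithinAt_id.prodMk contMDiffWithinAt_const) (fun h hh => hh)
  have h2 := (h1.mdifferentiableWithinAt (by simp)).hasMFDerivWithinAt
  rw [← h0] at h2
  have h3 := (HasMFDerivWithinAt.comp (0 : ℝ) h2 (hc.hasMFDerivAt.hasMFDerivWithinAt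
    (s := c ⁻¹' {h | 𝒢.s h = 𝒢.r g})) subset_rfl).hasMFDerivAt hs
  refine ⟨h3.mdifferentiableAt, ?_⟩
  have h4 : tderiv ℝ EG (fun t => 𝒢.mul (c t) g) 0 = _ := h3.tderiv_eq
  rw [h4]
  change (mfderivWithin 𝓘(ℝ, EG) 𝓘(ℝ, EG) (fun h => 𝒢.mul h g) {h | 𝒢.s h = 𝒢.r g}
    (𝒢.u (𝒢.r g)) : EG →L[ℝ] EG) (X (𝒢.r g)) = _
  rw [← hv, ← h0]
  rfl

variable [IsManifold 𝓘(ℝ, EM) ∞ M] [IsManifold 𝓘(ℝ, EG) ∞ G]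

theorem exists_invField_curve {X : M → EG} {g : G}
    (hX : tderiv EG EM 𝒢.s (𝒢.u (𝒢.r g)) (X (𝒢.r g)) = 0) :
    ∃ c : ℝ → G, c 0 = 𝒢.u (𝒢.r g) ∧ MDifferentiableAt 𝓘(ℝ, ℝ) 𝓘(ℝ, EG) c 0 ∧
      (∀ᶠ t in 𝓝 0, 𝒢.s (c t) = 𝒢.r g) ∧ tderiv ℝ EG c 0 1 = X (𝒢.r g) ∧
      MDifferentiableAt 𝓘(ℝ, ℝ) 𝓘(ℝ, EG) (fun t => 𝒢.mul (c t) g) 0 ∧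
      𝒢.invField X g = tderiv ℝ EG (fun t => 𝒢.mul (c t) g) 0 1 := by
  obtain ⟨c, h0, hc, hv, hs⟩ := (𝒢.s_submersion.isSubmersionAt (𝒢.u (𝒢.r g))).exists_curve hX
  simp only [𝒢.s_unit] at hs
  exact ⟨c, h0, hc, hs, hv, 𝒢.invField_eq_of_curve h0 hc hs hv⟩

/-- If `f` sends the translates `c t * g` of curves in source fibres to a curve `d t`, then its
derivative sends the right-invariant vector at `g` to the velocity of `d`. -/
theorem tderiv_invField {E N : Type*} [NormedAddCommGroup E] [NormedSpace ℝ E]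
    [TopologicalSpace N] [ChartedSpace E N] {f : G → N} {g : G} {c : ℝ → G} {d : ℝ → N}
    {X : M → EG} (h0 : c 0 = 𝒢.u (𝒢.r g)) (hf : MDifferentiableAt 𝓘(ℝ, EG) 𝓘(ℝ, E) f g)
    (hc : MDifferentiableAt 𝓘(ℝ, ℝ) 𝓘(ℝ, EG) (fun t => 𝒢.mul (c t) g) 0)
    (hX : 𝒢.invField X g = tderiv ℝ EG (fun t => 𝒢.mul (c t) g) 0 1)
    (hd : ∀ᶠ t in 𝓝 0, f (𝒢.mul (c t) g) = d t) :
    tderiv EG E f g (𝒢.invField X g) = tderiv ℝ E d 0 1 := by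
  have h1 : 𝒢.mul (c 0) g = g := by rw [h0, 𝒢.unit_mul]
  have h2 : MDifferentiableAt 𝓘(ℝ, EG) 𝓘(ℝ, E) f (𝒢.mul (c 0) g) := by rwa [h1]
  have := tderiv_comp_apply (f := fun t => 𝒢.mul (c t) g) h2 hc (1 : ℝ)
  rw [h1] at this
  rw [hX, ← this, tderiv_congr hd]

theorem tderiv_s_invField {X : M → EG} {g : G}
    (hX : tderiv EG EM 𝒢.s (𝒢.u (𝒢.r g)) (X (𝒢.r g)) = 0) :
    tderiv EG EM 𝒢.s g (𝒢.invField X g) = 0 := by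
  obtain ⟨c, h0, hc, hs, hv, hd, h⟩ := 𝒢.exists_invField_curve hX
  rw [𝒢.tderiv_invField (d := fun _ => 𝒢.s g) h0 (𝒢.s_mdiff g) hd h, tderiv_const]
  · rfl
  · filter_upwards [hs] with t ht using 𝒢.s_mul _ _ ht

theorem tderiv_r_invField {X : M → EG} {g : G}
    (hX : tderiv EG EM 𝒢.s (𝒢.u (𝒢.r g)) (X (𝒢.r g)) = 0) :
    tderiv EG EM 𝒢.r g (𝒢.invField X g) = tderiv EG EM 𝒢.r (𝒢.u (𝒢.r g)) (X (𝒢.r g)) := by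
  obtain ⟨c, h0, hc, hs, hv, hd, h⟩ := 𝒢.exists_invField_curve hX
  rw [𝒢.tderiv_invField (d := fun t => 𝒢.r (c t)) h0 (𝒢.r_mdiff g) hd h,
    tderiv_comp_apply (𝒢.r_mdiff _) hc, hv, h0]
  filter_upwards [hs] with t ht using 𝒢.r_mul _ _ ht

theorem invField_unit {X : M → EG} {m : M} (hX : tderiv EG EM 𝒢.s (𝒢.u m) (X m) = 0) :
    𝒢.invField X (𝒢.u m) = X m := by
  obtain ⟨c, h0, hc, hs, hv, hd, h⟩ := 𝒢.exists_invField_curve (X := X) (g := 𝒢.u m)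
    (by rwa [𝒢.r_unit])
  rw [𝒢.r_unit] at hv hs
  rw [h, ← hv, tderiv_congr (g := c)]
  filter_upwards [hs] with t ht using 𝒢.mul_unit' ht

theorem isAlgSection_iff {X : M → EG} :
    𝒢.IsAlgSection X ↔ (∀ m, tderiv EG EM 𝒢.s (𝒢.u m) (X m) = 0) ∧
      ∀ m, SmoothAlongAt EG 𝓘(ℝ, EM) 𝒢.u X m := Iff.rfl

theorem IsAlgSection.ker {𝒢 : LieGroupoid EM EG M G} {X : M → EG} (h : 𝒢.IsAlgSection X) (m : M) :
    tderiv EG EM 𝒢.s (𝒢.u m) (X m) = 0 := h.1 m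

theorem IsAlgSection.smooth {𝒢 : LieGroupoid EM EG M G} {X : M → EG} (h : 𝒢.IsAlgSection X)
    (m : M) : SmoothAlongAt EG 𝓘(ℝ, EM) 𝒢.u X m := h.2 m

/-- Right-invariant vector fields are smooth. -/
theorem IsAlgSection.smooth_invField {𝒢 : LieGroupoid EM EG M G} {X : M → EG}
    (hX : 𝒢.IsAlgSection X) (g : G) :
    SmoothAlongAt EG 𝓘(ℝ, EG) (fun h : G => h) (𝒢.invField X) g := by
  -- For `h` near `g`, curves in the source fibre starting at the unit of `r h` with velocity `X (r
  -- h)`, smoothly in `h`.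
  obtain ⟨c, hc, h1, h2⟩ := Manifold.IsSubmersionAt.exists_curves (p₀ := g)
    (b := fun h => 𝒢.u (𝒢.r h)) (v := fun h => X (𝒢.r h))
    (𝒢.s_submersion.isSubmersionAt (𝒢.u (𝒢.r g))) ((hX.smooth (𝒢.r g)).comp (𝒢.r_smooth g))
    (Eventually.of_forall fun h => hX.ker _)
  simp only [𝒢.s_unit] at h2
  have hμ : ContMDiffAt (𝓘(ℝ, EG).prod 𝓘(ℝ, ℝ)) 𝓘(ℝ, EG) ∞
      (fun q : G × ℝ => 𝒢.mul (c q) q.1) (g, 0) :=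
    𝒢.contMDiffAt_mul_of_composable hc contMDiffAt_fst h2
  refine (smoothAlongAt_partialDeriv hμ).congr ?_ ?_
  · filter_upwards [h1] with h hh
    rw [hh.1, 𝒢.unit_mul]
  · filter_upwards [h1, h2.curry_nhds] with h hh hs
    exact (𝒢.invField_eq_of_curve hh.1 hh.2.1 hs hh.2.2).2

/-- The bracket of two right-invariant vector fields is right-invariant. -/
theorem IsAlgSection.ker_fieldBracket {𝒢 : LieGroupoid EM EG M G} [FiniteDimensional ℝ EM]
    [FiniteDimensional ℝ EG] {X Y : M → EG}
    (hX : 𝒢.IsAlgSection X) (hY : 𝒢.IsAlgSection Y) (g : G) :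
    tderiv EG EM 𝒢.s g (fieldBracket (𝒢.invField X) (𝒢.invField Y) g) = 0 := by
  have h0 : SmoothAlongAt EM 𝓘(ℝ, EM) (fun m : M => m) (fun _ => (0 : EM)) (𝒢.s g) :=
    smoothAlongAt_zero contMDiffAt_id
  -- Both fields are `s`-related to the zero field, hence so is their bracket.
  rw [tderiv_fieldBracket_of_related (𝒢.s_smooth g) (hX.smooth_invField g) (hY.smooth_invField g)
    h0 h0 (Eventually.of_forall fun h => 𝒢.tderiv_s_invField (hX.ker _))
    (Eventually.of_forall fun h => 𝒢.tderiv_s_invField (hY.ker _))]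
  exact congrFun VectorField.mlieBracket_zero_left _

/-- Right translation by `g` lives only on one source fibre. A local section `β` of `r` through `g`
extends it to the map `h ↦ h β(s h)` near the unit; right-invariant fields are related to themselves
under this map, hence so are their brackets. -/
theorem IsAlgSection.fieldBracket_eq_invField {𝒢 : LieGroupoid EM EG M G} [FiniteDimensional ℝ EM]
    [FiniteDimensional ℝ EG] {X Y : M → EG} (hX : 𝒢.IsAlgSection X) (hY : 𝒢.IsAlgSection Y)
    (g : G) : fieldBracket (𝒢.invField X) (𝒢.invField Y) g =
      𝒢.invField (fun m => fieldBracket (𝒢.invField X) (𝒢.invField Y) (𝒢.u m)) g := by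
  obtain ⟨β, hβ, hβg, hβr⟩ := (𝒢.r_submersion.isSubmersionAt g).exists_section
  set m := 𝒢.r g with hm
  let R : G → G := fun h => 𝒢.mul h (β (𝒢.s h))
  have hsev : Tendsto 𝒢.s (𝓝 (𝒢.u m)) (𝓝 m) := by
    have := (𝒢.s_smooth (𝒢.u m)).continuousAt
    rwa [ContinuousAt, 𝒢.s_unit] at this
  have hRu : R (𝒢.u m) = g := by
    simp only [R, 𝒢.s_unit, hβg]
    exact 𝒢.unit_mul g
  have hR : ContMDiffAt 𝓘(ℝ, EG) 𝓘(ℝ, EG) ∞ R (𝒢.u m) := by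
    refine 𝒢.contMDiffAt_mul_of_composable contMDiffAt_id
      (ContMDiffAt.comp_of_eq hβ (𝒢.s_smooth (𝒢.u m)) (𝒢.s_unit m)) ?_
    filter_upwards [hsev.eventually hβr] with h hh using hh.symm
  have hrel : ∀ {X : M → EG}, 𝒢.IsAlgSection X →
      ∀ᶠ h in 𝓝 (𝒢.u m), tderiv EG EG R h (𝒢.invField X h) = 𝒢.invField X (R h) := by
    intro X hX
    filter_upwards [hsev.eventually hβr, hR.eventually_mdiff] with h e1 e2
    obtain ⟨c, h0, hc, hs, hv, hd, hi⟩ := 𝒢.exists_invField_curve (g := h) (hX.ker _)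
    have hr : 𝒢.r (R h) = 𝒢.r h := 𝒢.r_mul _ _ e1.symm
    rw [𝒢.tderiv_invField (d := fun t => 𝒢.mul (c t) (R h)) h0 e2 hd hi,
      (𝒢.invField_eq_of_curve (g := R h) (by rwa [hr]) hc (by rwa [hr]) (by rwa [hr])).2]
    filter_upwards [hs] with t ht
    simp only [R]
    rw [𝒢.s_mul _ _ ht, 𝒢.mul_assoc _ _ _ ht e1.symm]
  have key := tderiv_fieldBracket_of_related hR (hX.smooth_invField _) (hY.smooth_invField _)
    (hX.smooth_invField _) (hY.smooth_invField _) (hrel hX) (hrel hY)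
  rw [hRu] at key
  obtain ⟨c, h0, hc, hs, hv, hd, hi⟩ := 𝒢.exists_invField_curve (g := g)
    (X := fun m => fieldBracket (𝒢.invField X) (𝒢.invField Y) (𝒢.u m))
    (hX.ker_fieldBracket hY _)
  rw [hi, ← key]
  rw [← hm] at h0 hs hv
  rw [← hv, ← h0, ← tderiv_comp_apply (f := c) (by rw [h0]; exact hR.mdiff) hc,
    tderiv_congr (g := fun t => 𝒢.mul (c t) g)]
  filter_upwards [hs] with t ht
  simp only [R, ht, hβg]

theorem IsAlgSection.bracket {𝒢 : LieGroupoid EM EG M G} [FiniteDimensional ℝ EM]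
    [FiniteDimensional ℝ EG] {X Y : M → EG} (hX : 𝒢.IsAlgSection X) (hY : 𝒢.IsAlgSection Y) :
    𝒢.IsAlgSection (𝒢.algBracket X Y) := by
  refine 𝒢.isAlgSection_iff.2 ⟨fun m => hX.ker_fieldBracket hY (𝒢.u m), fun m => ?_⟩
  have h1 := fun g => hX.smooth_invField g
  have h2 := fun g => hY.smooth_invField g
  unfold SmoothAlongAt at h1 h2
  have : CompleteSpace EG := FiniteDimensional.complete ℝ EG
  have : IsManifold 𝓘(ℝ, EG) (minSmoothness ℝ 2) G :=
    .of_le (n := ∞) (by rw [minSmoothness_of_isRCLikeNormedField]; exact ENat.LEInfty.out)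
  have : IsManifold 𝓘(ℝ, EG) (((⊤ : ℕ∞) : WithTop ℕ∞) + 1) G := ‹IsManifold 𝓘(ℝ, EG) ∞ G›
  have := ContMDiffAt.mlieBracket_vectorField (n := (⊤ : ℕ∞)) (m := (⊤ : ℕ∞)) (h1 (𝒢.u m))
    (h2 (𝒢.u m)) (by simp)
  have h3 : SmoothAlongAt EG 𝓘(ℝ, EG) (fun g : G => g)
    (fieldBracket (𝒢.invField X) (𝒢.invField Y)) (𝒢.u m) := this
  exact h3.comp (𝒢.u_smooth m)

end LieGroupoid

/-! ### Smooth local inverses. -/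

section LocalInverse

/-- A smooth map with invertible derivative restricts to a smooth diffeomorphism between open
sets. -/
theorem ContDiffOn.exists_openPartialHomeomorph {E : Type*} [NormedAddCommGroup E]
    [NormedSpace ℝ E] [CompleteSpace E] {Φ : E → E} {Ω : Set E} (hΩ : IsOpen Ω)
    (hΦ : ContDiffOn ℝ ∞ Φ Ω) {z : E} (hz : z ∈ Ω)
    (h1 : fderiv ℝ Φ z = ContinuousLinearMap.id ℝ E) :
    ∃ e : OpenPartialHomeomorph E E, z ∈ e.source ∧ e.source ⊆ Ω ∧ (∀ y, e y = Φ y) ∧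
      ContDiffOn ℝ ∞ e e.source ∧ ContDiffOn ℝ ∞ e.symm e.target := by
  have hΦz : ContDiffAt ℝ ∞ Φ z := hΦ.contDiffAt (hΩ.mem_nhds hz)
  have hd : HasFDerivAt Φ ((ContinuousLinearEquiv.refl ℝ E : E ≃L[ℝ] E) : E →L[ℝ] E) z := by
    have := (hΦz.differentiableAt (by simp)).hasFDerivAt
    rwa [h1] at this
  let e₀ := hΦz.toOpenPartialHomeomorph Φ hd (by simp)
  have he₀ : ∀ y, e₀ y = Φ y := fun y => rfl
  -- Shrinking to the open set of points with invertible derivative makes the inverse smooth on the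
  -- whole target.
  have hopen : IsOpen (Ω ∩ {y | (fderiv ℝ Φ y) ∈
      Set.range ((↑) : (E ≃L[ℝ] E) → E →L[ℝ] E)}) :=
    (hΦ.continuousOn_fderiv_of_isOpen hΩ (by simp)).isOpen_inter_preimage hΩ
      ContinuousLinearEquiv.isOpen
  have hmem : z ∈ Ω ∩ {y | (fderiv ℝ Φ y) ∈ Set.range ((↑) : (E ≃L[ℝ] E) → E →L[ℝ] E)} :=
    ⟨hz, ⟨ContinuousLinearEquiv.refl ℝ E, h1.symm⟩⟩
  set Ω' := Ω ∩ {y | (fderiv ℝ Φ y) ∈ Set.range ((↑) : (E ≃L[ℝ] E) → E →L[ℝ] E)} with hΩ'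
  have hsub : (e₀.restrOpen Ω' hopen).source ⊆ Ω' := by
    rw [e₀.restrOpen_source]; exact Set.inter_subset_right
  refine ⟨e₀.restrOpen Ω' hopen, ?_, fun y hy => (hsub hy).1, fun y => rfl, ?_, ?_⟩
  · rw [e₀.restrOpen_source]
    exact ⟨hΦz.mem_toOpenPartialHomeomorph_source hd (by simp), hmem⟩
  · exact (hΦ.mono fun y hy => (hsub hy).1)
  · intro y hy
    have h2 := hsub ((e₀.restrOpen Ω' hopen).map_target hy)
    obtain ⟨h3, f', hf'⟩ := h2
    have h4 : ContDiffAt ℝ ∞ Φ ((e₀.restrOpen Ω' hopen).symm y) := hΦ.contDiffAt (hΩ.mem_nhds h3)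
    refine ((e₀.restrOpen Ω' hopen).contDiffAt_symm (f₀' := f') hy ?_ h4).contDiffWithinAt
    rw [hf']
    exact (h4.differentiableAt (by simp)).hasFDerivAt

end LocalInverse

/-! ### Adapted charts, tangent spaces of submanifolds, and tangency of brackets. -/

section Submanifold

open Filter

variable {E : Type*} [NormedAddCommGroup E] [NormedSpace ℝ E] [FiniteDimensional ℝ E]
  {M : Type*} [TopologicalSpace M] [ChartedSpace E M] [IsManifold 𝓘(ℝ, E) ∞ M]

/-- Projecting to a complement turns membership in `V` into a linear equation, which can be
differentiated. -/
theorem Submodule.exists_clm_surjective_ker_eq (V : Submodule ℝ E) :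
    ∃ (R : Submodule ℝ E) (π : E →L[ℝ] R), Function.Surjective π ∧ ∀ v, π v = 0 ↔ v ∈ V := by
  obtain ⟨W, hW⟩ := V.exists_isCompl
  refine ⟨W, (W.projectionOnto V hW.symm).toContinuousLinearMap, ?_, fun v => ?_⟩
  · intro w
    exact ⟨w, by simp⟩
  · simp

theorem Submodule.tderiv_mem {V : Submodule ℝ E} {c : ℝ → E}
    (hc : MDifferentiableAt 𝓘(ℝ, ℝ) 𝓘(ℝ, E) c 0) (h : ∀ᶠ t in 𝓝 0, c t ∈ V) :
    tderiv ℝ E c 0 1 ∈ V := by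
  obtain ⟨R, π, -, hπ⟩ := V.exists_clm_surjective_ker_eq
  rw [← hπ]
  have h1 : tderiv ℝ R (fun t => π (c t)) 0 1 = π (tderiv ℝ E c 0 1) := by
    rw [tderiv_comp_apply π.differentiableAt.mdifferentiableAt hc, tderiv_eq_fderiv π, π.fderiv]
  rw [← h1, tderiv_congr (g := fun _ => (0 : R)), tderiv_const]
  · rfl
  · filter_upwards [h] with t ht using (hπ _).2 ht

/-- The zero set of a submersion is an embedded submanifold, whose tangent space contains the kernel
of the derivative. -/
theorem exists_chart_of_zero_set {R : Type*} [NormedAddCommGroup R] [NormedSpace ℝ R]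
    [FiniteDimensional ℝ R] {S U : Set M} (hU : IsOpen U) {x : M} (hx : x ∈ U) {f : M → R}
    (hf : ContMDiffOn 𝓘(ℝ, E) 𝓘(ℝ, R) ∞ f U) (hfx : Function.Surjective (tderiv E R f x))
    (hS : ∀ y ∈ U, y ∈ S ↔ f y = 0) :
    ∃ φ ∈ IsManifold.maximalAtlas 𝓘(ℝ, E) ∞ M, x ∈ φ.source ∧
      ∃ V : Submodule ℝ E, (∀ y ∈ φ.source, y ∈ S ↔ φ y ∈ V) ∧
        ∀ v, tderiv E R f x v = 0 → tderiv E E φ x v ∈ V := by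
  have : CompleteSpace E := FiniteDimensional.complete ℝ E
  set ψ := chartAt E x with hψ
  have hψ' : ψ ∈ IsManifold.maximalAtlas 𝓘(ℝ, E) ∞ M := IsManifold.chart_mem_maximalAtlas x
  have hxs : x ∈ ψ.source := mem_chart_source E x
  have hzt : ψ x ∈ ψ.target := mem_chart_target E x
  obtain ⟨S', hS'⟩ := ContinuousLinearMap.exists_rightInverse_of_surjective (tderiv E R f x)
    (LinearMap.range_eq_top.2 hfx)
  set A := tderiv E R f x with hA
  have hAS : ∀ v, A (S' v) = v := fun v => congrArg (fun T : R →L[ℝ] R => T v) hS'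
  let g : E → R := fun y => f (ψ.symm y)
  let Ω : Set E := ψ.target ∩ ψ.symm ⁻¹' U
  have hΩ : IsOpen Ω := ψ.isOpen_inter_preimage_symm hU
  have hzΩ : ψ x ∈ Ω := ⟨hzt, by simpa [ψ.left_inv hxs] using hx⟩
  have hg : ContDiffOn ℝ ∞ g Ω := by
    refine ContMDiffOn.contDiffOn ?_
    exact hf.comp ((contMDiffOn_symm_of_mem_maximalAtlas hψ').mono Set.inter_subset_left)
      (fun y hy => hy.2)
  have hgz : fderiv ℝ g (ψ x) = A := by
    rw [← tderiv_eq_fderiv, tderiv_comp (E := E) (E' := E) (E'' := R) (g := f) (f := ψ.symm),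
      ψ.left_inv hxs, hψ, tderiv_chartAt_symm_self]
    · rfl
    · rw [ψ.left_inv hxs]
      exact (hf.contMDiffAt (hU.mem_nhds hx)).mdiff
    · exact mdifferentiableAt_chart_symm hψ' hzt
  -- Straightens `g`: since `A S' = 1`, one has `A ∘ Φ = g`, and the derivative of `Φ` at the base
  -- point is the identity. The zero set of `g` becomes `ker A`.
  let Φ : E → E := fun y => y + S' (g y - A y)
  have hΦ : ContDiffOn ℝ ∞ Φ Ω :=
    contDiffOn_id.add (S'.contDiff.comp_contDiffOn (hg.sub A.contDiff.contDiffOn))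
  have hΦz : HasFDerivAt Φ (ContinuousLinearMap.id ℝ E) (ψ x) := by
    have h1 : HasFDerivAt g A (ψ x) := by
      rw [← hgz]
      exact ((hg.contDiffAt (hΩ.mem_nhds hzΩ)).differentiableAt (by simp)).hasFDerivAt
    have h2 := (hasFDerivAt_id (ψ x)).add (S'.hasFDerivAt.comp (ψ x) (h1.sub A.hasFDerivAt))
    convert! h2 using 1
    simp
  obtain ⟨e, hze, heΩ, heΦ, he1, he2⟩ := hΦ.exists_openPartialHomeomorph hΩ hzΩ hΦz.fderiv
  have hφ : ψ.trans e ∈ IsManifold.maximalAtlas 𝓘(ℝ, E) ∞ M := by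
    refine OpenPartialHomeomorph.mem_maximalAtlas_of_contMDiffOn _ ?_ ?_
    · refine (he1.contMDiffOn.comp (t := e.source) ((contMDiffOn_of_mem_maximalAtlas hψ').mono ?_)
        ?_)
      · intro y hy; rw [ψ.trans_source] at hy; exact hy.1
      · intro y hy; rw [ψ.trans_source] at hy; exact hy.2
    · refine ((contMDiffOn_symm_of_mem_maximalAtlas hψ').comp (t := ψ.target)
        (he2.contMDiffOn.mono ?_) ?_)
      · intro y hy; rw [ψ.trans_target] at hy; exact hy.1
      · intro y hy; rw [ψ.trans_target] at hy; exact hy.2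
  refine ⟨ψ.trans e, hφ, ?_, LinearMap.ker A.toLinearMap, ?_, ?_⟩
  · rw [ψ.trans_source]; exact ⟨hxs, hze⟩
  · intro y hy
    rw [ψ.trans_source] at hy
    have h1 := heΩ hy.2
    have hyU : y ∈ U := by simpa [ψ.left_inv hy.1] using h1.2
    have h2 : A (ψ.trans e y) = f y := by
      have : ψ.trans e y = Φ (ψ y) := by rw [← heΦ]; rfl
      rw [this]
      simp only [Φ, map_add, hAS, g, ψ.left_inv hy.1]
      abel
    rw [hS y hyU, LinearMap.mem_ker, ← h2]; rfl
  · intro v hv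
    have h1 : tderiv E E (ψ.trans e) x v = v := by
      have h3 : MDifferentiableAt 𝓘(ℝ, E) 𝓘(ℝ, E) Φ (ψ x) := hΦz.differentiableAt.mdifferentiableAt
      have h2 : tderiv E E (ψ.trans e) x = tderiv E E (fun y => Φ (ψ y)) x :=
        tderiv_congr (Eventually.of_forall fun y => heΦ (ψ y))
      rw [h2, tderiv_comp_apply h3 (mdifferentiableAt_chart hψ' hxs), hψ, tderiv_chartAt_self,
        ← hψ, hΦz.tderiv_eq]
      rfl
    rw [h1]
    exact hv

variable {S : Set M} {φ : OpenPartialHomeomorph M E} {V : Submodule ℝ E}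

/-- A curve in `S` becomes a curve in `V`, whose velocity lies in `V`; conversely a vector of `V` is
the velocity of a straight segment in the chart, so every element of the span is itself a velocity.
-/
theorem mem_tangentSub_iff (hφ : φ ∈ IsManifold.maximalAtlas 𝓘(ℝ, E) ∞ M)
    (hV : ∀ y ∈ φ.source, y ∈ S ↔ φ y ∈ V) {x : M} (hx : x ∈ φ.source) (hxS : x ∈ S) {v : E} :
    v ∈ tangentSub E S x ↔ tderiv E E φ x v ∈ V := by
  constructor
  · intro hv
    have h1 : tangentSub E S x ≤ V.comap (tderiv E E φ x).toLinearMap := by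
      refine Submodule.span_le.2 ?_
      rintro w ⟨c, hc0, ⟨ε, hε, hc, hcS⟩, hw⟩
      have hc1 : MDifferentiableAt 𝓘(ℝ, ℝ) 𝓘(ℝ, E) c 0 :=
        (hc.contMDiffAt (Ioo_mem_nhds (by linarith) hε)).mdiff
      change tderiv E E φ x w ∈ V
      have hφc : MDifferentiableAt 𝓘(ℝ, E) 𝓘(ℝ, E) φ (c 0) := by
        rw [hc0]; exact mdifferentiableAt_chart hφ hx
      have h2 : tderiv ℝ E c 0 1 = w := hw
      have h3 : tderiv ℝ E (fun t => φ (c t)) 0 1 = tderiv E E φ x w := by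
        rw [tderiv_comp_apply hφc hc1, hc0, h2]
      rw [← h3]
      refine V.tderiv_mem (hφc.comp (0 : ℝ) hc1) ?_
      filter_upwards [Ioo_mem_nhds (show -ε < 0 by linarith) hε, hc1.continuousAt.eventually
        (φ.open_source.mem_nhds (by rwa [hc0]))] with t h4 h5
      exact (hV _ h5).1 (hcS t h4)
    exact h1 hv
  · intro hv
    refine Submodule.subset_span ?_
    set w := tderiv E E φ x v with hw
    have ht : φ x ∈ φ.target := φ.map_source hx
    have hl : ContDiff ℝ ∞ fun t : ℝ => φ x + t • w := by fun_prop
    have hnear : ∀ᶠ t in 𝓝 (0 : ℝ), φ x + t • w ∈ φ.target :=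
      hl.continuous.continuousAt.eventually (by simpa using φ.open_target.mem_nhds ht)
    obtain ⟨ε, hε, hball⟩ := Metric.eventually_nhds_iff.1 hnear
    have hIoo : ∀ t ∈ Set.Ioo (-ε) ε, φ x + t • w ∈ φ.target := fun t h =>
      hball (by rw [Real.dist_eq, sub_zero]; exact abs_lt.2 h)
    refine ⟨fun t => φ.symm (φ x + t • w), by simp [φ.left_inv hx], ⟨ε, hε, ?_, ?_⟩, ?_⟩
    · exact (contMDiffOn_symm_of_mem_maximalAtlas hφ).comp hl.contMDiff.contMDiffOn hIoo
    · intro t h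
      have h1 := hIoo t h
      rw [hV _ (φ.map_target h1), φ.right_inv h1]
      exact V.add_mem ((hV x hx).1 hxS) (V.smul_mem t hv)
    · have h1 : HasFDerivAt (fun t : ℝ => φ x + t • w)
          (ContinuousLinearMap.toSpanSingleton ℝ w) 0 :=
        ((hasFDerivAt_id (𝕜 := ℝ) (0 : ℝ)).smul_const w).const_add (φ x)
      have h2 := tderiv_comp_apply (g := φ.symm) (f := fun t : ℝ => φ x + t • w) (x := (0 : ℝ))
        (by rw [zero_smul, add_zero]; exact mdifferentiableAt_chart_symm hφ ht)
        h1.differentiableAt.mdifferentiableAt (1 : ℝ)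
      refine Eq.trans h2 ?_
      rw [h1.tderiv_eq, zero_smul, add_zero]
      simp [hw, tderiv_symm_tderiv hφ hx]
      rfl

/-- The bracket of vector fields tangent to an embedded submanifold is tangent to it. -/
theorem IsEmbeddedSubmanifold.fieldBracket_mem (hS : IsEmbeddedSubmanifold E S) {x : M}
    (hx : x ∈ S) {v w : M → E} (hv : SmoothAlongAt E 𝓘(ℝ, E) (fun y : M => y) v x)
    (hw : SmoothAlongAt E 𝓘(ℝ, E) (fun y : M => y) w x)
    (hvS : ∀ y ∈ S, v y ∈ tangentSub E S y) (hwS : ∀ y ∈ S, w y ∈ tangentSub E S y) :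
    fieldBracket v w x ∈ tangentSub E S x := by
  obtain ⟨φ, hφ, hxs, V, hV⟩ := hS x hx
  rw [mem_tangentSub_iff hφ hV hxs hx]
  have hsm : ∀ {v : M → E}, SmoothAlongAt E 𝓘(ℝ, E) (fun y : M => y) v x →
      ContDiffAt ℝ ∞ (fun z => tderiv E E φ (φ.symm z) (v (φ.symm z))) (φ x) := by
    intro v hv
    exact (ContMDiffAt.comp_of_eq (g := fun q => tderiv E E φ q (v q))
      ((smoothAlongAt_iff_of_chart hφ hxs).1 hv).2
      (contMDiffAt_symm_of_mem_maximalAtlas hφ (φ.map_source hxs)) (φ.left_inv hxs)).contDiffAt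
  have hrel : ∀ v : M → E, ∀ᶠ y in 𝓝 x, tderiv E E φ y (v y) =
      (fun z => tderiv E E φ (φ.symm z) (v (φ.symm z))) (φ y) := by
    intro v
    filter_upwards [φ.open_source.mem_nhds hxs] with y hy
    simp only [φ.left_inv hy]
  have hmem : ∀ {v : M → E}, (∀ y ∈ S, v y ∈ tangentSub E S y) → ∀ z ∈ φ.target, z ∈ V →
      tderiv E E φ (φ.symm z) (v (φ.symm z)) ∈ V := by
    intro v hv z hz hzV
    have h1 := φ.map_target hz
    have h2 : φ.symm z ∈ S := by rwa [hV _ h1, φ.right_inv hz]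
    exact (mem_tangentSub_iff hφ hV h1 h2).1 (hv _ h2)
  -- A map sending `V` to `V` has derivative preserving `V`. Both terms of the bracket in the
  -- adapted chart are of this form.
  have hder : ∀ {a : E → E}, ContDiffAt ℝ ∞ a (φ x) → (∀ z ∈ φ.target, z ∈ V → a z ∈ V) →
      ∀ b ∈ V, fderiv ℝ a (φ x) b ∈ V := by
    intro a ha haV b hb
    have h1 : HasFDerivAt (fun t : ℝ => φ x + t • b)
        (ContinuousLinearMap.toSpanSingleton ℝ b) 0 :=
      ((hasFDerivAt_id (𝕜 := ℝ) (0 : ℝ)).smul_const b).const_add (φ x)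
    have h0 : φ x + (0 : ℝ) • b = φ x := by simp
    have h3 : MDifferentiableAt 𝓘(ℝ, E) 𝓘(ℝ, E) a (φ x + (0 : ℝ) • b) := by
      rw [h0]; exact (ha.differentiableAt (by simp)).mdifferentiableAt
    have h2 := tderiv_comp_apply (g := a) (f := fun t : ℝ => φ x + t • b) (x := (0 : ℝ))
      h3 h1.differentiableAt.mdifferentiableAt (1 : ℝ)
    rw [h1.tderiv_eq, h0, tderiv_eq_fderiv a] at h2
    simp only [ContinuousLinearMap.toSpanSingleton_apply, one_smul] at h2
    rw [← h2]
    refine V.tderiv_mem (h3.comp (0 : ℝ) h1.differentiableAt.mdifferentiableAt) ?_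
    have h4 : φ.target ∈ 𝓝 (φ x + (0 : ℝ) • b) := by
      rw [h0]; exact φ.open_target.mem_nhds (φ.map_source hxs)
    filter_upwards [h1.continuousAt.eventually h4] with t ht
    exact haV _ ht (V.add_mem ((hV x hxs).1 hx) (V.smul_mem t hb))
  have htm := φ.map_source hxs
  have hxV := (hV x hxs).1 hx
  have hself : ∀ a : E → E, chartField a (φ x) = a := by
    intro a
    ext z
    have : tderiv E E (fun y : E => y) z (a z) = a z := by rw [tderiv_id]; rfl
    exact this
  rw [tderiv_fieldBracket_of_related (contMDiffAt_of_mem_maximalAtlas hφ hxs) hv hw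
    (smoothAlongAt_model_iff.2 ⟨contMDiffAt_id, (hsm hv).contMDiffAt⟩)
    (smoothAlongAt_model_iff.2 ⟨contMDiffAt_id, (hsm hw).contMDiffAt⟩) (hrel v) (hrel w),
    fieldBracket_eq, hself, hself]
  exact V.sub_mem (hder (hsm hw) (hmem hwS) _ (hmem hvS _ htm hxV))
    (hder (hsm hv) (hmem hvS) _ (hmem hwS _ htm hxV))

end Submanifold

/-! ### Local extension, gluing and cutting off of vector fields along maps. -/

section Extension

open Filter

variable {E E' : Type*} [NormedAddCommGroup E] [NormedSpace ℝ E]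
  [NormedAddCommGroup E'] [NormedSpace ℝ E']
  {M N : Type*} [TopologicalSpace M] [ChartedSpace E M] [TopologicalSpace N] [ChartedSpace E' N]
  [IsManifold 𝓘(ℝ, E) ∞ M] [IsManifold 𝓘(ℝ, E') ∞ N]

/-- A vector field along the restriction of a smooth map `b` to a subset is smooth if and only if it
extends locally to a smooth vector field along `b`. -/
theorem smoothNear_along_iff {S : Set M} {b : M → N} (hb : ContMDiff 𝓘(ℝ, E) 𝓘(ℝ, E') ∞ b)
    {a : S → E'} {x : S} :
    SmoothNear (E := E) 𝓘(ℝ, E').tangent (fun q : S => (⟨b q, a q⟩ : TangentBundle 𝓘(ℝ, E') N)) x ↔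
      ∃ U : Set M, IsOpen U ∧ (x : M) ∈ U ∧ ∃ X : M → E',
        (∀ m ∈ U, SmoothAlongAt E' 𝓘(ℝ, E) b X m) ∧ ∀ y : S, (y : M) ∈ U → X y = a y := by
  constructor
  · rintro ⟨U, hU, hx, F, hF, hFa⟩
    set χ := chartAt E' (b x) with hχ
    have hχ' : χ ∈ IsManifold.maximalAtlas 𝓘(ℝ, E') ∞ N := IsManifold.chart_mem_maximalAtlas (b x)
    have hF' : ∀ m ∈ U, SmoothAlongAt E' 𝓘(ℝ, E) (fun m => (F m).1) (fun m => (F m).2) m :=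
      fun m hm => hF.contMDiffAt (hU.mem_nhds hm)
    have hcont : ContinuousOn (fun m => (F m).1) U := fun m hm =>
      (hF' m hm).base.continuousAt.continuousWithinAt
    have hFx : (F x).1 = b x := by rw [hFa x hx]
    have hxs : b x ∈ χ.source := mem_chart_source E' (b x)
    -- Away from `S` the extension `F` need not lie over `b`. Its vector part is read in the chart
    -- `χ` and placed at `b m` with the same coordinates.
    refine ⟨(U ∩ (fun m => (F m).1) ⁻¹' χ.source) ∩ b ⁻¹' χ.source,
      (hcont.isOpen_inter_preimage hU χ.open_source).inter (χ.open_source.preimage hb.continuous),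
      ⟨⟨hx, by simpa [hFx] using hxs⟩, hxs⟩, fun m => tderiv E' E' χ.symm (χ (b m))
        (tderiv E' E' χ (F m).1 (F m).2), ?_, ?_⟩
    · rintro m ⟨⟨hm, h1⟩, h2⟩
      have h3 := ((smoothAlongAt_iff_of_chart (b := fun m => (F m).1)
        (v := fun m => (F m).2) hχ' h1).1 (hF' m hm)).2
      refine (smoothAlongAt_iff_of_chart hχ' h2).2 ⟨hb m, h3.congr_of_eventuallyEq ?_⟩
      filter_upwards [(χ.open_source.preimage hb.continuous).mem_nhds h2] with y hy
      rw [tderiv_tderiv_symm hχ' hy]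
    · rintro y ⟨⟨hy, h1⟩, h2⟩
      have h3 := hFa y hy
      have h4 : tderiv E' E' χ (F y).1 (F y).2 = tderiv E' E' χ (b y) (a y) := by rw [h3]
      simp only [h4]
      exact tderiv_symm_tderiv hχ' h2 _
  · rintro ⟨U, hU, hx, X, hX, hXa⟩
    refine ⟨U, hU, hx, fun m => ⟨b m, X m⟩, fun m hm => (hX m hm).contMDiffWithinAt, ?_⟩
    intro y hy
    exact congrArg (fun v : E' => (⟨b y, v⟩ : TangentBundle 𝓘(ℝ, E') N)) (hXa y hy)

/-- Smooth vector fields along a map which satisfy locally a convex condition can be glued. -/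
theorem exists_smoothAlong_of_local [FiniteDimensional ℝ E] [T2Space M] [CompactSpace M]
    {b : M → N} (hb : ContMDiff 𝓘(ℝ, E) 𝓘(ℝ, E') ∞ b) {C : M → Set E'}
    (hC : ∀ m, Convex ℝ (C m))
    (h : ∀ x, ∃ U : Set M, IsOpen U ∧ x ∈ U ∧ ∃ X : M → E',
      (∀ m ∈ U, SmoothAlongAt E' 𝓘(ℝ, E) b X m) ∧ ∀ m ∈ U, X m ∈ C m) :
    ∃ X : M → E', (∀ m, SmoothAlongAt E' 𝓘(ℝ, E) b X m) ∧ ∀ m, X m ∈ C m := by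
  choose U hU hxU X hX hXC using h
  obtain ⟨t, ht⟩ := isCompact_univ.elim_finite_subcover U hU
    (fun x _ => Set.mem_iUnion.2 ⟨x, hxU x⟩)
  obtain ⟨f, hf⟩ := SmoothPartitionOfUnity.exists_isSubordinate 𝓘(ℝ, E) isClosed_univ
    (fun i : t => U i) (fun i => hU i) (fun x hx => by
      obtain ⟨i, hi, hx⟩ := Set.mem_iUnion₂.1 (ht hx)
      exact Set.mem_iUnion.2 ⟨⟨i, hi⟩, hx⟩)
  refine ⟨fun m => ∑ i : t, f i m • X i m, fun m => ?_, fun m => ?_⟩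
  · have : ∀ s : Finset t, SmoothAlongAt E' 𝓘(ℝ, E) b (fun m => ∑ i ∈ s, f i m • X i m) m := by
      classical
      intro s
      induction s using Finset.induction_on with
      | empty => simpa using smoothAlongAt_zero (hb m)
      | insert i s hi ih =>
        simp only [Finset.sum_insert hi]
        refine SmoothAlongAt.add ?_ ih
        by_cases hm : m ∈ U i
        · exact (hX i m hm).smul (f i).contMDiff.contMDiffAt
        · refine (smoothAlongAt_zero (hb m)).congr EventuallyEq.rfl ?_
          have : m ∉ tsupport (f i) := fun h => hm (hf i h)
          filter_upwards [notMem_tsupport_iff_eventuallyEq.1 this] with y hy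
          rw [hy, Pi.zero_apply, zero_smul]
    exact this Finset.univ
  · have := (hC m).finsum_mem (fun i => f.nonneg i m) (f.sum_eq_one (Set.mem_univ m))
      (z := fun i : t => X i m) (fun i hi => hXC i m (hf i (subset_tsupport _ hi)))
    rwa [finsum_eq_sum_of_fintype] at this

/-- A smooth vector field along a map can be cut off outside an open set. -/
theorem exists_cutoff [FiniteDimensional ℝ E] [T2Space M]
    {b : M → N} (hb : ContMDiff 𝓘(ℝ, E) 𝓘(ℝ, E') ∞ b) {U : Set M} (hU : IsOpen U) {x : M}
    (hx : x ∈ U) :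
    ∃ f : M → ℝ, f =ᶠ[𝓝 x] 1 ∧ (∀ m ∉ U, f m = 0) ∧ ∀ X : M → E', (∀ m ∈ U, SmoothAlongAt E' 𝓘(ℝ, E) b X m) →
      ∀ m, SmoothAlongAt E' 𝓘(ℝ, E) b (fun m => f m • X m) m := by
  obtain ⟨f, -, hf⟩ := (SmoothBumpFunction.nhds_basis_tsupport (I := 𝓘(ℝ, E)) x).mem_iff.1
    (hU.mem_nhds hx)
  refine ⟨f, f.eventuallyEq_one,
    fun m hm => image_eq_zero_of_notMem_tsupport fun h => hm (hf h), fun X hX m => ?_⟩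
  by_cases hm : m ∈ U
  · exact (hX m hm).smul f.contMDiff.contMDiffAt
  · refine (smoothAlongAt_zero (hb m)).congr EventuallyEq.rfl ?_
    have : m ∉ tsupport f := fun h => hm (hf h)
    filter_upwards [notMem_tsupport_iff_eventuallyEq.1 this] with y hy
    rw [hy, Pi.zero_apply, zero_smul]

end Extension

/-! ### Extension of sections of the Lie algebroid from closed subsets. -/

namespace LieGroupoid

open Filter

variable {EM EG : Type*} [NormedAddCommGroup EM] [NormedSpace ℝ EM]
  [NormedAddCommGroup EG] [NormedSpace ℝ EG]
  {M G : Type*} [TopologicalSpace M] [ChartedSpace EM M] [TopologicalSpace G] [ChartedSpace EG G]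
  [IsManifold 𝓘(ℝ, EM) ∞ M] [IsManifold 𝓘(ℝ, EG) ∞ G] {𝒢 : LieGroupoid EM EG M G}

/-- Subtracting `Tu (Ts v)` projects onto `A` along the tangent space of the units. This corrects an
arbitrary extension to one with values in `A`. -/
theorem tderiv_s_sub_tderiv_u (m : M) (v : EG) :
    tderiv EG EM 𝒢.s (𝒢.u m) (v - tderiv EM EG 𝒢.u m (tderiv EG EM 𝒢.s (𝒢.u m) v)) = 0 := by
  rw [map_sub, 𝒢.tderiv_s_u, sub_self]

theorem smoothAlongAt_sub_tderiv_u {X : M → EG} {m : M}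
    (hX : SmoothAlongAt EG 𝓘(ℝ, EM) 𝒢.u X m) :
    SmoothAlongAt EG 𝓘(ℝ, EM) 𝒢.u
      (fun m => X m - tderiv EM EG 𝒢.u m (tderiv EG EM 𝒢.s (𝒢.u m) (X m))) m := by
  have h1 : SmoothAlongAt EM 𝓘(ℝ, EM) (fun m => m)
      (fun m => tderiv EG EM 𝒢.s (𝒢.u m) (X m)) m :=
    (hX.pushforward (𝒢.s_smooth _)).congr
      (Eventually.of_forall fun m => (𝒢.s_unit m).symm) EventuallyEq.rfl
  exact hX.sub (h1.pushforward (𝒢.u_smooth m))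

theorem smoothAlongAt_rangeDeriv {X : M → EG} {m : M}
    (hX : SmoothAlongAt EG 𝓘(ℝ, EM) 𝒢.u X m) :
    SmoothAlongAt EM 𝓘(ℝ, EM) (fun m => m) (fun m => tderiv EG EM 𝒢.r (𝒢.u m) (X m)) m :=
  (hX.pushforward (𝒢.r_smooth _)).congr
    (Eventually.of_forall fun m => (𝒢.r_unit m).symm) EventuallyEq.rfl

/-- Smooth sections of the Lie algebroid along a closed subset extend to global sections. -/
theorem exists_isAlgSection_extension [FiniteDimensional ℝ EM] [T2Space M] [CompactSpace M]
    {Q : Set M} (hQ : IsClosed Q) {a : Q → EG}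
    (ha : SmoothOnSub (E := EM) 𝓘(ℝ, EG).tangent
      (fun q : Q => (⟨𝒢.u q, a q⟩ : TangentBundle 𝓘(ℝ, EG) G)))
    (hs : ∀ q : Q, tderiv EG EM 𝒢.s (𝒢.u q) (a q) = 0) :
    ∃ X : M → EG, 𝒢.IsAlgSection X ∧ ∀ q : Q, X q = a q := by
  -- Lying in `A` and having the prescribed value on `Q` are together a convex condition, so local
  -- solutions glue. Near a point of `Q` the projected local extension solves it; off `Q`, which is
  -- closed, zero does.
  obtain ⟨X, hX, hXC⟩ := exists_smoothAlong_of_local 𝒢.u_smooth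
    (C := fun m => {v | tderiv EG EM 𝒢.s (𝒢.u m) v = 0 ∧ ∀ hm : m ∈ Q, v = a ⟨m, hm⟩})
    (fun m v hv w hw α β hα hβ hαβ => by
      refine ⟨by rw [map_add, map_smul, map_smul, hv.1, hw.1, smul_zero, smul_zero, add_zero],
        fun hm => ?_⟩
      rw [hv.2 hm, hw.2 hm, ← add_smul, hαβ, one_smul])
    (fun x => by
      by_cases hx : x ∈ Q
      · obtain ⟨U, hU, hxU, X, hX, hXa⟩ := (smoothNear_along_iff 𝒢.u_smooth).1 (ha ⟨x, hx⟩)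
        refine ⟨U, hU, hxU, _, fun m hm => smoothAlongAt_sub_tderiv_u (hX m hm), fun m hm =>
          ⟨tderiv_s_sub_tderiv_u m _, fun hmQ => ?_⟩⟩
        have h1 : X m = a ⟨m, hmQ⟩ := hXa ⟨m, hmQ⟩ hm
        have h2 := hs ⟨m, hmQ⟩
        simp only [h1, h2, map_zero, sub_zero]
      · exact ⟨Qᶜ, hQ.isOpen_compl, hx, fun _ => 0, fun m _ => smoothAlongAt_zero (𝒢.u_smooth m),
          fun m hm => ⟨map_zero _, fun h => absurd h hm⟩⟩)
  exact ⟨X, 𝒢.isAlgSection_iff.2 ⟨fun m => (hXC m).1, hX⟩, fun q => (hXC q).2 q.2⟩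

theorem IsAlgSection.smoothOnSub {X : M → EG} (hX : 𝒢.IsAlgSection X) {Q : Set M} {a : Q → EG}
    (h : ∀ q : Q, X q = a q) : SmoothOnSub (E := EM) 𝓘(ℝ, EG).tangent
      (fun q : Q => (⟨𝒢.u q, a q⟩ : TangentBundle 𝓘(ℝ, EG) G)) :=
  fun _ => (smoothNear_along_iff 𝒢.u_smooth).2
    ⟨Set.univ, isOpen_univ, trivial, X, fun m _ => hX.smooth m, fun y _ => h y⟩

theorem smoothOnSub_rangeDeriv {Q : Set M} {a : Q → EG}
    (ha : SmoothOnSub (E := EM) 𝓘(ℝ, EG).tangent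
      (fun q : Q => (⟨𝒢.u q, a q⟩ : TangentBundle 𝓘(ℝ, EG) G))) :
    SmoothOnSub (E := EM) 𝓘(ℝ, EM).tangent
      (fun q : Q => (⟨q, tderiv EG EM 𝒢.r (𝒢.u q) (a q)⟩ : TangentBundle 𝓘(ℝ, EM) M)) := by
  intro x
  obtain ⟨U, hU, hxU, X, hX, hXa⟩ := (smoothNear_along_iff 𝒢.u_smooth).1 (ha x)
  exact (smoothNear_along_iff (b := fun m : M => m) contMDiff_id).2 ⟨U, hU, hxU, _,
    fun m hm => smoothAlongAt_rangeDeriv (hX m hm), fun y hy => by rw [hXa y hy]⟩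

theorem IsAlgSection.add {X Y : M → EG} (hX : 𝒢.IsAlgSection X) (hY : 𝒢.IsAlgSection Y) :
    𝒢.IsAlgSection (fun m => X m + Y m : M → EG) :=
  𝒢.isAlgSection_iff.2 ⟨fun m => by rw [map_add, hX.ker, hY.ker, add_zero],
    fun m => (hX.smooth m).add (hY.smooth m)⟩

end LieGroupoid

/-! ### Frames of kernels of surjective linear families. -/

section KernelFrame

/-- The kernels of a smooth family of surjective linear maps have a local frame, with coordinates
given by constant functionals. -/
theorem ContDiffOn.exists_frame_ker {E R : Type*} [NormedAddCommGroup E] [NormedSpace ℝ E]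
    [FiniteDimensional ℝ E] [NormedAddCommGroup R] [NormedSpace ℝ R] [FiniteDimensional ℝ R]
    {Ω : Set E} (hΩ : IsOpen Ω) {B : E → E →L[ℝ] R} (hB : ContDiffOn ℝ ∞ B Ω) {z₀ : E}
    (hz₀ : z₀ ∈ Ω) (hs : Function.Surjective (B z₀)) :
    ∃ W : Set E, IsOpen W ∧ z₀ ∈ W ∧ W ⊆ Ω ∧ ∃ (k : ℕ) (e : Fin k → E → E)
      (c : Fin k → E →L[ℝ] ℝ), (∀ i, ContDiffOn ℝ ∞ (e i) W) ∧
      ∀ z ∈ W, (∀ i, B z (e i z) = 0) ∧ (∀ i j, c i (e j z) = if i = j then 1 else 0) ∧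
        ∀ a, B z a = 0 → a = ∑ i, c i a • e i z := by
  have : CompleteSpace R := FiniteDimensional.complete ℝ R
  obtain ⟨S, hS⟩ := (B z₀).exists_rightInverse_of_surjective (LinearMap.range_eq_top.2 hs)
  have hBS : ∀ y, B z₀ (S y) = y := fun y => congrArg (fun T : R →L[ℝ] R => T y) hS
  -- `A z₀ = 1`, so `A z` is invertible near `z₀`, and `S (A z)⁻¹` is then a right inverse of `B z`.
  let A : E → R →L[ℝ] R := fun z => (B z).comp S
  have hA : ContDiffOn ℝ ∞ A Ω := hB.clm_comp contDiffOn_const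
  have hA0 : A z₀ = 1 := hS
  let W := Ω ∩ A ⁻¹' {T | IsUnit T}
  have hW : IsOpen W := hA.continuousOn.isOpen_inter_preimage hΩ Units.isOpen
  have hWinv : ∀ z ∈ W, ∀ y, Ring.inverse (A z) (B z (S y)) = y := fun z hz y =>
    congrArg (fun T : R →L[ℝ] R => T y) (Ring.inverse_mul_cancel _ hz.2)
  have hWinv' : ∀ z ∈ W, ∀ y, B z (S (Ring.inverse (A z) y)) = y := fun z hz y =>
    congrArg (fun T : R →L[ℝ] R => T y) (Ring.mul_inverse_cancel _ hz.2)
  let K := LinearMap.ker (B z₀).toLinearMap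
  let P : E →L[ℝ] K := (ContinuousLinearMap.id ℝ E - S.comp (B z₀)).codRestrict K (fun v => by
    change B z₀ (v - S (B z₀ v)) = 0
    rw [map_sub, hBS, sub_self])
  have hP : ∀ v, (P v : E) = v - S (B z₀ v) := fun v => rfl
  let b := Module.finBasis ℝ K
  -- The projection onto `ker (B z)` along the range of `S`. This range does not depend on `z`, so
  -- `P` identifies all these kernels with `K` and gives constant coordinate functionals.
  let e : E → E → E := fun v z => v - S (Ring.inverse (A z) (B z v))
  have he : ∀ z ∈ W, ∀ a, B z a = 0 → e (P a) z = a := by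
    intro z hz a ha
    simp only [e, hP, map_sub, ha, hWinv z hz, map_neg, zero_sub]
    abel
  have headd : ∀ z, ∀ (α : Fin (Module.finrank ℝ K) → ℝ) (v : Fin (Module.finrank ℝ K) → E),
      e (∑ i, α i • v i) z = ∑ i, α i • e (v i) z := by
    intro z α v
    simp only [e, map_sum, map_smul, smul_sub, Finset.sum_sub_distrib]
  refine ⟨W, hW, ⟨hz₀, by simp [hA0]⟩, Set.inter_subset_left, Module.finrank ℝ K,
    fun i => e (b i), fun i => (LinearMap.toContinuousLinearMap (b.coord i)).comp P, ?_, ?_⟩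
  · intro i z hz
    have h1 : ContDiffWithinAt ℝ ∞ (fun z => Ring.inverse (A z)) W z := by
      obtain ⟨T, hT⟩ := hz.2
      have h2 : ContDiffAt ℝ ∞ Ring.inverse (A z) := by
        rw [← hT]; exact contDiffAt_ringInverse ℝ T
      exact h2.comp_contDiffWithinAt z ((hA z hz.1).mono Set.inter_subset_left)
    have h3 : ContDiffWithinAt ℝ ∞ B W z := (hB z hz.1).mono Set.inter_subset_left
    exact contDiffWithinAt_const.sub (S.contDiff.contDiffAt.comp_contDiffWithinAt z
      (h1.clm_apply (h3.clm_apply contDiffWithinAt_const)))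
  · intro z hz
    refine ⟨fun i => ?_, fun i j => ?_, fun a ha => ?_⟩
    · simp only [e, map_sub, hWinv' z hz, sub_self]
    · have h1 : P (e (b j) z) = b j := by
        refine Subtype.ext ?_
        have h2 : B z₀ (b j) = 0 := (b j).2
        rw [hP]
        simp only [e, map_sub, hBS, h2, zero_sub, map_neg]
        abel
      simp only [ContinuousLinearMap.comp_apply, h1, LinearMap.coe_toContinuousLinearMap',
        Module.Basis.coord_apply, Module.Basis.repr_self]
      rw [Finsupp.single_apply]
      simp only [eq_comm]
    · conv_lhs => rw [← he z hz a ha, ← b.sum_repr (P a)]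
      simp only [Submodule.coe_sum, Submodule.coe_smul, headd]
      rfl

end KernelFrame

/-! ### Local frames of the pullback. -/

namespace LieGroupoid

open Filter

variable {EM EG : Type*} [NormedAddCommGroup EM] [NormedSpace ℝ EM]
  [NormedAddCommGroup EG] [NormedSpace ℝ EG] [FiniteDimensional ℝ EM] [FiniteDimensional ℝ EG]
  {M G : Type*} [TopologicalSpace M] [ChartedSpace EM M] [TopologicalSpace G] [ChartedSpace EG G]
  [IsManifold 𝓘(ℝ, EM) ∞ M] [IsManifold 𝓘(ℝ, EG) ∞ G] {𝒢 : LieGroupoid EM EG M G}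

/-- If the anchor is transverse to `Q`, then the pullback of the Lie algebroid to `Q` has local
frames, with smooth coordinates. -/
theorem exists_local_frame {Q : Set M} (hQ : IsEmbeddedSubmanifold EM Q)
    (hT : 𝒢.AnchorTransverse Q) {q₀ : M} (hq₀ : q₀ ∈ Q) :
    ∃ U : Set M, IsOpen U ∧ q₀ ∈ U ∧ ∃ (k : ℕ) (e : Fin k → M → EG)
      (c : Fin k → M → EG →L[ℝ] ℝ),
      (∀ i, ∀ m ∈ U, SmoothAlongAt EG 𝓘(ℝ, EM) 𝒢.u (e i) m) ∧
      (∀ i, ∀ m ∈ U, ∀ X : M → EG, SmoothAlongAt EG 𝓘(ℝ, EM) 𝒢.u X m →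
        ContMDiffAt 𝓘(ℝ, EM) 𝓘(ℝ, ℝ) ∞ (fun m => c i m (X m)) m) ∧
      ∀ q ∈ U, q ∈ Q →
        (∀ i, tderiv EG EM 𝒢.s (𝒢.u q) (e i q) = 0 ∧
          tderiv EG EM 𝒢.r (𝒢.u q) (e i q) ∈ tangentSub EM Q q) ∧
        (∀ i j, c i q (e j q) = if i = j then 1 else 0) ∧
        ∀ a, tderiv EG EM 𝒢.s (𝒢.u q) a = 0 →
          tderiv EG EM 𝒢.r (𝒢.u q) a ∈ tangentSub EM Q q → a = ∑ i, c i q a • e i q := by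
  obtain ⟨φ, hφ, hqφ, V, hV⟩ := hQ q₀ hq₀
  obtain ⟨R, π, hπ, hπV⟩ := V.exists_clm_surjective_ker_eq
  set χ := chartAt EG (𝒢.u q₀) with hχ
  have hχ' : χ ∈ IsManifold.maximalAtlas 𝓘(ℝ, EG) ∞ G := IsManifold.chart_mem_maximalAtlas _
  have hqχ : 𝒢.u q₀ ∈ χ.source := mem_chart_source EG _
  let O : Set G := 𝒢.s ⁻¹' φ.source ∩ 𝒢.r ⁻¹' φ.source
  have hO : IsOpen O := (φ.open_source.preimage 𝒢.s_smooth.continuous).inter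
    (φ.open_source.preimage 𝒢.r_smooth.continuous)
  let Ω : Set EG := χ.target ∩ χ.symm ⁻¹' O
  have hΩ : IsOpen Ω := χ.isOpen_inter_preimage_symm hO
  have hcomp : ∀ {f : G → M}, ContMDiff 𝓘(ℝ, EG) 𝓘(ℝ, EM) ∞ f → O ⊆ f ⁻¹' φ.source →
      ContDiffOn ℝ ∞ (fun z => φ (f (χ.symm z))) Ω := by
    intro f hf hfO
    refine ContMDiffOn.contDiffOn ?_
    exact (contMDiffOn_of_mem_maximalAtlas hφ).comp (t := φ.source)
      (hf.comp_contMDiffOn ((contMDiffOn_symm_of_mem_maximalAtlas hχ').mono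
        Set.inter_subset_left)) (fun z hz => hfO hz.2)
  -- At units over `Q` the kernel of `B` is the fibre of the pullback: the first component tests `Ts
  -- a = 0`, the second tests that `Tr a` is tangent to `Q`. Elsewhere `B` only serves to extend the
  -- frame smoothly.
  let B : EG → EG →L[ℝ] EM × R := fun z => (fderiv ℝ (fun z => φ (𝒢.s (χ.symm z))) z).prod
    (π.comp (fderiv ℝ (fun z => φ (𝒢.r (χ.symm z))) z))
  have hB : ContDiffOn ℝ ∞ B Ω := by
    have h1 := (hcomp 𝒢.s_smooth Set.inter_subset_left).fderiv_of_isOpen (m := ∞) hΩ (by simp)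
    have h2 := (hcomp 𝒢.r_smooth Set.inter_subset_right).fderiv_of_isOpen (m := ∞) hΩ (by simp)
    refine (((contDiffOn_const (c := ContinuousLinearMap.inl ℝ EM R)).clm_comp h1).add
      ((contDiffOn_const (c := (ContinuousLinearMap.inr ℝ EM R).comp π)).clm_comp h2)).congr ?_
    intro z _
    ext v <;> simp [B]
  have hder : ∀ {f : G → M}, ContMDiff 𝓘(ℝ, EG) 𝓘(ℝ, EM) ∞ f → ∀ {q : M}, 𝒢.u q ∈ χ.source →
      q ∈ φ.source → f (𝒢.u q) = q → ∀ v, fderiv ℝ (fun z => φ (f (χ.symm z))) (χ (𝒢.u q)) v =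
        tderiv EM EM φ q (tderiv EG EM f (𝒢.u q) (tderiv EG EG χ.symm (χ (𝒢.u q)) v)) := by
    intro f hf q h1 h2 h3 v
    have hsymm := mdifferentiableAt_chart_symm hχ' (χ.map_source h1)
    have hf' : MDifferentiableAt 𝓘(ℝ, EG) 𝓘(ℝ, EM) f (χ.symm (χ (𝒢.u q))) := (hf _).mdiff
    have e1 : f (χ.symm (χ (𝒢.u q))) = q := by rw [χ.left_inv h1, h3]
    have hφ' : MDifferentiableAt 𝓘(ℝ, EM) 𝓘(ℝ, EM) φ (f (χ.symm (χ (𝒢.u q)))) := by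
      rw [e1]; exact mdifferentiableAt_chart hφ h2
    rw [← tderiv_eq_fderiv, tderiv_comp_apply (f := fun z => f (χ.symm z)) hφ'
      (hf'.comp (χ (𝒢.u q)) hsymm), tderiv_comp_apply hf' hsymm, e1, χ.left_inv h1]
  have hBker : ∀ {q : M}, 𝒢.u q ∈ χ.source → q ∈ φ.source → q ∈ Q → ∀ v,
      B (χ (𝒢.u q)) v = 0 ↔
        tderiv EG EM 𝒢.s (𝒢.u q) (tderiv EG EG χ.symm (χ (𝒢.u q)) v) = 0 ∧
        tderiv EG EM 𝒢.r (𝒢.u q) (tderiv EG EG χ.symm (χ (𝒢.u q)) v) ∈ tangentSub EM Q q := by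
    intro q h1 h2 hq v
    rw [mem_tangentSub_iff hφ hV h2 hq, ← hder 𝒢.r_smooth h1 h2 (𝒢.r_unit q) v, ← hπV]
    simp only [B, ContinuousLinearMap.prod_apply, Prod.mk_eq_zero, ContinuousLinearMap.comp_apply]
    refine and_congr_left fun _ => ?_
    rw [hder 𝒢.s_smooth h1 h2 (𝒢.s_unit q) v]
    refine ⟨fun h => ?_, fun h => by rw [h, map_zero]⟩
    rw [← tderiv_symm_tderiv hφ h2 (tderiv EG EM 𝒢.s (𝒢.u q) _), h, map_zero]
  have hz₀ : χ (𝒢.u q₀) ∈ Ω :=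
    ⟨χ.map_source hqχ, by simpa [O, χ.left_inv hqχ, 𝒢.s_unit, 𝒢.r_unit] using hqφ⟩
  have hsurj : Function.Surjective (B (χ (𝒢.u q₀))) := by
    rintro ⟨x, y⟩
    have hid : tderiv EG EG χ.symm (χ (𝒢.u q₀)) = ContinuousLinearMap.id ℝ EG := by
      rw [hχ, tderiv_chartAt_symm_self]
    have hB0 : ∀ v, B (χ (𝒢.u q₀)) v = (tderiv EM EM φ q₀ (tderiv EG EM 𝒢.s (𝒢.u q₀) v),
        π (tderiv EM EM φ q₀ (tderiv EG EM 𝒢.r (𝒢.u q₀) v))) := by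
      intro v
      have h1 := hder 𝒢.s_smooth hqχ hqφ (𝒢.s_unit q₀) v
      have h2 := hder 𝒢.r_smooth hqχ hqφ (𝒢.r_unit q₀) v
      rw [hid] at h1 h2
      exact Prod.ext h1 (congrArg π h2)
    -- A vector tangent to the units attains the first component. By transversality the second can
    -- then be corrected with some `a` in `ker Ts`, which leaves the first unchanged.
    set v₁ : EG := tderiv EM EG 𝒢.u q₀ (tderiv EM EM φ.symm (φ q₀) x) with hv₁
    obtain ⟨w, hw⟩ := hπ (y - π (tderiv EM EM φ q₀ (tderiv EG EM 𝒢.r (𝒢.u q₀) v₁)))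
    obtain ⟨a, t, ha, ht, hat⟩ : ∃ (a : EG) (t : EM), tderiv EG EM 𝒢.s (𝒢.u q₀) a = 0 ∧
        t ∈ tangentSub EM Q q₀ ∧
        tderiv EG EM 𝒢.r (𝒢.u q₀) a + t = tderiv EM EM φ.symm (φ q₀) w := by
      have h1 : ∀ w : TangentSpace 𝓘(ℝ, EM) q₀,
          w ∈ LinearMap.range (𝒢.anchor q₀) ⊔ tangentSub EM Q q₀ := fun w => by
        rw [hT q₀ hq₀]; exact Submodule.mem_top
      obtain ⟨_, ⟨a, rfl⟩, t, ht, hat⟩ := Submodule.mem_sup.1 (h1 (tderiv EM EM φ.symm (φ q₀) w))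
      exact ⟨a.1, t, a.2, ht, hat⟩
    have ht' : π (tderiv EM EM φ q₀ t) = 0 := (hπV _).2 ((mem_tangentSub_iff hφ hV hqφ hq₀).1 ht)
    have h2 : π (tderiv EM EM φ q₀ (tderiv EG EM 𝒢.r (𝒢.u q₀) a)) = π w := by
      rw [← tderiv_tderiv_symm hφ hqφ w, ← hat, map_add, map_add, ht', add_zero]
    refine ⟨v₁ + a, ?_⟩
    rw [hB0]
    refine Prod.ext ?_ ?_
    · change tderiv EM EM φ q₀ (tderiv EG EM 𝒢.s (𝒢.u q₀) (v₁ + a)) = x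
      rw [map_add, ha, add_zero, hv₁, 𝒢.tderiv_s_u, tderiv_tderiv_symm hφ hqφ]
    · change π (tderiv EM EM φ q₀ (tderiv EG EM 𝒢.r (𝒢.u q₀) (v₁ + a))) = y
      rw [map_add, map_add, map_add, h2, hw]
      abel
  obtain ⟨W, hW, hzW, hWΩ, k, e, c, he, hec⟩ := hB.exists_frame_ker hΩ hz₀ hsurj
  let O' : Set G := χ.source ∩ χ ⁻¹' W
  have hO' : IsOpen O' := χ.isOpen_inter_preimage hW
  refine ⟨𝒢.u ⁻¹' O' ∩ φ.source, (hO'.preimage 𝒢.u_smooth.continuous).inter φ.open_source,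
    ⟨⟨hqχ, hzW⟩, hqφ⟩, k, fun i m => tderiv EG EG χ.symm (χ (𝒢.u m)) (e i (χ (𝒢.u m))),
    fun i m => (c i).comp (tderiv EG EG χ (𝒢.u m)), ?_, ?_, ?_⟩
  · rintro i m ⟨hm, -⟩
    refine (smoothAlongAt_iff_of_chart hχ' hm.1).2 ⟨𝒢.u_smooth m, ?_⟩
    have h1 : ContMDiffAt 𝓘(ℝ, EM) 𝓘(ℝ, EG) ∞ (fun m => e i (χ (𝒢.u m))) m :=
      ((he i).contDiffAt (hW.mem_nhds hm.2)).contMDiffAt.comp m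
        ((contMDiffAt_of_mem_maximalAtlas hχ' hm.1).comp m (𝒢.u_smooth m))
    refine h1.congr_of_eventuallyEq ?_
    filter_upwards [(hO'.preimage 𝒢.u_smooth.continuous).mem_nhds hm] with y hy
    exact tderiv_tderiv_symm hχ' hy.1 _
  · rintro i m ⟨hm, -⟩ X hX
    exact (c i).contDiff.contMDiff.contMDiffAt.comp m
      ((smoothAlongAt_iff_of_chart hχ' hm.1).1 hX).2
  · rintro q ⟨hq, hqφ'⟩ hqQ
    obtain ⟨h1, h2, h3⟩ := hec _ hq.2
    refine ⟨fun i => (hBker hq.1 hqφ' hqQ _).1 (h1 i), fun i j => ?_, fun a ha1 ha2 => ?_⟩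
    · rw [← h2 i j]
      exact congrArg (c i) (tderiv_tderiv_symm hχ' hq.1 _)
    · have h4 := h3 (tderiv EG EG χ (𝒢.u q) a) ((hBker hq.1 hqφ' hqQ _).2
        (by rw [tderiv_symm_tderiv hχ' hq.1]; exact ⟨ha1, ha2⟩))
      have h5 := congrArg (tderiv EG EG χ.symm (χ (𝒢.u q))) h4
      rw [tderiv_symm_tderiv hχ' hq.1, map_sum] at h5
      simp only [map_smul] at h5
      exact h5

end LieGroupoid

/-! ### Algebraic identities of the bracket of vector fields. -/

section FieldBracket

open VectorField

variable {E : Type*} [NormedAddCommGroup E] [NormedSpace ℝ E] [FiniteDimensional ℝ E]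
  {M : Type*} [TopologicalSpace M] [ChartedSpace E M] [IsManifold 𝓘(ℝ, E) ∞ M]

theorem fieldBracket_self (V : M → E) (x : M) : fieldBracket V V x = 0 :=
  congrFun (mlieBracket_self (I := 𝓘(ℝ, E)) (V := V)) x

theorem fieldBracket_swap (V W : M → E) (x : M) : fieldBracket V W x = -fieldBracket W V x :=
  mlieBracket_swap_apply (I := 𝓘(ℝ, E)) (V := V) (W := W)

theorem fieldBracket_add_right {V W W' : M → E} {x : M}
    (hW : SmoothAlongAt E 𝓘(ℝ, E) (fun y : M => y) W x)
    (hW' : SmoothAlongAt E 𝓘(ℝ, E) (fun y : M => y) W' x) :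
    fieldBracket V (fun y => W y + W' y) x = fieldBracket V W x + fieldBracket V W' x := by
  have : CompleteSpace E := FiniteDimensional.complete ℝ E
  have : IsManifold 𝓘(ℝ, E) 2 M := .of_le (n := ∞) ENat.LEInfty.out
  unfold SmoothAlongAt at hW hW'
  exact mlieBracket_add_right (I := 𝓘(ℝ, E)) (V := V) hW.mdiff hW'.mdiff

theorem fieldBracket_smul_right {V W : M → E} {f : M → ℝ} {x : M}
    (hf : MDifferentiableAt 𝓘(ℝ, E) 𝓘(ℝ, ℝ) f x)
    (hW : SmoothAlongAt E 𝓘(ℝ, E) (fun y : M => y) W x) :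
    fieldBracket V (fun y => f y • W y) x =
      tderiv E ℝ f x (V x) • W x + f x • fieldBracket V W x := by
  have : CompleteSpace E := FiniteDimensional.complete ℝ E
  have : IsManifold 𝓘(ℝ, E) 2 M := .of_le (n := ∞) ENat.LEInfty.out
  unfold SmoothAlongAt at hW
  exact mlieBracket_smul_right (I := 𝓘(ℝ, E)) (V := V) hf hW.mdiff

theorem fieldBracket_jacobi {U V W : M → E} {x : M}
    (hU : SmoothAlongAt E 𝓘(ℝ, E) (fun y : M => y) U x)
    (hV : SmoothAlongAt E 𝓘(ℝ, E) (fun y : M => y) V x)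
    (hW : SmoothAlongAt E 𝓘(ℝ, E) (fun y : M => y) W x) :
    fieldBracket U (fieldBracket V W) x =
      fieldBracket (fieldBracket U V) W x + fieldBracket V (fieldBracket U W) x := by
  have : CompleteSpace E := FiniteDimensional.complete ℝ E
  have h2 : minSmoothness ℝ 2 ≤ (∞ : WithTop ℕ∞) := by
    rw [minSmoothness_of_isRCLikeNormedField]; exact ENat.LEInfty.out
  have h3 : minSmoothness ℝ 3 ≤ (∞ : WithTop ℕ∞) := by
    rw [minSmoothness_of_isRCLikeNormedField]; exact ENat.LEInfty.out
  have : IsManifold 𝓘(ℝ, E) (minSmoothness ℝ 3) M := .of_le (n := ∞) h3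
  unfold SmoothAlongAt at hU hV hW
  exact leibniz_identity_mlieBracket_apply (I := 𝓘(ℝ, E)) (hU.of_le h2) (hV.of_le h2)
    (hW.of_le h2)

end FieldBracket

/-! ### The bracket of sections and its dependence on values along a submanifold. -/

namespace LieGroupoid

open Filter

variable {EM EG : Type*} [NormedAddCommGroup EM] [NormedSpace ℝ EM]
  [NormedAddCommGroup EG] [NormedSpace ℝ EG]
  {M G : Type*} [TopologicalSpace M] [ChartedSpace EM M] [TopologicalSpace G] [ChartedSpace EG G]
  {𝒢 : LieGroupoid EM EG M G}

theorem invField_add (X Y : M → EG) (g : G) :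
    𝒢.invField (fun m => X m + Y m) g = 𝒢.invField X g + 𝒢.invField Y g :=
  map_add (mfderivWithin 𝓘(ℝ, EG) 𝓘(ℝ, EG) (fun h => 𝒢.mul h g) {h | 𝒢.s h = 𝒢.r g}
    (𝒢.u (𝒢.r g)) : EG →L[ℝ] EG) (X (𝒢.r g)) (Y (𝒢.r g))

theorem invField_smul_apply {X Y : M → EG} {g : G} {c : ℝ} (h : Y (𝒢.r g) = c • X (𝒢.r g)) :
    𝒢.invField Y g = c • 𝒢.invField X g :=
  (congrArg (mfderivWithin 𝓘(ℝ, EG) 𝓘(ℝ, EG) (fun h => 𝒢.mul h g) {h | 𝒢.s h = 𝒢.r g}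
    (𝒢.u (𝒢.r g)) : EG →L[ℝ] EG) h).trans
    (map_smul (mfderivWithin 𝓘(ℝ, EG) 𝓘(ℝ, EG) (fun h => 𝒢.mul h g) {h | 𝒢.s h = 𝒢.r g}
      (𝒢.u (𝒢.r g)) : EG →L[ℝ] EG) c (X (𝒢.r g)))

/-- The bracket of sections of the Lie algebroid, as a function to the model space. -/
def sectionBracket (𝒢 : LieGroupoid EM EG M G) (X Y : M → EG) (m : M) : EG := 𝒢.algBracket X Y m

theorem sectionBracket_eq (X Y : M → EG) (m : M) :
    𝒢.sectionBracket X Y m = fieldBracket (𝒢.invField X) (𝒢.invField Y) (𝒢.u m) := rfl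

variable [IsManifold 𝓘(ℝ, EM) ∞ M] [IsManifold 𝓘(ℝ, EG) ∞ G]
  [FiniteDimensional ℝ EM] [FiniteDimensional ℝ EG]

theorem sectionBracket_self (X : M → EG) (m : M) : 𝒢.sectionBracket X X m = 0 :=
  fieldBracket_self _ _

theorem sectionBracket_swap (X Y : M → EG) (m : M) :
    𝒢.sectionBracket X Y m = -𝒢.sectionBracket Y X m :=
  fieldBracket_swap _ _ _

theorem sectionBracket_add_right {X Y Z : M → EG} (hY : 𝒢.IsAlgSection Y)
    (hZ : 𝒢.IsAlgSection Z) (m : M) : 𝒢.sectionBracket X (fun m => Y m + Z m) m =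
      𝒢.sectionBracket X Y m + 𝒢.sectionBracket X Z m := by
  rw [sectionBracket_eq, funext (invField_add Y Z)]
  exact fieldBracket_add_right (hY.smooth_invField _) (hZ.smooth_invField _)

/-- The inner bracket extends to the right-invariant field `[X^R, Y^R]`, so the nested brackets are
nested brackets of fields on `G`. -/
theorem sectionBracket_jacobi {X Y Z : M → EG} (hX : 𝒢.IsAlgSection X) (hY : 𝒢.IsAlgSection Y)
    (hZ : 𝒢.IsAlgSection Z) (m : M) : 𝒢.sectionBracket X (𝒢.sectionBracket Y Z) m =
      𝒢.sectionBracket (𝒢.sectionBracket X Y) Z m +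
        𝒢.sectionBracket Y (𝒢.sectionBracket X Z) m := by
  have key : ∀ {X Y : M → EG}, 𝒢.IsAlgSection X → 𝒢.IsAlgSection Y →
      𝒢.invField (𝒢.sectionBracket X Y) = fieldBracket (𝒢.invField X) (𝒢.invField Y) :=
    fun hX hY => funext fun g => (hX.fieldBracket_eq_invField hY g).symm
  rw [sectionBracket_eq, sectionBracket_eq, sectionBracket_eq, key hY hZ, key hX hY, key hX hZ]
  exact fieldBracket_jacobi (hX.smooth_invField _) (hY.smooth_invField _) (hZ.smooth_invField _)

/-- The field `X^R` is `r`-related to `ρ(X)`, so the anchor respects brackets. It follows that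
sections of the pullback are closed under the bracket. -/
theorem tderiv_r_sectionBracket {X Y : M → EG} (hX : 𝒢.IsAlgSection X) (hY : 𝒢.IsAlgSection Y)
    (m : M) : tderiv EG EM 𝒢.r (𝒢.u m) (𝒢.sectionBracket X Y m) =
      fieldBracket (fun m => tderiv EG EM 𝒢.r (𝒢.u m) (X m))
        (fun m => tderiv EG EM 𝒢.r (𝒢.u m) (Y m)) m := by
  rw [sectionBracket_eq, tderiv_fieldBracket_of_related (𝒢.r_smooth _) (hX.smooth_invField _)
    (hY.smooth_invField _) (smoothAlongAt_rangeDeriv (hX.smooth _))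
    (smoothAlongAt_rangeDeriv (hY.smooth _))
    (Eventually.of_forall fun g => 𝒢.tderiv_r_invField (hX.ker _))
    (Eventually.of_forall fun g => 𝒢.tderiv_r_invField (hY.ker _)), 𝒢.r_unit]

theorem tderiv_r_sectionBracket_mem {Q : Set M} (hQ : IsEmbeddedSubmanifold EM Q) {X Y : M → EG}
    (hX : 𝒢.IsAlgSection X) (hY : 𝒢.IsAlgSection Y)
    (hXQ : ∀ q ∈ Q, tderiv EG EM 𝒢.r (𝒢.u q) (X q) ∈ tangentSub EM Q q)
    (hYQ : ∀ q ∈ Q, tderiv EG EM 𝒢.r (𝒢.u q) (Y q) ∈ tangentSub EM Q q) {q : M} (hq : q ∈ Q) :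
    tderiv EG EM 𝒢.r (𝒢.u q) (𝒢.sectionBracket X Y q) ∈ tangentSub EM Q q := by
  rw [tderiv_r_sectionBracket hX hY]
  exact hQ.fieldBracket_mem hq (smoothAlongAt_rangeDeriv (hX.smooth _))
    (smoothAlongAt_rangeDeriv (hY.smooth _)) hXQ hYQ

/-- The bracket with a vector field which vanishes on `r⁻¹(Q)` vanishes at the units over `Q`, if
the range derivative of the other field is tangent to `Q`. -/
theorem fieldBracket_eq_zero_of_vanishing_on_preimage {Q : Set M} {q : M} (hq : q ∈ Q)
    {V N : G → EG} (hN : SmoothAlongAt EG 𝓘(ℝ, EG) (fun g : G => g) N (𝒢.u q))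
    (hNQ : ∀ᶠ g in 𝓝 (𝒢.u q), 𝒢.r g ∈ Q → N g = 0)
    (hV : tderiv EG EM 𝒢.r (𝒢.u q) (V (𝒢.u q)) ∈ tangentSub EM Q q) :
    fieldBracket V N (𝒢.u q) = 0 := by
  refine fieldBracket_eq_zero_of_vanishing hN
    (hNQ.self_of_nhds (by rwa [𝒢.r_unit])) ?_
  set T := {v : EG | ∃ c : ℝ → G, c 0 = 𝒢.u q ∧
      MDifferentiableAt 𝓘(ℝ, ℝ) 𝓘(ℝ, EG) c 0 ∧ (∀ᶠ t in 𝓝 0, N (c t) = 0) ∧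
      tderiv ℝ EG c 0 1 = v} with hT
  have h1 : ∀ c : ℝ → G, c 0 = 𝒢.u q → MDifferentiableAt 𝓘(ℝ, ℝ) 𝓘(ℝ, EG) c 0 →
      (∀ᶠ t in 𝓝 0, 𝒢.r (c t) ∈ Q) → tderiv ℝ EG c 0 1 ∈ Submodule.span ℝ T := by
    intro c h0 hc hr
    refine Submodule.subset_span ⟨c, h0, hc, ?_, rfl⟩
    have := hc.continuousAt
    rw [ContinuousAt, h0] at this
    filter_upwards [this.eventually hNQ, hr] with t e1 e2 using e1 e2
  set v := V (𝒢.u q) with hv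
  have h2 : tangentSub EM Q q ≤
      (Submodule.span ℝ T).comap (tderiv EM EG 𝒢.u q).toLinearMap := by
    refine Submodule.span_le.2 ?_
    rintro w ⟨c, hc0, ⟨ε, hε, hc, hcS⟩, hw⟩
    have hc1 : MDifferentiableAt 𝓘(ℝ, ℝ) 𝓘(ℝ, EM) c 0 :=
      (hc.contMDiffAt (Ioo_mem_nhds (by linarith) hε)).mdiff
    have h3 : tderiv ℝ EG (fun t => 𝒢.u (c t)) 0 1 = tderiv EM EG 𝒢.u q w := by
      have h4 : tderiv ℝ EM c 0 1 = w := hw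
      rw [tderiv_comp_apply (f := c) (𝒢.u_mdiff _) hc1, hc0, h4]
    change tderiv EM EG 𝒢.u q w ∈ Submodule.span ℝ T
    rw [← h3]
    refine h1 _ (by rw [hc0]) ((𝒢.u_mdiff _).comp (0 : ℝ) hc1) ?_
    filter_upwards [Ioo_mem_nhds (show -ε < 0 by linarith) hε] with t ht
    rw [𝒢.r_unit]
    exact hcS t ht
  have h3 : tderiv EM EG 𝒢.u q (tderiv EG EM 𝒢.r (𝒢.u q) v) ∈ Submodule.span ℝ T := h2 hV
  -- `v` is the sum of a vector tangent to the units over `Q` (`h3`) and one in `ker Tr`, which is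
  -- the velocity of a curve in the `r`-fibre over `q`. Both kinds of curve stay in `r⁻¹(Q)`.
  have h4 : v - tderiv EM EG 𝒢.u q (tderiv EG EM 𝒢.r (𝒢.u q) v) ∈ Submodule.span ℝ T := by
    have h5 : tderiv EG EM 𝒢.r (𝒢.u q)
        (v - tderiv EM EG 𝒢.u q (tderiv EG EM 𝒢.r (𝒢.u q) v)) = 0 := by
      rw [map_sub, 𝒢.tderiv_r_u, sub_self]
    obtain ⟨c, h0, hc, hcv, hr⟩ := (𝒢.r_submersion.isSubmersionAt (𝒢.u q)).exists_curve h5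
    rw [← hcv]
    refine h1 c h0 hc ?_
    filter_upwards [hr] with t ht
    rwa [ht, 𝒢.r_unit]
  simpa using Submodule.add_mem _ h4 h3

/-- If `W = F Y` on `Q` near `q`, and `X` is tangent to `Q`, then `[X, W] = F [X, Y] + (ρ(X) F) Y`
at `q`. -/
theorem sectionBracket_of_eq_smul {Q : Set M} {q : M} (hq : q ∈ Q) {X Y W : M → EG}
    (hX : 𝒢.IsAlgSection X) (hY : 𝒢.IsAlgSection Y) (hW : 𝒢.IsAlgSection W)
    (hXQ : tderiv EG EM 𝒢.r (𝒢.u q) (X q) ∈ tangentSub EM Q q) {F : M → ℝ}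
    (hF : ContMDiffAt 𝓘(ℝ, EM) 𝓘(ℝ, ℝ) ∞ F q)
    (h : ∀ᶠ m in 𝓝 q, m ∈ Q → W m = F m • Y m) :
    𝒢.sectionBracket X W q = F q • 𝒢.sectionBracket X Y q +
      tderiv EM ℝ F q (tderiv EG EM 𝒢.r (𝒢.u q) (X q)) • Y q := by
  have hFr : ContMDiffAt 𝓘(ℝ, EG) 𝓘(ℝ, ℝ) ∞ (fun g => F (𝒢.r g)) (𝒢.u q) :=
    ContMDiffAt.comp_of_eq hF (𝒢.r_smooth _) (𝒢.r_unit q)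
  have h1 : SmoothAlongAt EG 𝓘(ℝ, EG) (fun g : G => g)
      (fun g => F (𝒢.r g) • 𝒢.invField Y g) (𝒢.u q) := (hY.smooth_invField _).smul hFr
  have h2 : SmoothAlongAt EG 𝓘(ℝ, EG) (fun g : G => g)
      (fun g => 𝒢.invField W g - F (𝒢.r g) • 𝒢.invField Y g) (𝒢.u q) :=
    (hW.smooth_invField _).sub h1
  have hXu : 𝒢.invField X (𝒢.u q) = X q := 𝒢.invField_unit (hX.ker q)
  have h3 : fieldBracket (𝒢.invField X) (fun g => 𝒢.invField W g - F (𝒢.r g) • 𝒢.invField Y g)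
      (𝒢.u q) = 0 := by
    refine fieldBracket_eq_zero_of_vanishing_on_preimage hq h2 ?_ (by rwa [hXu])
    have := (𝒢.r_smooth (𝒢.u q)).continuousAt
    rw [ContinuousAt, 𝒢.r_unit] at this
    filter_upwards [this.eventually h] with g hg hgQ
    rw [invField_smul_apply (hg hgQ), sub_self]
  -- The second summand vanishes on `r⁻¹(Q)` near the unit, so by `h3` it contributes nothing. The
  -- first obeys the Leibniz rule on `G`.
  have h4 : 𝒢.invField W = fun g => F (𝒢.r g) • 𝒢.invField Y g +
      (𝒢.invField W g - F (𝒢.r g) • 𝒢.invField Y g) := by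
    funext g; abel
  have h5 : tderiv EG ℝ (fun g => F (𝒢.r g)) (𝒢.u q) (X q) =
      tderiv EM ℝ F q (tderiv EG EM 𝒢.r (𝒢.u q) (X q)) := by
    rw [tderiv_comp_apply (f := 𝒢.r) (by rw [𝒢.r_unit]; exact hF.mdiff) (𝒢.r_mdiff _), 𝒢.r_unit]
  rw [sectionBracket_eq, h4, fieldBracket_add_right h1 h2, h3, add_zero,
    fieldBracket_smul_right hFr.mdiff (hY.smooth_invField _), hXu, h5,
    𝒢.invField_unit (hY.ker q), 𝒢.r_unit, add_comm]
  rfl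

/-- Equality is assumed only on `Q`, since chosen extensions need not depend linearly on the
section. -/
theorem sectionBracket_smul_right_of_eq {Q : Set M} {q : M} (hq : q ∈ Q) {X Y W : M → EG}
    (hX : 𝒢.IsAlgSection X) (hY : 𝒢.IsAlgSection Y) (hW : 𝒢.IsAlgSection W)
    (hXQ : tderiv EG EM 𝒢.r (𝒢.u q) (X q) ∈ tangentSub EM Q q) (c : ℝ)
    (h : ∀ m ∈ Q, W m = c • Y m) :
    𝒢.sectionBracket X W q = c • 𝒢.sectionBracket X Y q := by
  rw [sectionBracket_of_eq_smul (F := fun _ => c) hq hX hY hW hXQ contMDiffAt_const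
    (Eventually.of_forall h), tderiv_const]
  simp

/-- The bracket of sections tangent to `Q` depends only on their restrictions to `Q`. -/
theorem sectionBracket_congr {Q : Set M} {q : M} (hq : q ∈ Q) {X X' Y Y' : M → EG}
    (hX : 𝒢.IsAlgSection X) (hX' : 𝒢.IsAlgSection X') (hY : 𝒢.IsAlgSection Y)
    (hY' : 𝒢.IsAlgSection Y')
    (hXQ : tderiv EG EM 𝒢.r (𝒢.u q) (X q) ∈ tangentSub EM Q q)
    (hYQ : tderiv EG EM 𝒢.r (𝒢.u q) (Y q) ∈ tangentSub EM Q q)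
    (hXX' : ∀ m ∈ Q, X' m = X m) (hYY' : ∀ m ∈ Q, Y' m = Y m) :
    𝒢.sectionBracket X' Y' q = 𝒢.sectionBracket X Y q := by
  -- The arguments are replaced one at a time by the case `c = 1`, with skew symmetry for the first
  -- one.
  rw [← one_smul ℝ (𝒢.sectionBracket X Y q), sectionBracket_swap X Y, smul_neg,
    ← sectionBracket_smul_right_of_eq hq hY hX hX' hYQ 1 (by simpa using hXX'),
    ← sectionBracket_swap, ← one_smul ℝ (𝒢.sectionBracket X' Y q)]
  exact sectionBracket_smul_right_of_eq hq hX' hY hY' (by rwa [hXX' q hq]) 1 (by simpa using hYY')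

end LieGroupoid

/-! ### The pullback Lie algebroid along a closed transverse submanifold. -/

namespace LieGroupoid

open Filter

variable {EM EG : Type*} [NormedAddCommGroup EM] [NormedSpace ℝ EM]
  [NormedAddCommGroup EG] [NormedSpace ℝ EG]
  {M G : Type*} [TopologicalSpace M] [ChartedSpace EM M] [TopologicalSpace G] [ChartedSpace EG G]
  {𝒢 : LieGroupoid EM EG M G} {Q : Set M}

/-- The element `(a, ρ a)` of the pullback of the Lie algebroid. -/
def pullbackMk (q : Q) (a : EG) (hs : tderiv EG EM 𝒢.s (𝒢.u q) a = 0)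
    (hr : tderiv EG EM 𝒢.r (𝒢.u q) a ∈ tangentSub EM Q (q : M)) : 𝒢.pullbackFiber Q q :=
  ⟨(a, tderiv EG EM 𝒢.r (𝒢.u q) a), ⟨hs, hr⟩, rfl⟩

/-- The component in the Lie algebroid of an element of its pullback. -/
def pullbackFst {q : Q} (x : 𝒢.pullbackFiber Q q) : EG := x.1.1

theorem pullbackFst_mk {q : Q} {a : EG} (hs : tderiv EG EM 𝒢.s (𝒢.u q) a = 0)
    (hr : tderiv EG EM 𝒢.r (𝒢.u q) a ∈ tangentSub EM Q (q : M)) :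
    pullbackFst (pullbackMk q a hs hr) = a := rfl

theorem pullbackFst_add {q : Q} (x y : 𝒢.pullbackFiber Q q) :
    pullbackFst (x + y) = pullbackFst x + pullbackFst y := rfl

theorem pullbackFst_smul {q : Q} (c : ℝ) (x : 𝒢.pullbackFiber Q q) :
    pullbackFst (c • x) = c • pullbackFst x := rfl

theorem pullbackFst_zero {q : Q} : pullbackFst (0 : 𝒢.pullbackFiber Q q) = 0 := rfl

theorem pullbackFst_sum {q : Q} {ι : Type*} (s : Finset ι) (x : ι → 𝒢.pullbackFiber Q q) :
    pullbackFst (∑ i ∈ s, x i) = ∑ i ∈ s, pullbackFst (x i) := by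
  classical
  induction s using Finset.induction_on with
  | empty => simp [pullbackFst_zero]
  | insert i s hi ih => rw [Finset.sum_insert hi, Finset.sum_insert hi, pullbackFst_add, ih]

theorem pullback_ker {q : Q} (x : 𝒢.pullbackFiber Q q) :
    tderiv EG EM 𝒢.s (𝒢.u q) (pullbackFst x) = 0 := x.2.1.1

theorem pullback_snd {q : Q} (x : 𝒢.pullbackFiber Q q) :
    x.1.2 = tderiv EG EM 𝒢.r (𝒢.u q) (pullbackFst x) := x.2.2.symm

theorem pullback_mem {q : Q} (x : 𝒢.pullbackFiber Q q) :
    tderiv EG EM 𝒢.r (𝒢.u q) (pullbackFst x) ∈ tangentSub EM Q (q : M) := by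
  have h : x.1.2 ∈ tangentSub EM Q (q : M) := x.2.1.2
  rwa [pullback_snd] at h

/-- The tangent component is forced to be `ρ(a)`, so every identity in the pullback can be tested in
`A`. -/
theorem pullback_ext {q : Q} {x y : 𝒢.pullbackFiber Q q} (h : pullbackFst x = pullbackFst y) :
    x = y := by
  refine Subtype.ext (Prod.ext h ?_)
  rw [pullback_snd, pullback_snd, h]

variable [IsManifold 𝓘(ℝ, EM) ∞ M] [IsManifold 𝓘(ℝ, EG) ∞ G]

/-- The smooth sections of the pullback of the Lie algebroid along the inclusion of `Q`. -/
def pullbackSections (𝒢 : LieGroupoid EM EG M G) (Q : Set M) :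
    Submodule ℝ (∀ q : Q, 𝒢.pullbackFiber Q q) where
  -- Smoothness of the `A`-component suffices; that of its image under the anchor follows, see
  -- `smoothOnSub_pullback_snd`.
  carrier := {σ | SmoothOnSub (E := EM) 𝓘(ℝ, EG).tangent
    (fun q : Q => (⟨𝒢.u q, pullbackFst (EG := EG) (σ q)⟩ : TangentBundle 𝓘(ℝ, EG) G))}
  add_mem' {σ τ} hσ hτ x := by
    obtain ⟨U, hU, hxU, X, hX, hXσ⟩ := (smoothNear_along_iff 𝒢.u_smooth).1 (hσ x)
    obtain ⟨W, hW, hxW, Y, hY, hYτ⟩ := (smoothNear_along_iff 𝒢.u_smooth).1 (hτ x)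
    refine (smoothNear_along_iff 𝒢.u_smooth).2 ⟨U ∩ W, hU.inter hW, ⟨hxU, hxW⟩,
      fun m => X m + Y m, fun m hm => (hX m hm.1).add (hY m hm.2), fun y hy => ?_⟩
    exact congrArg₂ (· + ·) (hXσ y hy.1) (hYτ y hy.2)
  zero_mem' x := (smoothNear_along_iff 𝒢.u_smooth).2 ⟨Set.univ, isOpen_univ, trivial,
    fun _ => 0, fun m _ => smoothAlongAt_zero (𝒢.u_smooth m), fun y _ => rfl⟩
  smul_mem' c σ hσ x := by
    obtain ⟨U, hU, hxU, X, hX, hXσ⟩ := (smoothNear_along_iff 𝒢.u_smooth).1 (hσ x)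
    refine (smoothNear_along_iff 𝒢.u_smooth).2 ⟨U, hU, hxU,
      fun m => c • X m, fun m hm => (hX m hm).smul contMDiffAt_const, fun y hy => ?_⟩
    exact congrArg (c • ·) (hXσ y hy)

theorem smul_mem_pullbackSections {f : Q → ℝ} (hf : SmoothOnSub (E := EM) 𝓘(ℝ, ℝ) f)
    {σ : ∀ q : Q, 𝒢.pullbackFiber Q q} (hσ : σ ∈ 𝒢.pullbackSections Q) :
    (fun q => f q • σ q) ∈ 𝒢.pullbackSections Q := by
  intro x
  obtain ⟨U, hU, hxU, X, hX, hXσ⟩ := (smoothNear_along_iff 𝒢.u_smooth).1 (hσ x)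
  obtain ⟨W, hW, hxW, F, hF, hFf⟩ := hf x
  refine (smoothNear_along_iff 𝒢.u_smooth).2 ⟨U ∩ W, hU.inter hW, ⟨hxU, hxW⟩,
    fun m => F m • X m, fun m hm => (hX m hm.1).smul (hF.contMDiffAt (hW.mem_nhds hm.2)),
    fun y hy => ?_⟩
  exact congrArg₂ (· • ·) (hFf y hy.2) (hXσ y hy.1)

theorem mem_pullbackSections_of_local {σ : ∀ q : Q, 𝒢.pullbackFiber Q q}
    (h : ∀ q₀ : Q, ∃ U : Set M, IsOpen U ∧ (q₀ : M) ∈ U ∧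
      ∃ τ ∈ 𝒢.pullbackSections Q, ∀ q : Q, (q : M) ∈ U → σ q = τ q) :
    σ ∈ 𝒢.pullbackSections Q := by
  intro x
  obtain ⟨W, hW, hxW, τ, hτ, hστ⟩ := h x
  obtain ⟨U, hU, hxU, X, hX, hXτ⟩ := (smoothNear_along_iff 𝒢.u_smooth).1 (hτ x)
  refine (smoothNear_along_iff 𝒢.u_smooth).2 ⟨U ∩ W, hU.inter hW, ⟨hxU, hxW⟩, X,
    fun m hm => hX m hm.1, fun y hy => ?_⟩
  rw [hXτ y hy.1, hστ y hy.2]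

theorem smoothOnSub_pullback_snd {σ : ∀ q : Q, 𝒢.pullbackFiber Q q}
    (hσ : σ ∈ 𝒢.pullbackSections Q) : SmoothOnSub (E := EM) 𝓘(ℝ, EM).tangent
      (fun q : Q => (⟨q, (σ q).1.2⟩ : TangentBundle 𝓘(ℝ, EM) M)) := by
  have h := smoothOnSub_rangeDeriv hσ
  have h1 : (fun q : Q => (⟨q, (σ q).1.2⟩ : TangentBundle 𝓘(ℝ, EM) M)) =
      fun q : Q => ⟨q, tderiv EG EM 𝒢.r (𝒢.u q) (pullbackFst (EG := EG) (σ q))⟩ := by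
    funext q
    exact congrArg (fun v : EM => (⟨q, v⟩ : TangentBundle 𝓘(ℝ, EM) M)) (pullback_snd (σ q))
  rw [h1]
  exact h

variable [FiniteDimensional ℝ EM]

/-- A frame must consist of global sections, so the local frame is multiplied by a cutoff and used
where the cutoff equals `1`. Coordinates of a section are smooth because a global extension of it
has smooth coordinates. -/
theorem exists_pullback_frame [FiniteDimensional ℝ EG] [T2Space M] [CompactSpace M]
    (hc : IsClosed Q) (hQ : IsEmbeddedSubmanifold EM Q) (hT : 𝒢.AnchorTransverse Q) (q₀ : Q) :
    ∃ U : Set M, IsOpen U ∧ (q₀ : M) ∈ U ∧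
    ∃ (k : ℕ) (e : Fin k → ∀ q : Q, 𝒢.pullbackFiber Q q), (∀ i, e i ∈ 𝒢.pullbackSections Q) ∧
      (∀ q : Q, (q : M) ∈ U → LinearIndependent ℝ (fun i => e i q) ∧
        Submodule.span ℝ (Set.range fun i => e i q) = ⊤) ∧
      ∀ X ∈ 𝒢.pullbackSections Q, ∃ c : Fin k → Q → ℝ, ∀ q : Q, (q : M) ∈ U →
        X q = ∑ i, c i q • e i q ∧ ∀ i, SmoothNear (E := EM) 𝓘(ℝ, ℝ) (c i) q := by
  obtain ⟨U, hU, hqU, k, e, c, he, hcs, hec⟩ := exists_local_frame hQ hT q₀.2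
  obtain ⟨f, hf1, hf0, hf⟩ := exists_cutoff 𝒢.u_smooth hU hqU
  obtain ⟨W, hWf, hW, hqW⟩ := mem_nhds_iff.1 (hf1.and (hU.mem_nhds hqU))
  have hWU : ∀ m ∈ W, m ∈ U := fun m hm => (hWf hm).2
  have hWf1 : ∀ m ∈ W, f m = 1 := fun m hm => (hWf hm).1
  have hker : ∀ i, ∀ q : Q, tderiv EG EM 𝒢.s (𝒢.u q) (f q • e i q) = 0 := by
    intro i q
    by_cases h : (q : M) ∈ U
    · rw [map_smul, ((hec q h q.2).1 i).1, smul_zero]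
    · rw [hf0 q h, zero_smul, map_zero]
  have hmem : ∀ i, ∀ q : Q, tderiv EG EM 𝒢.r (𝒢.u q) (f q • e i q) ∈ tangentSub EM Q (q : M) := by
    intro i q
    by_cases h : (q : M) ∈ U
    · rw [map_smul]
      exact (tangentSub EM Q (q : M)).smul_mem _ ((hec q h q.2).1 i).2
    · rw [hf0 q h, zero_smul, map_zero]
      exact (tangentSub EM Q (q : M)).zero_mem
  let e' : Fin k → ∀ q : Q, 𝒢.pullbackFiber Q q := fun i q =>
    pullbackMk q (f q • e i q) (hker i q) (hmem i q)
  have he'W : ∀ i, ∀ q : Q, (q : M) ∈ W → pullbackFst (e' i q) = e i q := by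
    intro i q hq
    rw [pullbackFst_mk, hWf1 q hq, one_smul]
  have hexp : ∀ q : Q, (q : M) ∈ W → ∀ x : 𝒢.pullbackFiber Q q,
      x = ∑ i, c i q (pullbackFst x) • e' i q := by
    intro q hq x
    refine pullback_ext ?_
    rw [pullbackFst_sum]
    refine ((hec q (hWU q hq) q.2).2.2 _ (pullback_ker x) (pullback_mem x)).trans ?_
    refine Finset.sum_congr rfl fun i _ => ?_
    rw [pullbackFst_smul, he'W i q hq]
  refine ⟨W, hW, hqW, k, e', fun i => ?_, fun q hq => ⟨?_, ?_⟩, fun σ hσ => ?_⟩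
  · intro x
    exact (smoothNear_along_iff 𝒢.u_smooth).2 ⟨Set.univ, isOpen_univ, trivial, _,
      fun m _ => hf (e i) (he i) m, fun y _ => rfl⟩
  · rw [Fintype.linearIndependent_iff]
    intro g hg i
    have h1 := congrArg (fun x => c i q (pullbackFst x)) hg
    simp only [pullbackFst_sum, pullbackFst_smul, he'W _ q hq, map_sum, map_smul,
      (hec q (hWU q hq) q.2).2.1, pullbackFst_zero, map_zero] at h1
    simpa using h1
  · rw [eq_top_iff]
    intro x _
    rw [hexp q hq x]
    exact Submodule.sum_mem _ fun i _ => Submodule.smul_mem _ _ (Submodule.subset_span ⟨i, rfl⟩)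
  · obtain ⟨X, hX, hXσ⟩ := exists_isAlgSection_extension hc hσ fun q => pullback_ker (σ q)
    refine ⟨fun i q => c i q (pullbackFst (σ q)), fun q hq => ⟨hexp q hq (σ q), fun i => ?_⟩⟩
    refine ⟨W, hW, hq, fun m => c i m (X m), fun m hm =>
      (hcs i m (hWU m hm) X (hX.smooth m)).contMDiffWithinAt, fun y _ => ?_⟩
    exact congrArg (c i y) (hXσ y)

section Bracket

variable [T2Space M] [CompactSpace M] (hc : IsClosed Q)

/-- A global section of the Lie algebroid extending a section of its pullback. -/
def extendSection (σ : 𝒢.pullbackSections Q) : M → EG :=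
  (exists_isAlgSection_extension hc σ.2 fun q => pullback_ker (σ.1 q)).choose

theorem isAlgSection_extendSection (σ : 𝒢.pullbackSections Q) :
    𝒢.IsAlgSection (extendSection hc σ) :=
  (exists_isAlgSection_extension hc σ.2 fun q => pullback_ker (σ.1 q)).choose_spec.1

theorem extendSection_apply (σ : 𝒢.pullbackSections Q) (q : Q) :
    extendSection hc σ q = pullbackFst (σ.1 q) :=
  (exists_isAlgSection_extension hc σ.2 fun q => pullback_ker (σ.1 q)).choose_spec.2 q

theorem tderiv_r_extendSection_mem (σ : 𝒢.pullbackSections Q) {q : M} (hq : q ∈ Q) :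
    tderiv EG EM 𝒢.r (𝒢.u q) (extendSection hc σ q) ∈ tangentSub EM Q q := by
  have h := extendSection_apply hc σ ⟨q, hq⟩
  simp only at h
  rw [h]
  exact pullback_mem (σ.1 ⟨q, hq⟩)

variable [FiniteDimensional ℝ EG] (hQ : IsEmbeddedSubmanifold EM Q)

/-- The bracket of two sections of the pullback of the Lie algebroid. -/
def pullbackBracketFun (σ τ : 𝒢.pullbackSections Q) : 𝒢.pullbackSections Q :=
  ⟨fun q => pullbackMk q (𝒢.sectionBracket (extendSection hc σ) (extendSection hc τ) q)
    (((isAlgSection_extendSection hc σ).bracket (isAlgSection_extendSection hc τ)).ker q)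
    (tderiv_r_sectionBracket_mem hQ (isAlgSection_extendSection hc σ)
      (isAlgSection_extendSection hc τ) (fun _ hq => tderiv_r_extendSection_mem hc σ hq)
      (fun _ hq => tderiv_r_extendSection_mem hc τ hq) q.2),
    ((isAlgSection_extendSection hc σ).bracket (isAlgSection_extendSection hc τ)).smoothOnSub
      fun _ => rfl⟩

/-- The chosen extensions are immaterial. Each bracket identity can therefore be checked with
whichever extensions make it evident. -/
theorem pullbackFst_bracketFun (σ τ : 𝒢.pullbackSections Q) {X Y : M → EG}
    (hX : 𝒢.IsAlgSection X) (hY : 𝒢.IsAlgSection Y) (hXσ : ∀ q : Q, X q = pullbackFst (σ.1 q))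
    (hYτ : ∀ q : Q, Y q = pullbackFst (τ.1 q)) (q : Q) :
    pullbackFst ((pullbackBracketFun hc hQ σ τ).1 q) = 𝒢.sectionBracket X Y q := by
  refine (sectionBracket_congr q.2 (isAlgSection_extendSection hc σ) hX
    (isAlgSection_extendSection hc τ) hY (tderiv_r_extendSection_mem hc σ q.2)
    (tderiv_r_extendSection_mem hc τ q.2) ?_ ?_).symm
  · exact fun m hm => (hXσ ⟨m, hm⟩).trans (extendSection_apply hc σ ⟨m, hm⟩).symm
  · exact fun m hm => (hYτ ⟨m, hm⟩).trans (extendSection_apply hc τ ⟨m, hm⟩).symm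

theorem pullbackBracketFun_swap (σ τ : 𝒢.pullbackSections Q) :
    pullbackBracketFun hc hQ σ τ = -pullbackBracketFun hc hQ τ σ := by
  refine Subtype.ext (funext fun q => pullback_ext ?_)
  exact sectionBracket_swap _ _ _

theorem pullbackBracketFun_add (σ τ υ : 𝒢.pullbackSections Q) :
    pullbackBracketFun hc hQ σ (τ + υ) =
      pullbackBracketFun hc hQ σ τ + pullbackBracketFun hc hQ σ υ := by
  refine Subtype.ext (funext fun q => pullback_ext ?_)
  have hσ := isAlgSection_extendSection hc σ
  have hτ := isAlgSection_extendSection hc τ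
  have hυ := isAlgSection_extendSection hc υ
  rw [pullbackFst_bracketFun hc hQ σ (τ + υ) hσ (hτ.add hυ) (extendSection_apply hc σ)
    (fun q => by rw [extendSection_apply, extendSection_apply]; rfl),
    sectionBracket_add_right hτ hυ]
  rfl

theorem pullbackBracketFun_smul (c : ℝ) (σ τ : 𝒢.pullbackSections Q) :
    pullbackBracketFun hc hQ σ (c • τ) = c • pullbackBracketFun hc hQ σ τ := by
  refine Subtype.ext (funext fun q => pullback_ext ?_)
  refine sectionBracket_smul_right_of_eq q.2 (isAlgSection_extendSection hc σ)
    (isAlgSection_extendSection hc τ) (isAlgSection_extendSection hc (c • τ))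
    (tderiv_r_extendSection_mem hc σ q.2) c fun m hm => ?_
  have h1 := extendSection_apply hc (c • τ) ⟨m, hm⟩
  have h2 := extendSection_apply hc τ ⟨m, hm⟩
  exact h1.trans (congrArg (c • ·) h2.symm)

/-- The bracket of sections of the pullback of the Lie algebroid, as a bilinear map. -/
def pullbackBracket :
    𝒢.pullbackSections Q →ₗ[ℝ] 𝒢.pullbackSections Q →ₗ[ℝ] 𝒢.pullbackSections Q :=
  LinearMap.mk₂ ℝ (pullbackBracketFun hc hQ)
    -- Linearity in the first argument is transferred from the second by skew symmetry.
    (fun σ τ υ => by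
      rw [pullbackBracketFun_swap, pullbackBracketFun_add, pullbackBracketFun_swap hc hQ σ,
        pullbackBracketFun_swap hc hQ τ]
      exact Subtype.ext (funext fun q => pullback_ext (neg_add
        (pullbackFst ((pullbackBracketFun hc hQ υ σ).1 q))
        (pullbackFst ((pullbackBracketFun hc hQ υ τ).1 q)))))
    (fun c σ τ => by
      rw [pullbackBracketFun_swap, pullbackBracketFun_smul, pullbackBracketFun_swap hc hQ σ]
      exact Subtype.ext (funext fun q => pullback_ext (smul_neg c
        (pullbackFst ((pullbackBracketFun hc hQ τ σ).1 q))).symm))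
    (pullbackBracketFun_add hc hQ) (pullbackBracketFun_smul hc hQ)

theorem pullbackBracketFun_jacobi (σ τ υ : 𝒢.pullbackSections Q) :
    pullbackBracketFun hc hQ σ (pullbackBracketFun hc hQ τ υ) =
      pullbackBracketFun hc hQ (pullbackBracketFun hc hQ σ τ) υ +
        pullbackBracketFun hc hQ τ (pullbackBracketFun hc hQ σ υ) := by
  refine Subtype.ext (funext fun q => pullback_ext ?_)
  have hσ := isAlgSection_extendSection hc σ
  have hτ := isAlgSection_extendSection hc τ
  have hυ := isAlgSection_extendSection hc υ
  -- The bracket of the extensions of `τ` and `υ` extends their bracket by construction, so it may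
  -- replace the chosen extension.
  refine (pullbackFst_bracketFun hc hQ σ _ hσ (hτ.bracket hυ) (extendSection_apply hc σ)
    (fun _ => rfl) q).trans ?_
  refine (sectionBracket_jacobi hσ hτ hυ q).trans ?_
  refine congrArg₂ (· + ·) ?_ ?_
  · exact (pullbackFst_bracketFun hc hQ _ υ (hσ.bracket hτ) hυ (fun _ => rfl)
      (extendSection_apply hc υ) q).symm
  · exact (pullbackFst_bracketFun hc hQ τ _ hτ (hσ.bracket hυ) (extendSection_apply hc τ)
      (fun _ => rfl) q).symm

theorem pullbackBracketFun_leibniz (σ τ : 𝒢.pullbackSections Q) (f : Q → ℝ)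
    (hf : SmoothOnSub (E := EM) 𝓘(ℝ, ℝ) f) (q : Q) (F : M → ℝ)
    (hF : ContMDiffAt 𝓘(ℝ, EM) 𝓘(ℝ, ℝ) ∞ F (q : M))
    (hFf : ∀ᶠ m in 𝓝 (q : M), ∀ hm : m ∈ Q, F m = f ⟨m, hm⟩) :
    (pullbackBracketFun hc hQ σ
      ⟨fun p => f p • τ.1 p, smul_mem_pullbackSections hf τ.2⟩).1 q =
      f q • (pullbackBracketFun hc hQ σ τ).1 q +
        tderiv EM ℝ F q (tderiv EG EM 𝒢.r (𝒢.u q) (pullbackFst (σ.1 q))) • τ.1 q := by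
  refine pullback_ext ?_
  set υ : 𝒢.pullbackSections Q := ⟨fun p => f p • τ.1 p, smul_mem_pullbackSections hf τ.2⟩
  refine (sectionBracket_of_eq_smul q.2 (isAlgSection_extendSection hc σ)
    (isAlgSection_extendSection hc τ) (isAlgSection_extendSection hc υ)
    (tderiv_r_extendSection_mem hc σ q.2) hF ?_).trans ?_
  · filter_upwards [hFf] with m hm hmQ
    have h1 := extendSection_apply hc υ ⟨m, hmQ⟩
    have h2 := extendSection_apply hc τ ⟨m, hmQ⟩
    rw [hm hmQ]
    exact h1.trans (congrArg (f ⟨m, hmQ⟩ • ·) h2.symm)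
  · rw [extendSection_apply, extendSection_apply, hFf.self_of_nhds q.2]
    rfl

/-- The pullback of the Lie algebroid of a groupoid along the inclusion of a closed submanifold
transverse to the anchor. -/
def pullbackAlgebroid (hT : 𝒢.AnchorTransverse Q) :
    LieAlgebroid EM Q (fun q => 𝒢.pullbackFiber Q q) where
  sections := 𝒢.pullbackSections Q
  smul_mem f hf X hX := smul_mem_pullbackSections hf hX
  mem_of_local X hX := mem_pullbackSections_of_local hX
  exists_frame := exists_pullback_frame hc hQ hT
  anchor q := LinearMap.snd ℝ _ _ ∘ₗ (𝒢.pullbackFiber Q q).subtype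
  anchor_mem q v := v.2.1.2
  anchor_smooth X hX := smoothOnSub_pullback_snd hX
  bracket := pullbackBracket hc hQ
  bracket_self σ := Subtype.ext (funext fun _ => pullback_ext (sectionBracket_self _ _))
  jacobi := pullbackBracketFun_jacobi hc hQ
  leibniz σ τ f hf q F hF hFf := by
    refine (pullbackBracketFun_leibniz hc hQ σ τ f hf q F hF hFf).trans ?_
    rw [← pullback_snd]
    rfl

theorem isPullback_pullbackAlgebroid (hT : 𝒢.AnchorTransverse Q) :
    𝒢.IsPullback Q (pullbackAlgebroid hc hQ hT) where
  mem_sections _ := ⟨fun h => ⟨h, smoothOnSub_pullback_snd h⟩, fun h => h.1⟩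
  anchor_eq _ _ := rfl
  bracket_eq σ τ _ _ hX hY hXσ hYτ q :=
    pullbackFst_bracketFun hc hQ σ τ hX hY (fun q => (hXσ q).symm) (fun q => (hYτ q).symm) q

/-- Sections, anchor and bracket are the only data of a Lie algebroid. The compatibility condition
determines the bracket completely, because every section over the closed set `Q` has a global
extension. -/
theorem IsPullback.unique (hc : IsClosed Q) {L L' : LieAlgebroid EM Q (fun q => 𝒢.pullbackFiber Q q)}
    (h : 𝒢.IsPullback Q L) (h' : 𝒢.IsPullback Q L') : L = L' := by
  have hm := h.mem_sections
  have ha := h.anchor_eq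
  have hb := h.bracket_eq
  have hm' := h'.mem_sections
  have ha' := h'.anchor_eq
  have hb' := h'.bracket_eq
  clear h h'
  obtain ⟨S, _, _, _, A, _, _, B, _, _, _⟩ := L
  obtain ⟨S', _, _, _, A', _, _, B', _, _, _⟩ := L'
  simp only at hm ha hb hm' ha' hb'
  obtain rfl : S = S' := Submodule.ext fun σ => (hm σ).trans (hm' σ).symm
  obtain rfl : A = A' := funext fun q => LinearMap.ext fun x => (ha q x).trans (ha' q x).symm
  obtain rfl : B = B' := by
    refine LinearMap.ext₂ fun σ τ => Subtype.ext (funext fun q => pullback_ext ?_)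
    obtain ⟨X, hX, hXσ⟩ := exists_isAlgSection_extension hc ((hm σ.1).1 σ.2).1
      fun q => pullback_ker (σ.1 q)
    obtain ⟨Y, hY, hYτ⟩ := exists_isAlgSection_extension hc ((hm τ.1).1 τ.2).1
      fun q => pullback_ker (τ.1 q)
    exact (hb σ τ X Y hX hY (fun q => (hXσ q).symm) (fun q => (hYτ q).symm) q).trans
      (hb' σ τ X Y hX hY (fun q => (hXσ q).symm) (fun q => (hYτ q).symm) q).symm
  rfl

end Bracket

end LieGroupoid

/-! ### Operators with bounded powers, and a fixed point criterion. -/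

section BoundedPowers

open Filter

variable {E : Type*} [NormedAddCommGroup E] [NormedSpace ℝ E]

theorem eq_zero_of_norm_nsmul_le {v : E} {C : ℝ} (h : ∀ n : ℕ, (n : ℝ) * ‖v‖ ≤ C) : v = 0 := by
  by_contra hv
  obtain ⟨n, hn⟩ := exists_nat_gt (C / ‖v‖)
  exact absurd (h n) (not_le.2 ((div_lt_iff₀ (norm_pos_iff.2 hv)).1 hn))

theorem pow_apply_of_apply_eq_self {L : E →L[ℝ] E} {v : E} (h : L v = v) (n : ℕ) :
    (L ^ n) v = v := by
  induction n with
  | zero => rfl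
  | succ n ih => rw [pow_succ, mul_apply_eq_comp, h, ih]

theorem sum_pow_apply_sub (L : E →L[ℝ] E) (v : E) (n : ℕ) :
    ∑ i ∈ Finset.range n, (L ^ i) (L v - v) = (L ^ n) v - v := by
  have : ∀ i, (L ^ i) (L v - v) = (L ^ (i + 1)) v - (L ^ i) v := fun i => by
    rw [map_sub, pow_succ]; rfl
  simp only [this]
  rw [Finset.sum_range_sub (fun i => (L ^ i) v)]
  rfl

/-- An operator with bounded powers splits the space into its fixed vectors and its
coboundaries. -/
theorem isCompl_ker_range_sub_one [FiniteDimensional ℝ E] {L : E →L[ℝ] E} {C : ℝ}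
    (hC : ∀ n, ‖L ^ n‖ ≤ C) :
    IsCompl (LinearMap.ker (L - 1).toLinearMap) (LinearMap.range (L - 1).toLinearMap) := by
  have hd : Disjoint (LinearMap.ker (L - 1).toLinearMap)
      (LinearMap.range (L - 1).toLinearMap) := by
    rw [Submodule.disjoint_def]
    rintro _ h ⟨u, rfl⟩
    -- If `v` is also fixed by `L`, telescoping gives `n v = L^n u - u`, which is bounded in `n`;
    -- hence `v = 0`. Disjointness suffices by rank and nullity.
    set v : E := L u - u with hv
    have h1 : L v - v = 0 := h
    have h2 := pow_apply_of_apply_eq_self (sub_eq_zero.1 h1)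
    refine eq_zero_of_norm_nsmul_le (C := C * ‖u‖ + ‖u‖) fun n => ?_
    have h3 := sum_pow_apply_sub L u n
    simp only [← hv, h2, Finset.sum_const, Finset.card_range] at h3
    have h4 : (n : ℝ) * ‖v‖ = ‖(L ^ n) u - u‖ := by
      rw [← h3, ← Nat.cast_smul_eq_nsmul ℝ, norm_smul, Real.norm_natCast]
    change (n : ℝ) * ‖v‖ ≤ _
    rw [h4]
    exact (norm_sub_le _ _).trans (add_le_add_left (((L ^ n).le_opNorm u).trans
      (mul_le_mul_of_nonneg_right (hC n) (norm_nonneg u))) _)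
  refine (Submodule.isCompl_iff_disjoint _ _ ?_).2 hd
  rw [add_comm, LinearMap.finrank_range_add_finrank_ker]

/-- Consider maps `F n` fixing `z`, which form a semigroup near `z`, and are uniformly close to
their derivatives `L ^ n` near `z`. Points near `z` displaced by `F 1` by a vector fixed by `L` are
fixed. -/
theorem eventually_apply_eq_self {F : ℕ → E → E} {L : E →L[ℝ] E} {z : E} {C δ : ℝ}
    (hC : ∀ n, ‖L ^ n‖ ≤ C) (hδ : 0 < δ)
    (hF : ∀ n, ∀ y ∈ Metric.ball z δ, ∀ y' ∈ Metric.ball z δ,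
      ‖F n y - F n y' - (L ^ n) (y - y')‖ ≤ 1 / 2 * ‖y - y'‖)
    (hz : ∀ n, F n z = z) (hc : ContinuousAt (F 1) z)
    (hs : ∀ᶠ y in 𝓝 z, F 0 y = y ∧ ∀ n, F n (F 1 y) = F (n + 1) y) :
    ∀ᶠ y in 𝓝 z, L (F 1 y - y) = F 1 y - y → F 1 y = y := by
  have hb := Metric.ball_mem_nhds z hδ
  have hc' : ∀ᶠ y in 𝓝 z, F 1 y ∈ Metric.ball z δ := by
    rw [ContinuousAt, hz] at hc
    exact hc hb
  filter_upwards [hs, hb, hc'] with y hy hyb hyb' hL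
  set w := F 1 y - y with hw
  have hzb : z ∈ Metric.ball z δ := Metric.mem_ball_self hδ
  have hbound : ∀ n, ‖F n y - z‖ ≤ (1 / 2 + C) * ‖y - z‖ := by
    intro n
    have h1 := hF n y hyb z hzb
    rw [hz] at h1
    calc ‖F n y - z‖ = ‖(F n y - z - (L ^ n) (y - z)) + (L ^ n) (y - z)‖ := by congr 1; abel
      _ ≤ 1 / 2 * ‖y - z‖ + C * ‖y - z‖ := (norm_add_le _ _).trans (add_le_add h1
          (((L ^ n).le_opNorm _).trans (mul_le_mul_of_nonneg_right (hC n) (norm_nonneg _))))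
      _ = _ := by ring
  -- Each step `F (n + 1) y - F n y = F n (F 1 y) - F n y` is `L^n w = w` up to `‖w‖ / 2`. Only `y`
  -- and `F 1 y` have to lie in the ball, not the whole orbit. Any constant below `1` in place of `1
  -- / 2` would leave a positive multiple of `n ‖w‖`, bounded by `hbound`.
  have hstep : ∀ n : ℕ, ‖F n y - y - (n : ℝ) • w‖ ≤ n * (1 / 2 * ‖w‖) := by
    intro n
    induction n with
    | zero => simp [hy.1]
    | succ n ih =>
      have h1 := hF n (F 1 y) hyb' y hyb
      rw [hy.2, ← hw, pow_apply_of_apply_eq_self hL] at h1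
      have h2 : F (n + 1) y - y - ((n + 1 : ℕ) : ℝ) • w =
          (F (n + 1) y - F n y - w) + (F n y - y - (n : ℝ) • w) := by
        push_cast; rw [add_smul, one_smul]; abel
      rw [h2]
      refine (norm_add_le _ _).trans ((add_le_add h1 ih).trans (le_of_eq ?_))
      push_cast; ring
  refine sub_eq_zero.1 (eq_zero_of_norm_nsmul_le
    (C := 2 * ((1 / 2 + C) * ‖y - z‖ + ‖y - z‖)) fun n => ?_)
  have h1 : ‖(n : ℝ) • w‖ ≤ ‖F n y - y - (n : ℝ) • w‖ + (‖F n y - z‖ + ‖y - z‖) := by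
    have : (n : ℝ) • w = -(F n y - y - (n : ℝ) • w) + ((F n y - z) - (y - z)) := by abel
    calc ‖(n : ℝ) • w‖ = ‖-(F n y - y - (n : ℝ) • w) + ((F n y - z) - (y - z))‖ := by
          rw [← this]
      _ ≤ _ := (norm_add_le _ _).trans (add_le_add (norm_neg _).le (norm_sub_le _ _))
  rw [norm_smul, Real.norm_natCast] at h1
  linarith [hstep n, hbound n]

end BoundedPowers

/-! ### First order estimates uniform over a compact parameter set. -/

section UniformEstimate

open Filter

variable {E : Type*} [NormedAddCommGroup E] [NormedSpace ℝ E]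
  {EK : Type*} [NormedAddCommGroup EK] [NormedSpace ℝ EK]
  {K : Type*} [TopologicalSpace K] [ChartedSpace EK K] [IsManifold 𝓘(ℝ, EK) ∞ K]

/-- The partial derivative is jointly continuous, hence within `ε / 2` of its value at `(h₀, z)` on
a product neighbourhood. Two such errors add up to `ε` in the mean value inequality on the ball. -/
theorem exists_nhds_norm_sub_sub_le {F : K × E → E} {h₀ : K} {z : E}
    (hF : ContMDiffAt (𝓘(ℝ, EK).prod 𝓘(ℝ, E)) 𝓘(ℝ, E) ∞ F (h₀, z)) {ε : ℝ} (hε : 0 < ε) :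
    ∃ O ∈ 𝓝 h₀, ∃ δ > 0, ∃ C, ∀ h ∈ O, ‖fderiv ℝ (fun y => F (h, y)) z‖ ≤ C ∧
      ∀ y ∈ Metric.ball z δ, ∀ y' ∈ Metric.ball z δ,
        ‖F (h, y) - F (h, y') - fderiv ℝ (fun y => F (h, y)) z (y - y')‖ ≤ ε * ‖y - y'‖ := by
  have : IsManifold 𝓘(ℝ, EK) 1 K := .of_le (n := ∞) (by simp)
  let D : K × E → E →L[ℝ] E := fun p => fderiv ℝ (fun y => F (p.1, y)) p.2
  have hD : ContinuousAt D (h₀, z) := by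
    have h1 := ContMDiffAt.mfderiv (I := 𝓘(ℝ, E)) (I' := 𝓘(ℝ, E))
      (J := 𝓘(ℝ, EK).prod 𝓘(ℝ, E)) (m := 0) (n := 1) (x₀ := (h₀, z))
      (fun (p : K × E) y => F (p.1, y)) (fun p => p.2)
      (ContMDiffAt.comp (g := F) ((h₀, z), z) (hF.of_le (by simp))
        ((contMDiff_fst.comp contMDiff_fst).contMDiffAt.prodMk contMDiffAt_snd))
      contMDiffAt_snd (by simp)
    have h2 : D = inTangentCoordinates 𝓘(ℝ, E) 𝓘(ℝ, E) (fun p : K × E => p.2)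
        (fun p => F (p.1, p.2)) (fun p => mfderiv 𝓘(ℝ, E) 𝓘(ℝ, E) (fun y => F (p.1, y)) p.2)
        (h₀, z) := by
      refine Eq.trans ?_ (inTangentCoordinates_model_space _ _ _ _).symm
      funext p
      exact mfderiv_eq_fderiv.symm
    rw [h2]
    exact h1.continuousAt
  have h2 : ∀ᶠ p in 𝓝 (h₀, z), DifferentiableAt ℝ (fun y => F (p.1, y)) p.2 := by
    have h3 : ContMDiffAt (𝓘(ℝ, EK).prod 𝓘(ℝ, E)) 𝓘(ℝ, E) 1 F (h₀, z) := hF.of_le (by simp)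
    filter_upwards [(contMDiffAt_iff_contMDiffAt_nhds (by simp)).1 h3] with p hp
    have h4 : ContMDiffAt 𝓘(ℝ, E) 𝓘(ℝ, E) 1 (fun y => F (p.1, y)) p.2 :=
      ContMDiffAt.comp (g := F) p.2 hp (contMDiffAt_const.prodMk contMDiffAt_id)
    exact h4.contDiffAt.differentiableAt (by simp)
  have h3 : ∀ᶠ p in 𝓝 (h₀, z), ‖D p - D (h₀, z)‖ < ε / 2 := by
    have := hD.eventually (Metric.ball_mem_nhds _ (half_pos hε))
    filter_upwards [this] with p hp
    rwa [← dist_eq_norm]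
  have h4 := h2.and h3
  rw [nhds_prod_eq, eventually_prod_iff] at h4
  obtain ⟨O, hO, B, hB, hOB⟩ := h4
  obtain ⟨δ, hδ, hδB⟩ := Metric.eventually_nhds_iff_ball.1 hB
  refine ⟨{h | O h}, hO, δ, hδ, ε / 2 + ‖D (h₀, z)‖, fun h hh => ?_⟩
  have hz := (hOB hh (hδB z (Metric.mem_ball_self hδ))).2
  refine ⟨?_, fun y hy y' hy' => ?_⟩
  · calc ‖D (h, z)‖ = ‖(D (h, z) - D (h₀, z)) + D (h₀, z)‖ := by congr 1; abel
      _ ≤ _ := (norm_add_le _ _).trans (add_le_add_left hz.le _)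
  · refine (convex_ball z δ).norm_image_sub_le_of_norm_hasFDerivWithin_le'
      (f := fun y => F (h, y)) (f' := fun y => D (h, y))
      (fun y hy => (hOB hh (hδB y hy)).1.hasFDerivAt.hasFDerivWithinAt) (fun y hy => ?_) hy' hy
    change ‖D (h, y) - D (h, z)‖ ≤ ε
    have h5 := (hOB hh (hδB y hy)).2
    calc ‖D (h, y) - D (h, z)‖ = ‖(D (h, y) - D (h₀, z)) - (D (h, z) - D (h₀, z))‖ := by
          congr 1; abel
      _ ≤ ε / 2 + ε / 2 := (norm_sub_le _ _).trans (add_le_add h5.le hz.le)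
      _ = ε := by ring

theorem IsCompact.exists_norm_sub_sub_le {F : K × E → E} {H : Set K} (hH : IsCompact H) {z : E}
    (hF : ∀ h ∈ H, ContMDiffAt (𝓘(ℝ, EK).prod 𝓘(ℝ, E)) 𝓘(ℝ, E) ∞ F (h, z)) {ε : ℝ}
    (hε : 0 < ε) :
    ∃ δ > 0, ∃ C, ∀ h ∈ H, ‖fderiv ℝ (fun y => F (h, y)) z‖ ≤ C ∧
      ∀ y ∈ Metric.ball z δ, ∀ y' ∈ Metric.ball z δ,
        ‖F (h, y) - F (h, y') - fderiv ℝ (fun y => F (h, y)) z (y - y')‖ ≤ ε * ‖y - y'‖ := by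
  refine hH.induction_on (p := fun H => ∃ δ > 0, ∃ C, ∀ h ∈ H,
    ‖fderiv ℝ (fun y => F (h, y)) z‖ ≤ C ∧ ∀ y ∈ Metric.ball z δ, ∀ y' ∈ Metric.ball z δ,
      ‖F (h, y) - F (h, y') - fderiv ℝ (fun y => F (h, y)) z (y - y')‖ ≤ ε * ‖y - y'‖)
    ⟨1, one_pos, 0, by simp⟩ ?_ ?_ ?_
  · rintro S T hST ⟨δ, hδ, C, h⟩
    exact ⟨δ, hδ, C, fun k hk => h k (hST hk)⟩
  · rintro S T ⟨δ, hδ, C, h⟩ ⟨δ', hδ', C', h'⟩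
    refine ⟨min δ δ', lt_min hδ hδ', max C C', fun k hk => ?_⟩
    rcases hk with hk | hk
    · exact ⟨(h k hk).1.trans (le_max_left _ _), fun y hy y' hy' =>
        (h k hk).2 y (Metric.ball_subset_ball (min_le_left _ _) hy) y'
          (Metric.ball_subset_ball (min_le_left _ _) hy')⟩
    · exact ⟨(h' k hk).1.trans (le_max_right _ _), fun y hy y' hy' =>
        (h' k hk).2 y (Metric.ball_subset_ball (min_le_right _ _) hy) y'
          (Metric.ball_subset_ball (min_le_right _ _) hy')⟩
  · intro h hh
    obtain ⟨O, hO, δ, hδ, C, hOC⟩ := exists_nhds_norm_sub_sub_le (hF h hh) hε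
    exact ⟨O, mem_nhdsWithin_of_mem_nhds hO, δ, hδ, C, hOC⟩

end UniformEstimate

/-! ### The action by left multiplication and its fixed set. -/

namespace LieGroupoid

open Filter

variable {EM EG EK : Type*} [NormedAddCommGroup EM] [NormedSpace ℝ EM]
  [NormedAddCommGroup EG] [NormedSpace ℝ EG] [NormedAddCommGroup EK] [NormedSpace ℝ EK]
  {M G : Type*} [TopologicalSpace M] [ChartedSpace EM M] [TopologicalSpace G] [ChartedSpace EG G]
  {𝒢 : LieGroupoid EM EG M G}

namespace Bisection

variable (γ : 𝒢.Bisection)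

theorem leftMul_unit (m : M) : γ.leftMul (𝒢.u m) = γ.sInv m := by
  rw [leftMul, 𝒢.r_unit, 𝒢.mul_unit' (γ.s_sInv m)]

theorem s_leftMul (g : G) : 𝒢.s (γ.leftMul g) = 𝒢.s g := 𝒢.s_mul _ _ (γ.s_sInv _)

theorem mem_fixedSet_iff {m : M} : m ∈ γ.fixedSet ↔ γ.sInv m = 𝒢.u m := by
  rw [← leftMul_unit]; rfl

theorem leftMul_of_mem_fixedSet {g : G} (h : 𝒢.r g ∈ γ.fixedSet) : γ.leftMul g = g := by
  rw [leftMul, γ.mem_fixedSet_iff.1 h, 𝒢.unit_mul]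

theorem isClosed_fixedSet [T2Space G] : IsClosed γ.fixedSet := by
  have : γ.fixedSet = {m | γ.sInv m = 𝒢.u m} := Set.ext fun m => γ.mem_fixedSet_iff
  rw [this]
  exact isClosed_eq γ.sInv_smooth.continuous 𝒢.u_smooth.continuous

end Bisection

namespace BisectionAction

variable {K : Type*} [TopologicalSpace K] [ChartedSpace EK K] [Group K]
  (a : 𝒢.BisectionAction EK K)

/-- The action of the group on the arrows of the groupoid, by left multiplication. -/
def act (k : K) (g : G) : G := (a.bis k).leftMul g

theorem act_one (g : G) : a.act 1 g = g := by
  obtain ⟨m, hm⟩ : (a.bis 1).sInv (𝒢.r g) ∈ Set.range 𝒢.u := a.bis_one ▸ (a.bis 1).sInv_mem _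
  have h := congrArg 𝒢.s hm
  rw [𝒢.s_unit, (a.bis 1).s_sInv] at h
  rw [act, Bisection.leftMul, ← hm, h, 𝒢.unit_mul]

theorem act_mul (k l : K) (g : G) : a.act (k * l) g = a.act k (a.act l g) := by
  obtain ⟨x, hx, y, hy, hxy, h⟩ : (a.bis (k * l)).sInv (𝒢.r g) ∈
      𝒢.mulSet (a.bis k).carrier (a.bis l).carrier := a.bis_mul k l ▸ (a.bis (k * l)).sInv_mem _
  have h1 : 𝒢.s y = 𝒢.r g := by
    rw [← 𝒢.s_mul x y hxy, ← h, (a.bis (k * l)).s_sInv]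
  have h2 : (a.bis l).sInv (𝒢.r g) = y := by rw [← h1, (a.bis l).sInv_s y hy]
  have h3 : (a.bis k).sInv (𝒢.r y) = x := by rw [← hxy, (a.bis k).sInv_s x hx]
  simp only [act, Bisection.leftMul]
  rw [h, h2, 𝒢.r_mul y g h1, h3, 𝒢.mul_assoc x y g hxy h1]

theorem s_act (k : K) (g : G) : 𝒢.s (a.act k g) = 𝒢.s g := (a.bis k).s_leftMul g

theorem act_smooth : ContMDiff (𝓘(ℝ, EK).prod 𝓘(ℝ, EG)) 𝓘(ℝ, EG) ∞
    (fun p : K × G => a.act p.1 p.2) := by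
  intro p
  refine 𝒢.contMDiffAt_mul_of_composable (a := fun p : K × G => (a.bis p.1).sInv (𝒢.r p.2))
    (b := fun p => p.2) ?_ contMDiffAt_snd (Eventually.of_forall fun p => (a.bis p.1).s_sInv _)
  have h1 : (fun p : K × G => (a.bis p.1).sInv (𝒢.r p.2)) =
      fun p => (a.bis p.1).leftMul (𝒢.u (𝒢.r p.2)) :=
    funext fun p => ((a.bis p.1).leftMul_unit _).symm
  rw [h1]
  exact (a.smooth.comp (contMDiff_fst.prodMk (𝒢.r_smooth.comp contMDiff_snd))).contMDiffAt

theorem act_smooth_right (k : K) : ContMDiff 𝓘(ℝ, EG) 𝓘(ℝ, EG) ∞ (a.act k) :=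
  a.act_smooth.comp (contMDiff_const.prodMk contMDiff_id)

theorem act_mdiff (k : K) (g : G) : MDifferentiableAt 𝓘(ℝ, EG) 𝓘(ℝ, EG) (a.act k) g :=
  (a.act_smooth_right k g).mdiff

theorem act_pow_of_act_eq {k : K} {g : G} (h : a.act k g = g) (n : ℕ) : a.act (k ^ n) g = g := by
  induction n with
  | zero => rw [pow_zero, act_one]
  | succ n ih => rw [pow_succ, act_mul, h, ih]

/-- The chain rule at a fixed point. It exhibits the powers of the isotropy operator as derivatives
of elements of the stabilizer. -/
theorem tderiv_act_pow {k : K} {g : G} (h : a.act k g = g) (n : ℕ) :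
    tderiv EG EG (a.act (k ^ n)) g = tderiv EG EG (a.act k) g ^ n := by
  induction n with
  | zero =>
    have : a.act (k ^ 0) = fun g => g := funext fun g => by rw [pow_zero, act_one]
    rw [this, tderiv_id]; rfl
  | succ n ih =>
    have : a.act (k ^ (n + 1)) = fun g => a.act (k ^ n) (a.act k g) :=
      funext fun g => by rw [pow_succ, act_mul]
    rw [this, tderiv_comp (a.act_mdiff _ _) (a.act_mdiff _ _), h, ih, pow_succ]; rfl

/-- Near a fixed unit, the isotropy action has bounded powers, and the arrows displaced by a vector
fixed by the isotropy action are fixed. -/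
theorem exists_bound_and_eventually_act_eq [IsManifold 𝓘(ℝ, EK) ∞ K] [CompactSpace K]
    [FiniteDimensional ℝ EG] [IsManifold 𝓘(ℝ, EG) ∞ G] [T2Space G] {k : K} {x : G} (hx : a.act k x = x) :
    (∃ C, ∀ n, ‖tderiv EG EG (a.act k) x ^ n‖ ≤ C) ∧
      ∀ᶠ g in 𝓝 x, tderiv EG EG (a.act k) x (chartAt EG x (a.act k g) - chartAt EG x g) =
        chartAt EG x (a.act k g) - chartAt EG x g → a.act k g = g := by
  set χ := chartAt EG x with hχ
  have hχ' : χ ∈ IsManifold.maximalAtlas 𝓘(ℝ, EG) ∞ G := IsManifold.chart_mem_maximalAtlas _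
  have hxs : x ∈ χ.source := mem_chart_source EG x
  have hxx : χ.symm (χ x) = x := χ.left_inv hxs
  let F : K × EG → EG := fun p => χ (a.act p.1 (χ.symm p.2))
  -- Only elements fixing `x` can be read near `χ x` in the single chart `χ`. The stabilizer is
  -- closed, hence compact, and contains all powers of `k`.
  let H : Set K := {h | a.act h x = x}
  have hH : IsCompact H := by
    refine (isClosed_eq ?_ continuous_const).isCompact
    exact a.act_smooth.continuous.comp (Continuous.prodMk continuous_id continuous_const)
  have hsymm : ContMDiffAt 𝓘(ℝ, EG) 𝓘(ℝ, EG) ∞ χ.symm (χ x) :=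
    contMDiffAt_symm_of_mem_maximalAtlas hχ' (χ.map_source hxs)
  have hF : ∀ h ∈ H, ContMDiffAt (𝓘(ℝ, EK).prod 𝓘(ℝ, EG)) 𝓘(ℝ, EG) ∞ F (h, χ x) := by
    intro h hh
    have h1 : ContMDiffAt (𝓘(ℝ, EK).prod 𝓘(ℝ, EG)) 𝓘(ℝ, EG) ∞
        (fun p : K × EG => a.act p.1 (χ.symm p.2)) (h, χ x) :=
      ContMDiffAt.comp (g := fun p : K × G => a.act p.1 p.2) (h, χ x) (a.act_smooth _)
        (contMDiffAt_fst.prodMk (hsymm.comp (h, χ x) contMDiffAt_snd))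
    refine ContMDiffAt.comp_of_eq (g := χ) (contMDiffAt_of_mem_maximalAtlas hχ' hxs) h1 ?_
    simp only [hxx]
    exact hh
  have hFd : ∀ h ∈ H, fderiv ℝ (fun y => F (h, y)) (χ x) = tderiv EG EG (a.act h) x := by
    intro h hh
    have hh' : a.act h x = x := hh
    have h1 : MDifferentiableAt 𝓘(ℝ, EG) 𝓘(ℝ, EG) χ (a.act h (χ.symm (χ x))) := by
      rw [hxx, hh']; exact mdifferentiableAt_chart hχ' hxs
    rw [← tderiv_eq_fderiv, tderiv_comp (E := EG) (E' := EG) (E'' := EG) (g := χ)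
      (f := fun y => a.act h (χ.symm y)) h1 ((a.act_mdiff h _).comp (χ x) hsymm.mdiff),
      tderiv_comp (E := EG) (E' := EG) (E'' := EG) (g := a.act h) (f := χ.symm)
      (a.act_mdiff h _) hsymm.mdiff, hxx, hh', hχ, tderiv_chartAt_self, tderiv_chartAt_symm_self]
    rfl
  obtain ⟨δ, hδ, C, hC⟩ := hH.exists_norm_sub_sub_le hF (ε := 1 / 2) (by norm_num)
  have hpow : ∀ n, k ^ n ∈ H := fun n => a.act_pow_of_act_eq hx n
  have hCn : ∀ n, ‖tderiv EG EG (a.act k) x ^ n‖ ≤ C := fun n => by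
    rw [← a.tderiv_act_pow hx, ← hFd _ (hpow n)]
    exact (hC _ (hpow n)).1
  refine ⟨⟨C, hCn⟩, ?_⟩
  have hcont : ContinuousAt (fun y => a.act k (χ.symm y)) (χ x) :=
    (a.act_smooth_right k).continuous.continuousAt.comp hsymm.continuousAt
  have key := eventually_apply_eq_self (F := fun n y => F (k ^ n, y))
    (L := tderiv EG EG (a.act k) x) (z := χ x) hCn hδ (fun n => by
      have h1 := (hC _ (hpow n)).2
      rwa [hFd _ (hpow n), a.tderiv_act_pow hx] at h1)
    (fun n => by
      have h1 : a.act (k ^ n) x = x := hpow n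
      simp only [F, hxx, h1])
    (by
      have h1 : (fun y => F (k ^ 1, y)) = fun y => χ (a.act k (χ.symm y)) := by
        simp only [F, pow_one]
      rw [h1]
      refine ContinuousAt.comp (g := χ) ?_ hcont
      rw [hxx, hx]
      exact χ.continuousAt hxs)
    (by
      have h1 : ∀ᶠ y in 𝓝 (χ x), a.act k (χ.symm y) ∈ χ.source := by
        refine hcont.eventually (χ.open_source.mem_nhds ?_)
        simp only [hxx, hx]
        exact hxs
      filter_upwards [h1, χ.open_target.mem_nhds (χ.map_source hxs)] with y hy hyt
      refine ⟨?_, fun n => ?_⟩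
      · simp only [F, pow_zero, act_one, χ.right_inv hyt]
      · simp only [F, pow_succ, pow_zero, act_mul, act_one, χ.left_inv hy])
  filter_upwards [(χ.continuousAt hxs).eventually key, χ.open_source.mem_nhds hxs,
    (a.act_smooth_right k).continuous.continuousAt.eventually
      (χ.open_source.mem_nhds (show a.act k x ∈ χ.source by rwa [hx]))] with g hg hgs hgs' hL
  simp only [F, pow_one, χ.left_inv hgs] at hg
  exact χ.injOn hgs' hgs (hg hL)

section FixedSet

variable [IsManifold 𝓘(ℝ, EK) ∞ K] [CompactSpace K] [FiniteDimensional ℝ EM]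
  [FiniteDimensional ℝ EG] [IsManifold 𝓘(ℝ, EM) ∞ M] [IsManifold 𝓘(ℝ, EG) ∞ G] [T2Space G]

/-- Left multiplication fixes pointwise the `r`-fibre over a fixed point, and `ker Tr` consists of
velocities of curves in that fibre. -/
theorem tderiv_act_of_mem_ker {k : K} {m : M} (hm : m ∈ (a.bis k).fixedSet) {v : EG}
    (hv : tderiv EG EM 𝒢.r (𝒢.u m) v = 0) : tderiv EG EG (a.act k) (𝒢.u m) v = v := by
  obtain ⟨c, h0, hc, hcv, hr⟩ := (𝒢.r_submersion.isSubmersionAt (𝒢.u m)).exists_curve hv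
  rw [← hcv, ← h0, ← tderiv_comp_apply (a.act_mdiff k _) hc, tderiv_congr (g := c)]
  filter_upwards [hr] with t ht
  refine (a.bis k).leftMul_of_mem_fixedSet ?_
  rwa [ht, 𝒢.r_unit]

theorem tderiv_s_act {k : K} {x : G} (hx : a.act k x = x) (v : EG) :
    tderiv EG EM 𝒢.s x (tderiv EG EG (a.act k) x v) = tderiv EG EM 𝒢.s x v := by
  have h := tderiv_comp_apply (g := 𝒢.s) (f := a.act k) (x := x) (𝒢.s_mdiff _) (a.act_mdiff k x) v
  simp only [a.s_act, hx] at h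
  exact h.symm

/-- The fixed set is an embedded submanifold near each of its points, and the anchor is transverse
to it. -/
theorem exists_chart_fixedSet {k : K} {m₀ : M} (hm₀ : m₀ ∈ (a.bis k).fixedSet) :
    (∃ φ ∈ IsManifold.maximalAtlas 𝓘(ℝ, EM) ∞ M, m₀ ∈ φ.source ∧ ∃ V : Submodule ℝ EM,
      ∀ y ∈ φ.source, y ∈ (a.bis k).fixedSet ↔ φ y ∈ V) ∧
    ∀ v : EM, ∃ α : EG, tderiv EG EM 𝒢.s (𝒢.u m₀) α = 0 ∧
      v - tderiv EG EM 𝒢.r (𝒢.u m₀) α ∈ tangentSub EM (a.bis k).fixedSet m₀ := by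
  set x := 𝒢.u m₀ with hxdef
  have hx : a.act k x = x := hm₀
  obtain ⟨⟨C, hC⟩, hev⟩ := a.exists_bound_and_eventually_act_eq hx
  set L := tderiv EG EG (a.act k) x with hL
  have hcompl := isCompl_ker_range_sub_one hC
  set P := LinearMap.ker (L - 1).toLinearMap with hP
  set R := LinearMap.range (L - 1).toLinearMap with hR
  have hPmem : ∀ v, v ∈ P ↔ L v = v := fun v => by
    rw [hP, LinearMap.mem_ker]
    exact sub_eq_zero
  let π : EG →L[ℝ] R := LinearMap.toContinuousLinearMap (R.projectionOnto P hcompl.symm)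
  have hπ0 : ∀ v, π v = 0 ↔ v ∈ P := fun v => by simp [π]
  have hπ1 : ∀ v : R, π v = v := fun v => by simp [π]
  set χ := chartAt EG x with hχ
  have hχ' : χ ∈ IsManifold.maximalAtlas 𝓘(ℝ, EG) ∞ G := IsManifold.chart_mem_maximalAtlas _
  have hxs : x ∈ χ.source := mem_chart_source EG x
  -- `v - Tu (Tr v)` lies in `ker Tr`, where `L` is the identity. So `L - 1` factors through the
  -- projection `Tu ∘ Tr` to the tangent space of the units.
  have hLu : ∀ v, L (tderiv EM EG 𝒢.u m₀ (tderiv EG EM 𝒢.r x v)) -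
      tderiv EM EG 𝒢.u m₀ (tderiv EG EM 𝒢.r x v) = L v - v := by
    intro v
    have h1 : L (v - tderiv EM EG 𝒢.u m₀ (tderiv EG EM 𝒢.r x v)) =
        v - tderiv EM EG 𝒢.u m₀ (tderiv EG EM 𝒢.r x v) :=
      a.tderiv_act_of_mem_ker hm₀ (by rw [map_sub, 𝒢.tderiv_r_u, sub_self])
    rw [map_sub] at h1
    have h2 := sub_eq_sub_iff_sub_eq_sub.1 h1
    exact h2.symm
  obtain ⟨O, hOev, hO, hxO⟩ := mem_nhds_iff.1 hev
  let W : Set G := (χ.source ∩ a.act k ⁻¹' χ.source) ∩ O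
  have hW : IsOpen W := (χ.open_source.inter
    (χ.open_source.preimage (a.act_smooth_right k).continuous)).inter hO
  have hxW : x ∈ W := ⟨⟨hxs, by simpa [hx] using hxs⟩, hxO⟩
  -- Only the `R`-component of the displacement is kept: with values in `EG` the map would in
  -- general not be a submersion, while near `x` a displacement in `P` already forces the unit to be
  -- fixed.
  let f : M → R := fun m => π (χ (a.act k (𝒢.u m)) - χ (𝒢.u m))
  have hf : ContMDiffOn 𝓘(ℝ, EM) 𝓘(ℝ, R) ∞ f (𝒢.u ⁻¹' W) := by
    intro m hm
    have h1 : ContMDiffAt 𝓘(ℝ, EM) 𝓘(ℝ, EG) ∞ (fun m => χ (a.act k (𝒢.u m))) m :=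
      (contMDiffAt_of_mem_maximalAtlas hχ' hm.1.2).comp m
        ((a.act_smooth_right k _).comp m (𝒢.u_smooth m))
    have h2 : ContMDiffAt 𝓘(ℝ, EM) 𝓘(ℝ, EG) ∞ (fun m => χ (𝒢.u m)) m :=
      (contMDiffAt_of_mem_maximalAtlas hχ' hm.1.1).comp m (𝒢.u_smooth m)
    exact (π.contDiff.contMDiff.contMDiffAt.comp m (h1.sub h2)).contMDiffWithinAt
  have hfd : ∀ v, tderiv EM R f m₀ v =
      π (L (tderiv EM EG 𝒢.u m₀ v) - tderiv EM EG 𝒢.u m₀ v) := by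
    intro v
    let Ψ : G → R := fun g => π (χ (a.act k g) - χ g)
    have h1 : HasMFDerivAt 𝓘(ℝ, EG) 𝓘(ℝ, EG) χ x (ContinuousLinearMap.id ℝ EG) := by
      have := (mdifferentiableAt_chart hχ' hxs).hasMFDerivAt
      rwa [show mfderiv 𝓘(ℝ, EG) 𝓘(ℝ, EG) χ x = _ from tderiv_chartAt_self x] at this
    have h1' : HasMFDerivAt 𝓘(ℝ, EG) 𝓘(ℝ, EG) χ (a.act k x) (ContinuousLinearMap.id ℝ EG) := by
      rw [hx]; exact h1
    have h2 : HasMFDerivAt 𝓘(ℝ, EG) 𝓘(ℝ, EG) (fun g => χ (a.act k g)) x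
        ((ContinuousLinearMap.id ℝ EG).comp L) := h1'.comp x (a.act_mdiff k x).hasMFDerivAt
    have h3 : HasMFDerivAt 𝓘(ℝ, EG) 𝓘(ℝ, R) Ψ x
        (π.comp ((ContinuousLinearMap.id ℝ EG).comp L - ContinuousLinearMap.id ℝ EG)) :=
      HasMFDerivAt.comp x (g := π) π.hasMFDerivAt (h2.sub h1)
    have h4 := tderiv_comp_apply (g := Ψ) (f := 𝒢.u) (x := m₀) h3.mdifferentiableAt
      (𝒢.u_mdiff m₀) v
    refine h4.trans ?_
    rw [h3.tderiv_eq]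
    rfl
  have hsurj : Function.Surjective (tderiv EM R f m₀) := by
    rintro ⟨_, v, rfl⟩
    refine ⟨tderiv EG EM 𝒢.r x v, ?_⟩
    rw [hfd, hLu]
    exact hπ1 ⟨(L - 1) v, v, rfl⟩
  have hzero : ∀ m ∈ 𝒢.u ⁻¹' W, m ∈ (a.bis k).fixedSet ↔ f m = 0 := by
    intro m hm
    constructor
    · intro h
      have h1 : a.act k (𝒢.u m) = 𝒢.u m := h
      simp only [f, h1, sub_self, map_zero]
    · intro h
      exact hOev hm.2 ((hPmem _).1 ((hπ0 _).1 h))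
  obtain ⟨φ, hφ, hφm, V, hV, hker⟩ := exists_chart_of_zero_set
    (hW.preimage 𝒢.u_smooth.continuous) hxW hf hsurj hzero
  refine ⟨⟨φ, hφ, hφm, V, hV⟩, fun v => ?_⟩
  obtain ⟨p, hp, α, ⟨w, rfl⟩, hpα⟩ := Submodule.mem_sup.1
    (show tderiv EM EG 𝒢.u m₀ v ∈ P ⊔ R by rw [hcompl.sup_eq_top]; exact Submodule.mem_top)
  -- `(L - 1) w` lies in `ker Ts` because the action preserves sources. The remainder is `Tr p`,
  -- which the derivative of `f` kills: by `hLu` its value is `π ((L - 1) p)`, and `p` is fixed by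
  -- `L`.
  refine ⟨L w - w, ?_, (mem_tangentSub_iff hφ hV hφm hm₀).2 (hker _ ?_)⟩
  · rw [map_sub, hL, a.tderiv_s_act hx, sub_self]
  · have h1 : v - tderiv EG EM 𝒢.r x (L w - w) = tderiv EG EM 𝒢.r x p := by
      have h2 := congrArg (tderiv EG EM 𝒢.r x) hpα
      rw [map_add, 𝒢.tderiv_r_u] at h2
      rw [← h2]
      exact add_sub_cancel_right _ _
    rw [h1, hfd, hLu, (hPmem p).1 hp, sub_self, map_zero]

theorem isEmbeddedSubmanifold_fixedSet (k : K) :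
    IsEmbeddedSubmanifold EM (a.bis k).fixedSet :=
  fun _ hm => (a.exists_chart_fixedSet hm).1

theorem anchorTransverse_fixedSet (k : K) : 𝒢.AnchorTransverse (a.bis k).fixedSet := by
  intro m hm
  rw [eq_top_iff]
  intro v _
  obtain ⟨α, hα, hv⟩ := (a.exists_chart_fixedSet hm).2 v
  refine Submodule.mem_sup.2 ⟨_, ⟨⟨α, hα⟩, rfl⟩, _, hv, ?_⟩
  exact add_sub_cancel (tderiv EG EM 𝒢.r (𝒢.u m) α) (v : EM)

end FixedSet

end BisectionAction

end LieGroupoid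

end

theorem propositionp
    {EM EG EK : Type*}
    [NormedAddCommGroup EM] [NormedSpace ℝ EM] [FiniteDimensional ℝ EM]
    [NormedAddCommGroup EG] [NormedSpace ℝ EG] [FiniteDimensional ℝ EG]
    [NormedAddCommGroup EK] [NormedSpace ℝ EK] [FiniteDimensional ℝ EK]
    {M : Type*} [TopologicalSpace M] [ChartedSpace EM M] [IsManifold 𝓘(ℝ, EM) ∞ M]
    [T2Space M] [CompactSpace M]
    {G : Type*} [TopologicalSpace G] [ChartedSpace EG G] [IsManifold 𝓘(ℝ, EG) ∞ G]
    [T2Space G]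
    (𝒢 : LieGroupoid EM EG M G)
    {K : Type*} [TopologicalSpace K] [ChartedSpace EK K] [Group K] [LieGroup 𝓘(ℝ, EK) ∞ K]
    [T2Space K] [CompactSpace K]
    (a : 𝒢.BisectionAction EK K) (γ : K) :
    IsEmbeddedSubmanifold EM (a.bis γ).fixedSet ∧
    𝒢.AnchorTransverse (a.bis γ).fixedSet ∧
    ∃! L : LieAlgebroid EM (a.bis γ).fixedSet
        (fun q => 𝒢.pullbackFiber (a.bis γ).fixedSet q),
      𝒢.IsPullback (a.bis γ).fixedSet L := by
  have hc := (a.bis γ).isClosed_fixedSet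
  have hQ := a.isEmbeddedSubmanifold_fixedSet γ
  have hT := a.anchorTransverse_fixedSet γ
  exact ⟨hQ, hT, LieGroupoid.pullbackAlgebroid hc hQ hT,
    LieGroupoid.isPullback_pullbackAlgebroid hc hQ hT,
    fun _ h => h.unique hc (LieGroupoid.isPullback_pullbackAlgebroid hc hQ hT)⟩
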